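/- **Theorem 1 (Semiparametric efficiency bound).** Setting. A unit has covariates $X\in\mathbb R^m$, unobserved confounders $U$ (everything unobserved that influences treatment and outcome), a binary instrument $Z$, potential treatments $A(z)\in\{0,1\}$ and potential outcomes $Y(a,z)\in\mathbb R$ that are functions of $(X,U)$, and square-integrable potential outcomes $Y(a)$. One observes $(X,Z,A,Y)$ with $A=A(Z)$ and $Y=Y(A,Z)$; let $P$ be the law of $(X,Z,A,Y)$, and let $\tau=\mathbb E[Y(1)]-\mathbb E[Y(0)]$ be the average treatment effect (ATE). Assume * (exclusion) $Y(a,z)=Y(a)$ almost surely; (independence) $Z\perp U\mid X$; (relevance) $\mathrm{Cov}(Z,A\mid X)\neq 0$ almost surely; * (unconfounded compliance) $Y(1)-Y(0)\perp A(1)-A(0)\mid X$; * the instrument follows a fixed policy: $\Pr(Z=1\mid X)=\pi(X)$. Notation. For a law $Q$ of $(X,Z,A,Y)$ let $\mu^Y_Q(z,x)=\mathbb E_Q[Y\mid Z=z,X=x]$, $\mu^A_Q(z,x)=\mathbb E_Q[A\mid Z=z,X=x]$, $\delta^Y_Q=\mu^Y_Q(1,\cdot)-\mu^Y_Q(0,\cdot)$,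 $\delta^A_Q=\mu^A_Q(1,\cdot)-\mu^A_Q(0,\cdot)$, $\delta_Q=\delta^Y_Q/\delta^A_Q$ and $\Psi(Q)=\mathbb E_Q[\delta_Q(X)]$. The subscript is dropped for $Q=P$. Put $\sigma^2(z,x)=\mathrm{Var}(Y-A\delta(X)\mid Z=z,X=x)$. The nonparametric model $\mathcal M$ consists of all laws $Q$ of $(X,Z,A,Y)$ with $\mathbb E_Q[Y^2]<\infty$, $0<Q(Z=1\mid X)<1$ and $\delta^A_Q(X)\ne0$ $Q$-almost surely, and $\delta_Q(X)$ $Q$-integrable; $\mathcal M_\pi\subset\mathcal M$ is the submodel of those with $Q(Z=1\mid X)=\pi(X)$ $Q$-almost surely. A regular parametric submodel through $P$ is a family $(P_t)_{t\in\mathbb R}$ with $P_0=P$ that for all small $t$ lies in the model, is absolutely continuous with respect to $P$ and has $\chi^2(P_t\,\|\,P)\le Ct^2$ for some constant $C$; that is differentiable in quadratic mean at $t=0$ with score $s\in L^2(P)$, i.e. $\int(\sqrt{dP_t/dP}-1-\tfrac t2 s)^2\,dP=o(t^2)$; that has positive Fisher information $\mathbb E_P[s^2]$; along which $t\mapsto\Psi(P_t)$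 is differentiable at $0$; and for which there is $c>0$ such that for all small $t$, $P_t$-almost surely, $|\delta^A_{P_t}(X)|\ge c\,|\delta^A_P(X)|$ and $P_t(Z=z\mid X)\ge c\,P(Z=z\mid X)$ for $z=0,1$. The semiparametric efficiency bound at $P$ is the supremum over these submodels of the Cramér–Rao bound $\big(\tfrac{d}{dt}\Psi(P_t)|_{t=0}\big)^2/\mathbb E_P[s^2]$ (the supremum of the empty set being $0$). Conclusion. The ATE is identified, $\tau=\Psi(P)$, and the semiparametric efficiency bound at $P$ for estimating it, both in the model $\mathcal M_\pi$ with known policy $\pi$ and in the model $\mathcal M$, equals $$V_{\mathrm{eff}}(\pi)=\mathbb E\left[\frac1{\delta^A(X)^2}\left(\frac{\sigma^2(1,X)}{\pi(X)}+\frac{\sigma^2(0,X)}{1-\pi(X)}\right)+(\delta(X)-\tau)^2\right]\in[0,\infty],$$ as an identity in $[0,\infty]$. -/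

import Mathlib

open MeasureTheory ProbabilityTheory Filter Topology
open scoped ENNReal

noncomputable section

/-- The numerical value of a binary variable: `true` is `1`, `false` is `0`. -/
def bit (b : Bool) : ℝ := if b then 1 else 0

/-! ### The experiment: covariates, instrument, potential treatments, potential outcomes -/

/-- One unit of an experiment with noncompliance. `X` are the covariates, `U` the unobserved
confounders, `Z` the binary instrument, `treat z` the potential treatment `A(z)`, `outcome a z` the
potential outcome `Y(a, z)` and `po a` the potential outcome `Y(a)`. The variable `U` collects
everything unobserved that influences treatment and outcome: `A(z)` and `Y(a, z)` are functions of
`(X, U)`. No restriction is placed on the space in which `U` lives. -/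
structure IVExperiment (m : ℕ) (Ω 𝒰 : Type*) [MeasurableSpace Ω] [MeasurableSpace 𝒰] where
  X : Ω → EuclideanSpace ℝ (Fin m)
  U : Ω → 𝒰
  Z : Ω → Bool
  treat : Bool → Ω → Bool
  outcome : Bool → Bool → Ω → ℝ
  po : Bool → Ω → ℝ
  measurable_X : Measurable X
  measurable_U : Measurable U
  measurable_Z : Measurable Z
  measurable_po : ∀ a, Measurable (po a)
  treat_eq : ∀ z, ∃ g : EuclideanSpace ℝ (Fin m) × 𝒰 → Bool, Measurable g ∧
    treat z = fun ω => g (X ω, U ω)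
  outcome_eq : ∀ a z, ∃ g : EuclideanSpace ℝ (Fin m) × 𝒰 → ℝ, Measurable g ∧
    outcome a z = fun ω => g (X ω, U ω)

/-- The space of observations `((X, Z), (A, Y))`. -/
abbrev Obs (m : ℕ) : Type := (EuclideanSpace ℝ (Fin m) × Bool) × (Bool × ℝ)

namespace IVExperiment

variable {m : ℕ} {Ω 𝒰 : Type*} [MeasurableSpace Ω] [MeasurableSpace 𝒰]

/-- The realized treatment `A = A(Z)`. -/
def A (E : IVExperiment m Ω 𝒰) (ω : Ω) : Bool := E.treat (E.Z ω) ω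

/-- The realized outcome `Y = Y(A, Z)`. -/
def Y (E : IVExperiment m Ω 𝒰) (ω : Ω) : ℝ := E.outcome (E.A ω) (E.Z ω) ω

/-- The observation `((X, Z), (A, Y))`. -/
def obs (E : IVExperiment m Ω 𝒰) (ω : Ω) : Obs m := ((E.X ω, E.Z ω), (E.A ω, E.Y ω))

theorem measurable_treat (E : IVExperiment m Ω 𝒰) (z : Bool) : Measurable (E.treat z) := by
  obtain ⟨g, hg, h⟩ := E.treat_eq z
  rw [h]
  exact hg.comp (E.measurable_X.prodMk E.measurable_U)

theorem measurable_outcome (E : IVExperiment m Ω 𝒰) (a z : Bool) :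
    Measurable (E.outcome a z) := by
  obtain ⟨g, hg, h⟩ := E.outcome_eq a z
  rw [h]
  exact hg.comp (E.measurable_X.prodMk E.measurable_U)

theorem measurable_A (E : IVExperiment m Ω 𝒰) : Measurable E.A := by
  have h : Measurable (fun p : Bool × Ω => E.treat p.1 p.2) :=
    measurable_from_prod_countable_right fun z => E.measurable_treat z
  exact h.comp (E.measurable_Z.prodMk measurable_id)

theorem measurable_Y (E : IVExperiment m Ω 𝒰) : Measurable E.Y := by
  have h : Measurable (fun p : (Bool × Bool) × Ω => E.outcome p.1.1 p.1.2 p.2) :=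
    measurable_from_prod_countable_right fun z => E.measurable_outcome z.1 z.2
  exact h.comp ((E.measurable_A.prodMk E.measurable_Z).prodMk measurable_id)

theorem measurable_obs (E : IVExperiment m Ω 𝒰) : Measurable E.obs :=
  (E.measurable_X.prodMk E.measurable_Z).prodMk (E.measurable_A.prodMk E.measurable_Y)

/-- The law of the observation. -/
def obsLaw (E : IVExperiment m Ω 𝒰) (μ : Measure Ω) [IsProbabilityMeasure μ] :
    ProbabilityMeasure (Obs m) :=
  ⟨μ.map E.obs, Measure.isProbabilityMeasure_map E.measurable_obs.aemeasurable⟩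

/-- The σ-algebra generated by the covariates. -/
abbrev sigmaX (E : IVExperiment m Ω 𝒰) : MeasurableSpace Ω := MeasurableSpace.comap E.X inferInstance

theorem sigmaX_le (E : IVExperiment m Ω 𝒰) : E.sigmaX ≤ ‹MeasurableSpace Ω› :=
  E.measurable_X.comap_le

/-- The average treatment effect `E[Y(1)] - E[Y(0)]`. -/
def ate (E : IVExperiment m Ω 𝒰) (μ : Measure Ω) : ℝ :=
  (∫ ω, E.po true ω ∂μ) - ∫ ω, E.po false ω ∂μ

/-- The conditional covariance `Cov(Z, A | X)`. -/
def condCovZA (E : IVExperiment m Ω 𝒰) (μ : Measure Ω) : Ω → ℝ :=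
  μ[fun ω => (bit (E.Z ω) - (μ[fun ω' => bit (E.Z ω') | E.sigmaX]) ω) *
      (bit (E.A ω) - (μ[fun ω' => bit (E.A ω') | E.sigmaX]) ω) | E.sigmaX]

/-- The standard instrumental variable assumptions: exclusion `Y(a, z) = Y(a)`, independence
`Z ⫫ U | X`, and relevance `Cov(Z, A | X) ≠ 0` for almost every `X`. -/
structure StandardIV (E : IVExperiment m Ω 𝒰) (μ : Measure Ω) [IsProbabilityMeasure μ]
    [StandardBorelSpace Ω] : Prop where
  exclusion : ∀ a z, E.outcome a z =ᵐ[μ] E.po a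
  independence : CondIndepFun E.sigmaX E.sigmaX_le E.Z E.U μ
  relevance : ∀ᵐ ω ∂μ, E.condCovZA μ ω ≠ 0

/-- Unconfounded compliance: `Y(1) - Y(0) ⫫ A(1) - A(0) | X`. -/
def UnconfoundedCompliance (E : IVExperiment m Ω 𝒰) (μ : Measure Ω) [IsProbabilityMeasure μ]
    [StandardBorelSpace Ω] : Prop :=
  CondIndepFun E.sigmaX E.sigmaX_le (fun ω => E.po true ω - E.po false ω)
    (fun ω => bit (E.treat true ω) - bit (E.treat false ω)) μ

/-- The instrument is assigned by the policy `π`: the conditional probability of `Z = 1` given `X`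
is `π(X)`. -/
def FollowsPolicy (E : IVExperiment m Ω 𝒰) (μ : Measure Ω)
    (π : EuclideanSpace ℝ (Fin m) → ℝ) : Prop :=
  μ[fun ω => bit (E.Z ω) | E.sigmaX] =ᵐ[μ] fun ω => π (E.X ω)

end IVExperiment

/-! ### Functionals of the law of an observation -/

namespace ObsLaw

variable {m : ℕ}

/-- The law of the covariates `X`. -/
def lawX (P : ProbabilityMeasure (Obs m)) : Measure (EuclideanSpace ℝ (Fin m)) :=
  (P : Measure (Obs m)).fst.fst

/-- The conditional probability of `Z = z` given `X = x`. -/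
def propensity (P : ProbabilityMeasure (Obs m)) (z : Bool) (x : EuclideanSpace ℝ (Fin m)) : ℝ :=
  ((P : Measure (Obs m)).fst.condKernel x).real {z}

/-- The conditional law of `(A, Y)` given `Z = z` and `X = x`. -/
def condAY (P : ProbabilityMeasure (Obs m)) (z : Bool) (x : EuclideanSpace ℝ (Fin m)) :
    Measure (Bool × ℝ) :=
  (P : Measure (Obs m)).condKernel (x, z)

/-- `μ^Y(z, x) = E[Y | Z = z, X = x]`. -/
def muY (P : ProbabilityMeasure (Obs m)) (z : Bool) (x : EuclideanSpace ℝ (Fin m)) : ℝ :=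
  ∫ q, q.2 ∂(condAY P z x)

/-- `μ^A(z, x) = E[A | Z = z, X = x]`. -/
def muA (P : ProbabilityMeasure (Obs m)) (z : Bool) (x : EuclideanSpace ℝ (Fin m)) : ℝ :=
  ∫ q, bit q.1 ∂(condAY P z x)

/-- `δ^Y(x) = μ^Y(1, x) - μ^Y(0, x)`. -/
def deltaY (P : ProbabilityMeasure (Obs m)) (x : EuclideanSpace ℝ (Fin m)) : ℝ :=
  muY P true x - muY P false x

/-- The compliance score `δ^A(x) = μ^A(1, x) - μ^A(0, x)`. -/
def deltaA (P : ProbabilityMeasure (Obs m)) (x : EuclideanSpace ℝ (Fin m)) : ℝ :=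
  muA P true x - muA P false x

/-- `δ(x) = δ^Y(x) / δ^A(x)`. -/
def delta (P : ProbabilityMeasure (Obs m)) (x : EuclideanSpace ℝ (Fin m)) : ℝ :=
  deltaY P x / deltaA P x

/-- The estimand `E[δ^Y(X) / δ^A(X)]` as a functional of the law of an observation. -/
def ivFunctional (P : ProbabilityMeasure (Obs m)) : ℝ := ∫ x, delta P x ∂(lawX P)

/-- `σ²(z, x) = Var(Y - A δ(X) | Z = z, X = x)`. -/
def sigmaSq (P : ProbabilityMeasure (Obs m)) (z : Bool) (x : EuclideanSpace ℝ (Fin m)) : ℝ :=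
  variance (fun q : Bool × ℝ => q.2 - bit q.1 * delta P x) (condAY P z x)

/-- `V_eff(π)`, the expectation of a nonnegative function of `X`, with values in `[0, ∞]`. -/
def vEff (P : ProbabilityMeasure (Obs m)) (π : EuclideanSpace ℝ (Fin m) → ℝ) (τ : ℝ) : ℝ≥0∞ :=
  ∫⁻ x, ENNReal.ofReal
    (1 / (deltaA P x) ^ 2 * (sigmaSq P true x / π x + sigmaSq P false x / (1 - π x)) +
      (delta P x - τ) ^ 2) ∂(lawX P)

/-- The nonparametric model for the law of `(X, Z, A, Y)`: all laws with a square integrable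
outcome for which both values of the instrument have positive probability given `X`, the instrument
is relevant, and the estimand is well defined. -/
def nonparametricModel (m : ℕ) : Set (ProbabilityMeasure (Obs m)) :=
  {P | MemLp (fun o : Obs m => o.2.2) 2 (P : Measure (Obs m)) ∧
    (∀ z, ∀ᵐ x ∂(lawX P), 0 < propensity P z x) ∧
    (∀ᵐ x ∂(lawX P), deltaA P x ≠ 0) ∧
    Integrable (delta P) (lawX P)}

/-- The model with a fixed, known instrument policy: the laws of the nonparametric model in which
`Z = 1` has conditional probability `π(X)` given `X`, and which are otherwise unrestricted. -/
def fixedPolicyModel (π : EuclideanSpace ℝ (Fin m) → ℝ) : Set (ProbabilityMeasure (Obs m)) :=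
  {P | P ∈ nonparametricModel m ∧ ∀ᵐ x ∂(lawX P), propensity P true x = π x}

/-- Overlap and relevance hold locally uniformly along the path: for small `t` the conditional
probabilities of both instrument values and the absolute compliance score under `p t` are at least a
fixed positive fraction of what they are under `P`. -/
def LocallyUniformStrength (P : ProbabilityMeasure (Obs m))
    (p : ℝ → ProbabilityMeasure (Obs m)) : Prop :=
  ∃ c : ℝ, 0 < c ∧ ∀ᶠ t in 𝓝 (0 : ℝ), ∀ᵐ x ∂(lawX (p t)),
    c * |deltaA P x| ≤ |deltaA (p t) x| ∧ ∀ z, c * propensity P z x ≤ propensity (p t) z x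

end ObsLaw

/-! ### Regular parametric submodels and the semiparametric efficiency bound -/

/-- The likelihood ratio `dQ / dP`, for `Q` absolutely continuous with respect to `P`. -/
def likelihoodRatio {𝒪 : Type*} [MeasurableSpace 𝒪] (Q P : ProbabilityMeasure 𝒪) (o : 𝒪) : ℝ :=
  ((Q : Measure 𝒪).rnDeriv (P : Measure 𝒪) o).toReal

/-- The path `t ↦ p t` passes through `P` at `t = 0`, is differentiable in quadratic mean there,
with score `s`, and its chi-square divergence from `P` is of order `t ^ 2`. -/
structure IsRegularPath {𝒪 : Type*} [MeasurableSpace 𝒪] (P : ProbabilityMeasure 𝒪)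
    (p : ℝ → ProbabilityMeasure 𝒪) (s : 𝒪 → ℝ) : Prop where
  at_zero : p 0 = P
  absolutelyContinuous : ∀ᶠ t in 𝓝 (0 : ℝ), (p t : Measure 𝒪) ≪ (P : Measure 𝒪)
  memLp_score : MemLp s 2 (P : Measure 𝒪)
  quadraticMean : Tendsto
    (fun t : ℝ => (∫⁻ o, ENNReal.ofReal
      ((Real.sqrt (likelihoodRatio (p t) P o) - 1 - t / 2 * s o) ^ 2) ∂(P : Measure 𝒪)) /
        ENNReal.ofReal (t ^ 2))
    (𝓝[≠] 0) (𝓝 0)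
  chiSquare : ∃ C : ℝ, ∀ᶠ t in 𝓝 (0 : ℝ),
    ∫⁻ o, ENNReal.ofReal ((likelihoodRatio (p t) P o - 1) ^ 2) ∂(P : Measure 𝒪) ≤
      ENNReal.ofReal (C * t ^ 2)

/-- The semiparametric efficiency bound at `P` for the functional `Ψ` in the model `M`: the supremum
of the Cramér-Rao bounds `(dΨ(P_t)/dt)² / I` at `t = 0` over the regular one-parameter submodels of
`M` through `P` that have positive Fisher information `I = E[s²]` and along which `Ψ` is
differentiable. The submodels are further required to satisfy the local regularity condition `R`. -/
def efficiencyBound {𝒪 : Type*} [MeasurableSpace 𝒪] (M : Set (ProbabilityMeasure 𝒪))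
    (R : (ℝ → ProbabilityMeasure 𝒪) → Prop) (Ψ : ProbabilityMeasure 𝒪 → ℝ)
    (P : ProbabilityMeasure 𝒪) : ℝ≥0∞ :=
  sSup {b : ℝ≥0∞ | ∃ (p : ℝ → ProbabilityMeasure 𝒪) (s : 𝒪 → ℝ) (d : ℝ),
    IsRegularPath P p s ∧ (∀ᶠ t in 𝓝 (0 : ℝ), p t ∈ M) ∧ R p ∧
    HasDerivAt (fun t => Ψ (p t)) d 0 ∧ 0 < ∫ o, s o ^ 2 ∂(P : Measure 𝒪) ∧
    b = ENNReal.ofReal (d ^ 2 / ∫ o, s o ^ 2 ∂(P : Measure 𝒪))}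

end

/-!
The efficient influence function is the sum of two orthogonal parts: the residual `Y - A δ(X)`,
centered given `(Z, X)`, signed by the instrument and divided by propensity and compliance score
(`weightedResid`), and `δ(X) - τ`. Its second moment in `[0, ∞]` is the variance bound
(`vEff_eq_lintegral`).

*Derivative along a regular path.* For two laws `P`, `Q` of the model, `Ψ(Q) - Ψ(P)` equals exactly
the `Q`-mean of `δ_P(X) - Ψ(P)` plus the `Q`-mean of the residual built from `P` but carrying the
weights of `Q` (`integral_mul_weightedResid_mul_weightRatio`). Replacing the weights of `Q = P_t` by
those of `P` costs the integral of the influence function against `(ratio of the weights - 1)` and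
`dP_t/dP - 1`. The last factor is `O(t)` in `L²` by the chi-square bound; the ratio of the weights is
bounded by local uniform strength, and tends to one in measure because the laws converge in total
variation. So the cost is `o(t)`. As `(dP_t/dP - 1) / t` tends weakly to the score
(`IsRegularPath.tendsto_integral_mul_div`), the derivative is the inner product of score and
influence function (`hasDerivAt_ivFunctional`).

*Upper bound.* If the variance bound is finite, then the Cauchy–Schwarz inequality bounds every
Cramér–Rao bound by it (`efficiencyBound_nonparametricModel_le`).

*Lower bound.* The influence function is truncated to a bounded one, supported where the conditional
law of `(A, Y)` is well behaved, and recentered. Tilting the law of `X` by one part and the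
conditional law of `(A, Y)` by the other gives a regular path that leaves the law of `Z` given `X`
alone, hence lies in the model with known policy. Its Cramér–Rao bound is at least the second moment
of the truncated function (`ofReal_integral_trunc_le_efficiencyBound`), and Fatou's lemma lets the
truncation level grow, whether or not the limit is finite (`vEff_le_efficiencyBound`). Since the
smaller model already attains the bound of the larger one, knowledge of the policy does not matter.

*Identification.* Conditional independence of `Z` and `U` turns the conditional means on the arms
into conditional means of potential variables (`propensity_mul_integral_condAY`), relevance
entails overlap (`condCovZA_ae_eq`), and unconfounded compliance factors the conditional mean of
effect times compliance, so that `δ(X)` is the conditional average treatment effect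
(`delta_obsLaw`). Being a conditional expectation of a square integrable variable, `δ(X)` is square
integrable; both bounds above use this.
-/

/-! ### Disintegration of the law of an observation -/

namespace ObsLaw

/-- The space in which the covariates take their values. -/
abbrev Cov (m : ℕ) : Type := EuclideanSpace ℝ (Fin m)

theorem measurable_bit : Measurable bit := measurable_from_top

theorem bit_nonneg (b : Bool) : 0 ≤ bit b := by cases b <;> simp [bit]

theorem bit_le_one (b : Bool) : bit b ≤ 1 := by cases b <;> simp [bit]

theorem abs_bit_le_one (b : Bool) : |bit b| ≤ 1 := by cases b <;> simp [bit]

instance {m : ℕ} (P : ProbabilityMeasure (Obs m)) : IsProbabilityMeasure (lawX P) := by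
  unfold lawX; infer_instance

instance {m : ℕ} (P : ProbabilityMeasure (Obs m)) (z : Bool) (x : Cov m) :
    IsProbabilityMeasure (condAY P z x) := by
  unfold condAY; infer_instance

theorem measurable_propensity {m : ℕ} (P : ProbabilityMeasure (Obs m)) (z : Bool) :
    Measurable (propensity P z) :=
  (Kernel.measurable_coe _ (measurableSet_singleton z)).ennreal_toReal

theorem measurable_integral_condAY {m : ℕ} (P : ProbabilityMeasure (Obs m)) {f : Obs m → ℝ}
    (hf : Measurable f) :
    Measurable fun w : Cov m × Bool => ∫ q, f (w, q) ∂(condAY P w.2 w.1) :=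
  (hf.stronglyMeasurable.integral_kernel_prod_right'
    (κ := (P : Measure (Obs m)).condKernel)).measurable

theorem measurable_muY_uncurry {m : ℕ} (P : ProbabilityMeasure (Obs m)) :
    Measurable fun w : Cov m × Bool => muY P w.2 w.1 :=
  measurable_integral_condAY P (f := fun o => o.2.2) (by fun_prop)

theorem measurable_muA_uncurry {m : ℕ} (P : ProbabilityMeasure (Obs m)) :
    Measurable fun w : Cov m × Bool => muA P w.2 w.1 :=
  measurable_integral_condAY P (f := fun o => bit o.2.1)
    (measurable_bit.comp (by fun_prop))

theorem measurable_muY {m : ℕ} (P : ProbabilityMeasure (Obs m)) (z : Bool) :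
    Measurable (muY P z) :=
  (measurable_muY_uncurry P).comp (f := fun x => (x, z)) (by fun_prop)

theorem measurable_muA {m : ℕ} (P : ProbabilityMeasure (Obs m)) (z : Bool) :
    Measurable (muA P z) :=
  (measurable_muA_uncurry P).comp (f := fun x => (x, z)) (by fun_prop)

theorem measurable_deltaY {m : ℕ} (P : ProbabilityMeasure (Obs m)) : Measurable (deltaY P) :=
  (measurable_muY P true).sub (measurable_muY P false)

theorem measurable_deltaA {m : ℕ} (P : ProbabilityMeasure (Obs m)) : Measurable (deltaA P) :=
  (measurable_muA P true).sub (measurable_muA P false)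

theorem measurable_delta {m : ℕ} (P : ProbabilityMeasure (Obs m)) : Measurable (delta P) :=
  (measurable_deltaY P).div (measurable_deltaA P)

theorem measurable_propensity_uncurry {m : ℕ} (P : ProbabilityMeasure (Obs m)) :
    Measurable fun w : Cov m × Bool => propensity P w.2 w.1 :=
  measurable_from_prod_countable_left fun z => measurable_propensity P z

theorem propensity_nonneg {m : ℕ} (P : ProbabilityMeasure (Obs m)) (z : Bool) (x : Cov m) :
    0 ≤ propensity P z x := measureReal_nonneg

theorem propensity_le_one {m : ℕ} (P : ProbabilityMeasure (Obs m)) (z : Bool) (x : Cov m) :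
    propensity P z x ≤ 1 := measureReal_le_one

theorem propensity_true_add_false {m : ℕ} (P : ProbabilityMeasure (Obs m)) (x : Cov m) :
    propensity P true x + propensity P false x = 1 := by
  have h := sum_measureReal_singleton (μ := (P : Measure (Obs m)).fst.condKernel x)
    (Finset.univ : Finset Bool)
  rw [Finset.coe_univ, probReal_univ, Fintype.sum_bool] at h
  exact h

theorem integrable_bit_comp {Ω : Type*} [MeasurableSpace Ω] (μ : Measure Ω) [IsFiniteMeasure μ]
    {f : Ω → Bool} (hf : Measurable f) : Integrable (fun ω => bit (f ω)) μ :=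
  Integrable.of_bound (measurable_bit.comp hf).aestronglyMeasurable 1
    (ae_of_all _ fun ω => by simpa using abs_bit_le_one (f ω))

theorem muA_nonneg {m : ℕ} (P : ProbabilityMeasure (Obs m)) (z : Bool) (x : Cov m) :
    0 ≤ muA P z x := integral_nonneg fun q => bit_nonneg q.1

theorem muA_le_one {m : ℕ} (P : ProbabilityMeasure (Obs m)) (z : Bool) (x : Cov m) :
    muA P z x ≤ 1 := by
  have h : muA P z x ≤ ∫ _, (1 : ℝ) ∂(condAY P z x) :=
    integral_mono (integrable_bit_comp _ measurable_fst) (integrable_const _)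
      fun q => bit_le_one q.1
  simpa using h

theorem lintegral_fst {m : ℕ} (P : ProbabilityMeasure (Obs m)) {f : Cov m × Bool → ℝ≥0∞}
    (hf : Measurable f) :
    ∫⁻ w, f w ∂(P : Measure (Obs m)).fst =
      ∫⁻ x, ∑ z, ENNReal.ofReal (propensity P z x) * f (x, z) ∂(lawX P) := by
  rw [← Measure.lintegral_condKernel hf]
  refine lintegral_congr fun x => ?_
  rw [lintegral_fintype]
  refine Finset.sum_congr rfl fun z _ => ?_
  rw [propensity, ofReal_measureReal, mul_comm]

theorem integral_fst {m : ℕ} (P : ProbabilityMeasure (Obs m)) {f : Cov m × Bool → ℝ}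
    (hf : Integrable f (P : Measure (Obs m)).fst) :
    ∫ w, f w ∂(P : Measure (Obs m)).fst =
      ∫ x, ∑ z, propensity P z x * f (x, z) ∂(lawX P) := by
  rw [← Measure.integral_condKernel hf]
  refine integral_congr_ae ?_
  filter_upwards [hf.condKernel_ae] with x hx
  rw [integral_fintype hx]
  rfl

theorem ae_fst_of_ae_lawX {m : ℕ} (P : ProbabilityMeasure (Obs m)) {p : Cov m → Prop}
    (h : ∀ᵐ x ∂(lawX P), p x) : ∀ᵐ w ∂(P : Measure (Obs m)).fst, p w.1 :=
  ae_of_ae_map measurable_fst.aemeasurable h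

theorem ae_of_ae_fst {m : ℕ} (P : ProbabilityMeasure (Obs m)) {p : Cov m × Bool → Prop}
    (h : ∀ᵐ w ∂(P : Measure (Obs m)).fst, p w) : ∀ᵐ o ∂(P : Measure (Obs m)), p o.1 :=
  ae_of_ae_map measurable_fst.aemeasurable h

/-- Under overlap, a property holding for almost every `(X, Z)` holds, for almost every `X`, at
both values of the instrument. -/
theorem ae_lawX_of_ae_fst {m : ℕ} (P : ProbabilityMeasure (Obs m))
    (hpos : ∀ z, ∀ᵐ x ∂(lawX P), 0 < propensity P z x) {p : Cov m × Bool → Prop}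
    (h : ∀ᵐ w ∂(P : Measure (Obs m)).fst, p w) : ∀ᵐ x ∂(lawX P), ∀ z, p (x, z) := by
  rw [← (P : Measure (Obs m)).fst.disintegrate (P : Measure (Obs m)).fst.condKernel] at h
  have h' := Measure.ae_ae_of_ae_compProd h
  filter_upwards [h', ae_all_iff.2 hpos] with x hx hp z
  by_contra hz
  have h0 : (P : Measure (Obs m)).fst.condKernel x {z} = 0 :=
    measure_mono_null (by simpa using hz) (ae_iff.1 hx)
  have := hp z
  simp [propensity, measureReal_def, h0] at this

theorem integral_eq_integral_condAY {m : ℕ} (P : ProbabilityMeasure (Obs m)) {f : Obs m → ℝ}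
    (hf : Integrable f (P : Measure (Obs m))) :
    ∫ o, f o ∂(P : Measure (Obs m)) =
      ∫ w, ∫ q, f (w, q) ∂(condAY P w.2 w.1) ∂(P : Measure (Obs m)).fst :=
  (Measure.integral_condKernel hf).symm

theorem lintegral_eq_lintegral_condAY {m : ℕ} (P : ProbabilityMeasure (Obs m))
    {f : Obs m → ℝ≥0∞} (hf : Measurable f) :
    ∫⁻ o, f o ∂(P : Measure (Obs m)) =
      ∫⁻ w, ∫⁻ q, f (w, q) ∂(condAY P w.2 w.1) ∂(P : Measure (Obs m)).fst :=
  (Measure.lintegral_condKernel hf).symm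

theorem ae_integrable_condAY {m : ℕ} (P : ProbabilityMeasure (Obs m)) {f : Obs m → ℝ}
    (hf : Integrable f (P : Measure (Obs m))) :
    ∀ᵐ w ∂(P : Measure (Obs m)).fst, Integrable (fun q => f (w, q)) (condAY P w.2 w.1) :=
  hf.condKernel_ae

theorem integrable_integral_condAY {m : ℕ} (P : ProbabilityMeasure (Obs m)) {f : Obs m → ℝ}
    (hf : Integrable f (P : Measure (Obs m))) :
    Integrable (fun w : Cov m × Bool => ∫ q, f (w, q) ∂(condAY P w.2 w.1))
      (P : Measure (Obs m)).fst := by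
  refine hf.integral_norm_condKernel.mono' hf.1.integral_condKernel (ae_of_all _ fun w => ?_)
  exact norm_integral_le_integral_norm _

theorem integral_comp_fst {m : ℕ} (P : ProbabilityMeasure (Obs m)) {f : Cov m × Bool → ℝ}
    (hf : Measurable f) :
    ∫ o, f o.1 ∂(P : Measure (Obs m)) = ∫ w, f w ∂(P : Measure (Obs m)).fst :=
  (integral_map measurable_fst.aemeasurable hf.aestronglyMeasurable).symm

theorem integral_comp_cov {m : ℕ} (P : ProbabilityMeasure (Obs m)) {f : Cov m → ℝ}
    (hf : Measurable f) :
    ∫ o, f o.1.1 ∂(P : Measure (Obs m)) = ∫ x, f x ∂(lawX P) := by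
  rw [integral_comp_fst P (f := fun w => f w.1) (hf.comp measurable_fst)]
  exact (integral_map measurable_fst.aemeasurable hf.aestronglyMeasurable).symm

theorem memLp_comp_cov_iff {m : ℕ} (P : ProbabilityMeasure (Obs m)) {f : Cov m → ℝ}
    (hf : Measurable f) (p : ℝ≥0∞) :
    MemLp (fun o : Obs m => f o.1.1) p (P : Measure (Obs m)) ↔ MemLp f p (lawX P) := by
  have h : lawX P = (P : Measure (Obs m)).map (fun o => o.1.1) := by
    rw [lawX, Measure.fst, Measure.fst, Measure.map_map measurable_fst measurable_fst]; rfl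
  rw [h, memLp_map_measure_iff hf.aestronglyMeasurable (by fun_prop)]
  rfl

end ObsLaw

/-! ### Convergence in measure and the Cauchy–Schwarz inequality -/

section Analysis

variable {𝒪 : Type*} [MeasurableSpace 𝒪]

theorem sq_integral_mul_le {μ : Measure 𝒪} {f g : 𝒪 → ℝ} (hf : MemLp f 2 μ)
    (hg : MemLp g 2 μ) :
    (∫ o, f o * g o ∂μ) ^ 2 ≤ (∫ o, f o ^ 2 ∂μ) * ∫ o, g o ^ 2 ∂μ := by
  have hfg : Integrable (fun o => f o * g o) μ := hf.integrable_mul hg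
  have key : ∀ x : ℝ, 0 ≤ (∫ o, g o ^ 2 ∂μ) * (x * x) + (2 * ∫ o, f o * g o ∂μ) * x +
      ∫ o, f o ^ 2 ∂μ := by
    intro x
    have h : ∫ o, (f o + x * g o) ^ 2 ∂μ = (∫ o, g o ^ 2 ∂μ) * (x * x) +
        (2 * ∫ o, f o * g o ∂μ) * x + ∫ o, f o ^ 2 ∂μ := by
      have : ∀ o, (f o + x * g o) ^ 2 =
          (x * x) * g o ^ 2 + (2 * x) * (f o * g o) + f o ^ 2 := fun o => by ring
      simp_rw [this]
      have i1 : Integrable (fun o => (x * x) * g o ^ 2) μ := hg.integrable_sq.const_mul _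
      have i2 : Integrable (fun o => (2 * x) * (f o * g o)) μ := hfg.const_mul _
      have i12 : Integrable (fun o => (x * x) * g o ^ 2 + (2 * x) * (f o * g o)) μ := i1.add i2
      rw [integral_add i12 hf.integrable_sq, integral_add i1 i2, integral_const_mul,
        integral_const_mul]
      ring
    rw [← h]
    exact integral_nonneg fun o => sq_nonneg _
  have := discrim_le_zero key
  rw [discrim] at this
  nlinarith

theorem abs_integral_mul_le {μ : Measure 𝒪} {f g : 𝒪 → ℝ} (hf : MemLp f 2 μ)
    (hg : MemLp g 2 μ) :
    |∫ o, f o * g o ∂μ| ≤ √(∫ o, f o ^ 2 ∂μ) * √(∫ o, g o ^ 2 ∂μ) := by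
  rw [← Real.sqrt_mul (integral_nonneg fun o => sq_nonneg _), ← Real.sqrt_sq_eq_abs]
  exact Real.sqrt_le_sqrt (sq_integral_mul_le hf hg)

theorem integral_abs_le_sqrt {μ : Measure 𝒪} [IsProbabilityMeasure μ] {f : 𝒪 → ℝ}
    (hf : MemLp f 2 μ) : ∫ o, |f o| ∂μ ≤ √(∫ o, f o ^ 2 ∂μ) := by
  have h := abs_integral_mul_le hf.abs (memLp_const (1 : ℝ) (p := 2) (μ := μ))
  simpa using (le_abs_self _).trans h

/-- Convergence in measure to zero as `t → 0`, `t ≠ 0`, in the form in which it is used: every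
sequence has a subsequence that converges almost everywhere. -/
def VanishesInMeasure (μ : Measure 𝒪) (b : ℝ → 𝒪 → ℝ) : Prop :=
  ∀ u : ℕ → ℝ, Tendsto u atTop (𝓝[≠] 0) → ∃ ns : ℕ → ℕ, Tendsto ns atTop atTop ∧
    ∀ᵐ o ∂μ, Tendsto (fun n => b (u (ns n)) o) atTop (𝓝 0)

theorem vanishesInMeasure_of_tendsto_integral {μ : Measure 𝒪} {b : ℝ → 𝒪 → ℝ}
    (hb : ∀ᶠ t in 𝓝[≠] (0 : ℝ), Integrable (b t) μ)
    (h : Tendsto (fun t => ∫ o, |b t o| ∂μ) (𝓝[≠] 0) (𝓝 0)) : VanishesInMeasure μ b := by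
  intro u hu
  obtain ⟨N, hN⟩ := eventually_atTop.1 (hu.eventually hb)
  have hshift : Tendsto (fun n => n + N) atTop atTop := tendsto_add_atTop_nat N
  have hint : ∀ n, Integrable (b (u (n + N))) μ := fun n => hN _ (Nat.le_add_left _ _)
  have hm : TendstoInMeasure μ (fun n => b (u (n + N))) atTop (fun _ => (0 : ℝ)) := by
    refine tendstoInMeasure_of_tendsto_eLpNorm one_ne_zero (fun n => (hint n).1)
      aestronglyMeasurable_const ?_
    have h1 := ENNReal.tendsto_ofReal ((h.comp hu).comp hshift)
    rw [ENNReal.ofReal_zero] at h1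
    refine h1.congr fun n => ?_
    have h2 : (b (u (n + N)) - fun _ => (0 : ℝ)) = b (u (n + N)) := by ext; simp
    rw [h2, eLpNorm_one_eq_lintegral_enorm, ← ofReal_integral_norm_eq_lintegral_enorm (hint n)]
    rfl
  obtain ⟨ns, hns, hae⟩ := hm.exists_seq_tendsto_ae
  exact ⟨fun n => ns n + N, hshift.comp hns.tendsto_atTop, hae⟩

theorem VanishesInMeasure.tendsto_integral_sq {μ : Measure 𝒪} {b : ℝ → 𝒪 → ℝ} {f : 𝒪 → ℝ}
    {K : ℝ} (hv : VanishesInMeasure μ b) (hf : MemLp f 2 μ) (hbm : ∀ t, Measurable (b t))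
    (hbK : ∀ t o, |b t o| ≤ K) :
    Tendsto (fun t => ∫ o, (f o * b t o) ^ 2 ∂μ) (𝓝[≠] 0) (𝓝 0) := by
  refine tendsto_of_subseq_tendsto fun u hu => ?_
  obtain ⟨ns, -, hae⟩ := hv u hu
  refine ⟨ns, ?_⟩
  have h := tendsto_integral_of_dominated_convergence (μ := μ) (f := fun _ => (0 : ℝ))
    (F := fun n o => (f o * b (u (ns n)) o) ^ 2) (fun o => K ^ 2 * f o ^ 2)
    (fun n => (hf.1.mul (hbm _).aestronglyMeasurable).pow 2) (hf.integrable_sq.const_mul _)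
    (fun n => ae_of_all _ fun o => ?_) ?_
  · simpa using h
  · have h1 := abs_le.1 (hbK (u (ns n)) o)
    have := sq_le_sq' h1.1 h1.2
    rw [Real.norm_eq_abs, abs_of_nonneg (sq_nonneg _), mul_pow, mul_comm]
    exact mul_le_mul_of_nonneg_right this (sq_nonneg _)
  · filter_upwards [hae] with o ho
    simpa using (ho.const_mul (f o)).pow 2

/-- Second-order remainders: a factor that is `O(t)` in `L²`, times a fixed square integrable
function, times a bounded factor that vanishes in measure, has integral `o(t)`. -/
theorem VanishesInMeasure.tendsto_integral_mul_div {μ : Measure 𝒪} {b ρ : ℝ → 𝒪 → ℝ}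
    {f : 𝒪 → ℝ} {K C : ℝ} (hv : VanishesInMeasure μ b) (hf : MemLp f 2 μ)
    (hbm : ∀ t, Measurable (b t)) (hbK : ∀ t o, |b t o| ≤ K)
    (hρ : ∀ᶠ t in 𝓝[≠] (0 : ℝ), MemLp (ρ t) 2 μ ∧ ∫ o, ρ t o ^ 2 ∂μ ≤ C * t ^ 2) :
    Tendsto (fun t => (∫ o, f o * b t o * ρ t o ∂μ) / t) (𝓝[≠] 0) (𝓝 0) := by
  have h1 : Tendsto (fun t => √(∫ o, (f o * b t o) ^ 2 ∂μ) * √C) (𝓝[≠] 0) (𝓝 0) := by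
    have := (Real.continuous_sqrt.tendsto 0).comp (hv.tendsto_integral_sq hf hbm hbK)
    simpa using this.mul_const (√C)
  refine squeeze_zero_norm' ?_ h1
  filter_upwards [hρ, self_mem_nhdsWithin] with t ht ht0
  have ht0' : 0 < |t| := abs_pos.2 ht0
  have hfb : MemLp (fun o => f o * b t o) 2 μ := by
    refine (hf.const_mul K).mono (hf.1.mul (hbm t).aestronglyMeasurable) (ae_of_all _ fun o => ?_)
    rw [norm_mul, norm_mul, mul_comm]
    refine mul_le_mul_of_nonneg_right ?_ (norm_nonneg _)
    exact (hbK t o).trans (le_abs_self K)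
  rw [norm_div, Real.norm_eq_abs, Real.norm_eq_abs, div_le_iff₀ ht0']
  calc _ ≤ √(∫ o, (f o * b t o) ^ 2 ∂μ) * √(∫ o, ρ t o ^ 2 ∂μ) := abs_integral_mul_le hfb ht.1
    _ ≤ √(∫ o, (f o * b t o) ^ 2 ∂μ) * √(C * t ^ 2) := by
      gcongr; exact ht.2
    _ = _ := by rw [Real.sqrt_mul' _ (sq_nonneg t), Real.sqrt_sq_eq_abs]; ring

end Analysis

/-! ### First-order behaviour of likelihood ratios along a regular path -/

section LikelihoodRatio

variable {𝒪 : Type*} [MeasurableSpace 𝒪]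

theorem measurable_likelihoodRatio (Q P : ProbabilityMeasure 𝒪) :
    Measurable (likelihoodRatio Q P) :=
  (Measure.measurable_rnDeriv _ _).ennreal_toReal

theorem likelihoodRatio_nonneg (Q P : ProbabilityMeasure 𝒪) (o : 𝒪) :
    0 ≤ likelihoodRatio Q P o := ENNReal.toReal_nonneg

theorem integral_likelihoodRatio_mul {Q P : ProbabilityMeasure 𝒪}
    (h : (Q : Measure 𝒪) ≪ (P : Measure 𝒪)) (f : 𝒪 → ℝ) :
    ∫ o, likelihoodRatio Q P o * f o ∂(P : Measure 𝒪) = ∫ o, f o ∂(Q : Measure 𝒪) :=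
  integral_rnDeriv_smul h

theorem integrable_likelihoodRatio_mul_iff {Q P : ProbabilityMeasure 𝒪}
    (h : (Q : Measure 𝒪) ≪ (P : Measure 𝒪)) {f : 𝒪 → ℝ} :
    Integrable (fun o => likelihoodRatio Q P o * f o) (P : Measure 𝒪) ↔
      Integrable f (Q : Measure 𝒪) :=
  integrable_rnDeriv_smul_iff h

theorem IsRegularPath.exists_integral_sq_le {P : ProbabilityMeasure 𝒪}
    {p : ℝ → ProbabilityMeasure 𝒪} {s : 𝒪 → ℝ} (h : IsRegularPath P p s) :
    ∃ C : ℝ, 0 ≤ C ∧ ∀ᶠ t in 𝓝 (0 : ℝ),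
      MemLp (fun o => likelihoodRatio (p t) P o - 1) 2 (P : Measure 𝒪) ∧
      ∫ o, (likelihoodRatio (p t) P o - 1) ^ 2 ∂(P : Measure 𝒪) ≤ C * t ^ 2 := by
  obtain ⟨C, hC⟩ := h.chiSquare
  refine ⟨max C 0, le_max_right _ _, ?_⟩
  filter_upwards [hC] with t ht
  have hm : Measurable fun o => likelihoodRatio (p t) P o - 1 :=
    (measurable_likelihoodRatio _ _).sub_const 1
  have hle : ∫⁻ o, ENNReal.ofReal ((likelihoodRatio (p t) P o - 1) ^ 2) ∂(P : Measure 𝒪) ≤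
      ENNReal.ofReal (max C 0 * t ^ 2) :=
    ht.trans (ENNReal.ofReal_le_ofReal
      (mul_le_mul_of_nonneg_right (le_max_left _ _) (sq_nonneg t)))
  constructor
  · rw [memLp_two_iff_integrable_sq hm.aestronglyMeasurable]
    refine ⟨(hm.pow_const 2).aestronglyMeasurable, ?_⟩
    rw [hasFiniteIntegral_iff_ofReal (ae_of_all _ fun o => sq_nonneg _)]
    exact hle.trans_lt ENNReal.ofReal_lt_top
  · rw [integral_eq_lintegral_of_nonneg_ae (ae_of_all _ fun o => sq_nonneg _)
      (hm.pow_const 2).aestronglyMeasurable]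
    exact ENNReal.toReal_le_of_le_ofReal (mul_nonneg (le_max_right _ _) (sq_nonneg t)) hle

theorem IsRegularPath.tendsto_integral_abs {P : ProbabilityMeasure 𝒪}
    {p : ℝ → ProbabilityMeasure 𝒪} {s : 𝒪 → ℝ} (h : IsRegularPath P p s) :
    Tendsto (fun t => ∫ o, |likelihoodRatio (p t) P o - 1| ∂(P : Measure 𝒪)) (𝓝 0) (𝓝 0) := by
  obtain ⟨C, hC0, hC⟩ := h.exists_integral_sq_le
  have h1 : Tendsto (fun t : ℝ => √(C * t ^ 2)) (𝓝 0) (𝓝 0) := by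
    have : Continuous fun t : ℝ => √(C * t ^ 2) := by fun_prop
    simpa using this.tendsto 0
  refine squeeze_zero' (Eventually.of_forall fun t => integral_nonneg fun o => abs_nonneg _) ?_ h1
  filter_upwards [hC] with t ht
  exact (integral_abs_le_sqrt ht.1).trans (Real.sqrt_le_sqrt ht.2)

theorem abs_sqrt_sub_one_le {r : ℝ} (hr : 0 ≤ r) : |√r - 1| ≤ |r - 1| := by
  have h : r - 1 = (√r - 1) * (√r + 1) := by nlinarith [Real.sq_sqrt hr]
  rw [h, abs_mul]
  refine le_mul_of_one_le_right (abs_nonneg _) ?_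
  rw [abs_of_nonneg (by positivity)]
  linarith [Real.sqrt_nonneg r]

/-- The normalized likelihood ratios `(dP_t/dP - 1) / t` converge to the score weakly in `L²`. With
`r = dP_t/dP` one has `r - 1 = ts + 2 (√r - 1 - ts/2) + (√r - 1)²`; the second term is controlled by
differentiability in quadratic mean, and the last is `(r - 1) (√r - 1) / (√r + 1)`, the product of a
term that is `O(t)` in `L²` and a bounded one that vanishes in measure. -/
theorem IsRegularPath.tendsto_integral_mul_div {P : ProbabilityMeasure 𝒪}
    {p : ℝ → ProbabilityMeasure 𝒪} {s : 𝒪 → ℝ} (h : IsRegularPath P p s) {f : 𝒪 → ℝ}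
    (hf : MemLp f 2 (P : Measure 𝒪)) :
    Tendsto (fun t => (∫ o, f o * (likelihoodRatio (p t) P o - 1) ∂(P : Measure 𝒪)) / t)
      (𝓝[≠] 0) (𝓝 (∫ o, f o * s o ∂(P : Measure 𝒪))) := by
  obtain ⟨C, hC0, hC⟩ := h.exists_integral_sq_le
  set R : ℝ → 𝒪 → ℝ := fun t => likelihoodRatio (p t) P with hR
  have hRm : ∀ t, Measurable (R t) := fun t => measurable_likelihoodRatio _ _
  have hR0 : ∀ t o, 0 ≤ R t o := fun t => likelihoodRatio_nonneg _ _
  set b : ℝ → 𝒪 → ℝ := fun t o => (√(R t o) - 1) / (√(R t o) + 1) with hb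
  set q : ℝ → 𝒪 → ℝ := fun t o => √(R t o) - 1 - t / 2 * s o with hq
  have hC' : ∀ᶠ t in 𝓝[≠] (0 : ℝ), MemLp (fun o => R t o - 1) 2 (P : Measure 𝒪) ∧
      ∫ o, (R t o - 1) ^ 2 ∂(P : Measure 𝒪) ≤ C * t ^ 2 := hC.filter_mono nhdsWithin_le_nhds
  have hqL : ∀ᶠ t in 𝓝[≠] (0 : ℝ), MemLp (q t) 2 (P : Measure 𝒪) := by
    filter_upwards [hC'] with t ht
    refine MemLp.sub (ht.1.mono ((hRm t).sqrt.sub_const 1).aestronglyMeasurable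
      (ae_of_all _ fun o => ?_)) (h.memLp_score.const_mul _)
    exact abs_sqrt_sub_one_le (hR0 t o)
  have hq0 : Tendsto (fun t => √(∫ o, q t o ^ 2 ∂(P : Measure 𝒪)) / |t|) (𝓝[≠] 0) (𝓝 0) := by
    have h1 := (ENNReal.tendsto_toReal ENNReal.zero_ne_top).comp h.quadraticMean
    have h2 := (Real.continuous_sqrt.tendsto 0).comp h1
    simp only [Real.sqrt_zero] at h2
    refine h2.congr' ?_
    filter_upwards [hqL] with t ht
    simp only [Function.comp_apply]
    rw [ENNReal.toReal_div, ENNReal.toReal_ofReal (sq_nonneg t), Real.sqrt_div' _ (sq_nonneg t),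
      Real.sqrt_sq_eq_abs, integral_eq_lintegral_of_nonneg_ae (ae_of_all _ fun o => sq_nonneg _)
      ht.integrable_sq.1]
  have hqf : Tendsto (fun t => (∫ o, f o * q t o ∂(P : Measure 𝒪)) / t) (𝓝[≠] 0) (𝓝 0) := by
    have h1 := hq0.const_mul (√(∫ o, f o ^ 2 ∂(P : Measure 𝒪)))
    rw [mul_zero] at h1
    refine squeeze_zero_norm' ?_ h1
    filter_upwards [hqL] with t ht
    rw [norm_div, Real.norm_eq_abs, Real.norm_eq_abs, ← mul_div_assoc]
    gcongr
    exact abs_integral_mul_le hf ht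
  have hbm : ∀ t, Measurable (b t) := fun t =>
    ((hRm t).sqrt.sub_const 1).div ((hRm t).sqrt.add_const 1)
  have hb1 : ∀ t o, |b t o| ≤ 1 := by
    intro t o
    have := Real.sqrt_nonneg (R t o)
    rw [hb, abs_div, abs_of_nonneg (by linarith : 0 ≤ √(R t o) + 1), div_le_one (by linarith),
      abs_le]
    constructor <;> linarith
  have hbR : ∀ t o, |b t o| ≤ |R t o - 1| := by
    intro t o
    have := Real.sqrt_nonneg (R t o)
    refine le_trans ?_ (abs_sqrt_sub_one_le (hR0 t o))
    rw [hb, abs_div, abs_of_nonneg (by linarith : 0 ≤ √(R t o) + 1)]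
    exact div_le_self (abs_nonneg _) (by linarith)
  have hbv : VanishesInMeasure (P : Measure 𝒪) b := by
    have hbi : ∀ t, Integrable (b t) (P : Measure 𝒪) := fun t =>
      Integrable.of_bound (hbm t).aestronglyMeasurable 1 (ae_of_all _ (hb1 t))
    refine vanishesInMeasure_of_tendsto_integral (Eventually.of_forall hbi) ?_
    refine squeeze_zero' (Eventually.of_forall fun t => integral_nonneg fun o => abs_nonneg _) ?_
      (h.tendsto_integral_abs.mono_left nhdsWithin_le_nhds)
    filter_upwards [hC'] with t ht
    exact integral_mono (hbi t).abs (ht.1.integrable one_le_two).abs (hbR t)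
  have hbf := hbv.tendsto_integral_mul_div hf hbm hb1 hC'
  have key := (hqf.const_mul 2).add hbf |>.add_const (∫ o, f o * s o ∂(P : Measure 𝒪))
  rw [mul_zero, zero_add, zero_add] at key
  refine key.congr' ?_
  filter_upwards [hqL, hC', self_mem_nhdsWithin] with t htq htC ht0
  have i1 : Integrable (fun o => f o * q t o) (P : Measure 𝒪) := hf.integrable_mul htq
  have i2 : Integrable (fun o => f o * s o) (P : Measure 𝒪) := hf.integrable_mul h.memLp_score
  have i3 : Integrable (fun o => f o * b t o * (R t o - 1)) (P : Measure 𝒪) := by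
    have := (hf.integrable_mul htC.1).bdd_mul (hbm t).aestronglyMeasurable
      (ae_of_all _ (hb1 t))
    refine this.congr (ae_of_all _ fun o => ?_)
    simp only [Pi.mul_apply]; ring
  have hsplit : ∀ o, f o * (R t o - 1) =
      2 * (f o * q t o) + f o * b t o * (R t o - 1) + t * (f o * s o) := by
    intro o
    have h1 : √(R t o) + 1 ≠ 0 := by positivity
    have h2 : √(R t o) * √(R t o) = R t o := Real.mul_self_sqrt (hR0 t o)
    have h3 : b t o * (R t o - 1) = (√(R t o) - 1) ^ 2 := by
      simp only [hb]
      rw [div_mul_eq_mul_div, div_eq_iff h1]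
      linear_combination (1 - √(R t o)) * h2
    have h4 : f o * b t o * (R t o - 1) = f o * (√(R t o) - 1) ^ 2 := by rw [mul_assoc, h3]
    rw [h4]
    simp only [hq]
    linear_combination (- f o) * h2
  have hval : ∫ o, f o * (R t o - 1) ∂(P : Measure 𝒪) =
      2 * (∫ o, f o * q t o ∂(P : Measure 𝒪)) +
        (∫ o, f o * b t o * (R t o - 1) ∂(P : Measure 𝒪)) +
        t * ∫ o, f o * s o ∂(P : Measure 𝒪) := by
    simp_rw [hsplit]
    have i4 : Integrable (fun o => 2 * (f o * q t o) + f o * b t o * (R t o - 1))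
        (P : Measure 𝒪) := (i1.const_mul 2).add i3
    rw [integral_add i4 (i2.const_mul t), integral_add (i1.const_mul 2) i3, integral_const_mul,
      integral_const_mul]
  have ht0' : t ≠ 0 := ht0
  rw [hval]
  field_simp

/-- If two laws on a product space differ by at most `ε` on functions bounded by one, then the
conditional means of such a function differ by at most `2ε` on average. -/
theorem integral_abs_condMean_sub_le {α β : Type*} [MeasurableSpace α] [MeasurableSpace β]
    [StandardBorelSpace β] [Nonempty β] (P Q : Measure (α × β)) [IsProbabilityMeasure P]
    [IsProbabilityMeasure Q] {ε : ℝ}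
    (hε : ∀ F : α × β → ℝ, Measurable F → (∀ w, |F w| ≤ 1) → |∫ w, F w ∂Q - ∫ w, F w ∂P| ≤ ε)
    {f : β → ℝ} (hf : Measurable f) (hf1 : ∀ y, |f y| ≤ 1) :
    ∫ x, |∫ y, f y ∂(Q.condKernel x) - ∫ y, f y ∂(P.condKernel x)| ∂P.fst ≤ 2 * ε := by
  set gQ : α → ℝ := fun x => ∫ y, f y ∂(Q.condKernel x) with hgQ
  set gP : α → ℝ := fun x => ∫ y, f y ∂(P.condKernel x) with hgP
  have mQ : Measurable gQ := (hf.stronglyMeasurable.integral_kernel (κ := Q.condKernel)).measurable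
  have mP : Measurable gP := (hf.stronglyMeasurable.integral_kernel (κ := P.condKernel)).measurable
  have bd : ∀ (κ : Kernel α β) [IsMarkovKernel κ] (x : α), |∫ y, f y ∂(κ x)| ≤ 1 := by
    intro κ _ x
    have hb : ∀ᵐ y ∂(κ x), ‖f y‖ ≤ 1 := ae_of_all _ hf1
    simpa using norm_integral_le_of_norm_le_const hb
  have bQ : ∀ x, |gQ x| ≤ 1 := bd Q.condKernel
  have bP : ∀ x, |gP x| ≤ 1 := bd P.condKernel
  -- The sign of the difference is a test function that turns it into its absolute value.
  set h : α → ℝ := fun x => if gP x ≤ gQ x then 1 else -1 with hh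
  have mh : Measurable h :=
    Measurable.ite (measurableSet_le mP mQ) measurable_const measurable_const
  have bh : ∀ x, |h x| ≤ 1 := by intro x; simp only [hh]; split_ifs <;> simp
  have babs : ∀ {a b : ℝ}, |a| ≤ 1 → |b| ≤ 1 → |a * b| ≤ 1 := by
    intro a b ha hb
    rw [abs_mul]; exact mul_le_one₀ ha (abs_nonneg b) hb
  have hF1 := hε (fun w => h w.1 * f w.2) (by fun_prop) fun w => babs (bh _) (hf1 _)
  have hF2 := hε (fun w => h w.1 * gQ w.1) (by fun_prop) fun w => babs (bh _) (bQ _)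
  have tower : ∀ (S : Measure (α × β)) [IsProbabilityMeasure S],
      ∫ w, h w.1 * f w.2 ∂S = ∫ x, h x * ∫ y, f y ∂(S.condKernel x) ∂S.fst := by
    intro S _
    rw [← Measure.integral_condKernel]
    · exact integral_congr_ae (ae_of_all _ fun x => integral_const_mul (h x) f)
    · exact Integrable.of_bound (by fun_prop) 1 (ae_of_all _ fun w => babs (bh _) (hf1 _))
  have marg : ∀ (S : Measure (α × β)) [IsProbabilityMeasure S],
      ∫ w, h w.1 * gQ w.1 ∂S = ∫ x, h x * gQ x ∂S.fst := fun S _ =>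
    (integral_map measurable_fst.aemeasurable (mh.mul mQ).aestronglyMeasurable).symm
  rw [tower Q, tower P] at hF1
  rw [marg Q, marg P] at hF2
  have habs : ∀ x, |gQ x - gP x| = h x * gQ x - h x * gP x := by
    intro x
    simp only [hh]
    split_ifs with hx
    · rw [abs_of_nonneg (by linarith)]; ring
    · rw [abs_of_neg (by linarith)]; ring
  have iQ : Integrable (fun x => h x * gQ x) P.fst :=
    Integrable.of_bound (by fun_prop) 1 (ae_of_all _ fun x => babs (bh _) (bQ _))
  have iP : Integrable (fun x => h x * gP x) P.fst :=
    Integrable.of_bound (by fun_prop) 1 (ae_of_all _ fun x => babs (bh _) (bP _))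
  rw [integral_congr_ae (ae_of_all _ habs), integral_sub iQ iP]
  have e1 := abs_le.1 hF1
  have e2 := abs_le.1 hF2
  linarith

theorem abs_integral_sub_integral_le {P Q : ProbabilityMeasure 𝒪}
    (hQ : (Q : Measure 𝒪) ≪ (P : Measure 𝒪)) {F : 𝒪 → ℝ} (hF : Measurable F)
    (hF1 : ∀ o, |F o| ≤ 1) :
    |∫ o, F o ∂(Q : Measure 𝒪) - ∫ o, F o ∂(P : Measure 𝒪)| ≤
      ∫ o, |likelihoodRatio Q P o - 1| ∂(P : Measure 𝒪) := by
  have iF : ∀ S : ProbabilityMeasure 𝒪, Integrable F (S : Measure 𝒪) := fun S =>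
    Integrable.of_bound hF.aestronglyMeasurable 1 (ae_of_all _ hF1)
  have i1 := (integrable_likelihoodRatio_mul_iff hQ).2 (iF Q)
  have i2 : Integrable (fun o => likelihoodRatio Q P o - 1) (P : Measure 𝒪) := by
    have := (integrable_likelihoodRatio_mul_iff hQ (f := fun _ => 1)).2 (integrable_const 1)
    simp only [mul_one] at this
    exact this.sub (integrable_const 1)
  rw [← integral_likelihoodRatio_mul hQ, ← integral_sub i1 (iF P)]
  refine (norm_integral_le_integral_norm _).trans (integral_mono (i1.sub (iF P)).norm i2.abs ?_)
  intro o
  have : likelihoodRatio Q P o * F o - F o = (likelihoodRatio Q P o - 1) * F o := by ring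
  change |likelihoodRatio Q P o * F o - F o| ≤ _
  rw [this, abs_mul]
  exact mul_le_of_le_one_right (abs_nonneg _) (hF1 o)

end LikelihoodRatio

/-! ### The weighted residual and the derivative of the functional along a regular path -/

namespace ObsLaw

variable {m : ℕ}

/-- The sign `2z - 1` of an instrument value. -/
noncomputable def armSign (z : Bool) : ℝ := if z then 1 else -1

theorem armSign_sq (z : Bool) : armSign z ^ 2 = 1 := by cases z <;> norm_num [armSign]

theorem abs_armSign (z : Bool) : |armSign z| = 1 := by cases z <;> norm_num [armSign]

theorem measurable_armSign : Measurable armSign := measurable_from_top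

/-- The residual `Y - A δ(X)`, centered at its conditional mean given `(Z, X)`. -/
noncomputable def resid (P : ProbabilityMeasure (Obs m)) (o : Obs m) : ℝ :=
  (o.2.2 - bit o.2.1 * delta P o.1.1) -
    (muY P o.1.2 o.1.1 - muA P o.1.2 o.1.1 * delta P o.1.1)

/-- The centered residual, signed by the instrument and weighted by the inverse of the propensity
and of the compliance score. Together with `δ(X) - τ` it makes up the efficient influence
function. -/
noncomputable def weightedResid (P : ProbabilityMeasure (Obs m)) (o : Obs m) : ℝ :=
  armSign o.1.2 * resid P o / (propensity P o.1.2 o.1.1 * deltaA P o.1.1)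

theorem measurable_resid (P : ProbabilityMeasure (Obs m)) : Measurable (resid P) := by
  have h1 : Measurable fun o : Obs m => delta P o.1.1 := (measurable_delta P).comp (by fun_prop)
  have h2 : Measurable fun o : Obs m => bit o.2.1 := measurable_bit.comp (by fun_prop)
  have h3 : Measurable fun o : Obs m => muY P o.1.2 o.1.1 :=
    (measurable_muY_uncurry P).comp measurable_fst
  have h4 : Measurable fun o : Obs m => muA P o.1.2 o.1.1 :=
    (measurable_muA_uncurry P).comp measurable_fst
  unfold resid
  fun_prop

theorem measurable_weightedResid (P : ProbabilityMeasure (Obs m)) :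
    Measurable (weightedResid P) := by
  have h1 : Measurable fun o : Obs m => armSign o.1.2 := measurable_armSign.comp (by fun_prop)
  have h2 : Measurable fun o : Obs m => propensity P o.1.2 o.1.1 :=
    (measurable_propensity_uncurry P).comp measurable_fst
  have h3 : Measurable fun o : Obs m => deltaA P o.1.1 := (measurable_deltaA P).comp (by fun_prop)
  exact (h1.mul (measurable_resid P)).div (h2.mul h3)

/-- The conditional mean under `Q` of the residual built from `P`. -/
theorem integral_resid (P Q : ProbabilityMeasure (Obs m)) {w : Cov m × Bool}
    (hY : Integrable (fun q : Bool × ℝ => q.2) (condAY Q w.2 w.1)) :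
    ∫ q, resid P (w, q) ∂(condAY Q w.2 w.1) =
      muY Q w.2 w.1 - muA Q w.2 w.1 * delta P w.1 -
        (muY P w.2 w.1 - muA P w.2 w.1 * delta P w.1) := by
  have hA : Integrable (fun q : Bool × ℝ => bit q.1) (condAY Q w.2 w.1) :=
    integrable_bit_comp _ measurable_fst
  have h1 : Integrable (fun q : Bool × ℝ => q.2 - bit q.1 * delta P w.1) (condAY Q w.2 w.1) :=
    hY.sub (hA.mul_const _)
  change ∫ q : Bool × ℝ, (q.2 - bit q.1 * delta P w.1) -
    (muY P w.2 w.1 - muA P w.2 w.1 * delta P w.1) ∂(condAY Q w.2 w.1) = _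
  rw [integral_sub h1 (integrable_const _), integral_sub hY (hA.mul_const _), integral_mul_const,
    integral_const, probReal_univ, one_smul]
  rfl

theorem ae_integrable_outcome {P : ProbabilityMeasure (Obs m)}
    (hP : P ∈ nonparametricModel m) : ∀ᵐ w ∂(P : Measure (Obs m)).fst,
      Integrable (fun q : Bool × ℝ => q.2) (condAY P w.2 w.1) :=
  ae_integrable_condAY P (f := fun o => o.2.2) (hP.1.integrable one_le_two)

/-- The weighted residual is uncorrelated with every function of `(X, Z)`. -/
theorem integral_mul_weightedResid {P : ProbabilityMeasure (Obs m)}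
    (hP : P ∈ nonparametricModel m) {k : Cov m × Bool → ℝ}
    (hk : Integrable (fun o => k o.1 * weightedResid P o) (P : Measure (Obs m))) :
    ∫ o, k o.1 * weightedResid P o ∂(P : Measure (Obs m)) = 0 := by
  rw [integral_eq_integral_condAY P hk]
  refine integral_eq_zero_of_ae ?_
  filter_upwards [ae_integrable_outcome hP] with w hw
  have h := integral_resid P P hw
  rw [sub_self] at h
  have h2 : ∀ q, k w * weightedResid P (w, q) =
      (k w * armSign w.2 / (propensity P w.2 w.1 * deltaA P w.1)) * resid P (w, q) := by
    intro q; simp only [weightedResid]; ring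
  simp_rw [h2]
  rw [integral_const_mul, h, mul_zero]
  rfl

/-- The factor that turns the weights of the residual under `P` into those under `Q`. -/
noncomputable def weightRatio (P Q : ProbabilityMeasure (Obs m)) (w : Cov m × Bool) : ℝ :=
  propensity P w.2 w.1 * deltaA P w.1 / (propensity Q w.2 w.1 * deltaA Q w.1)

theorem measurable_weightRatio (P Q : ProbabilityMeasure (Obs m)) :
    Measurable (weightRatio P Q) :=
  ((measurable_propensity_uncurry P).mul ((measurable_deltaA P).comp measurable_fst)).div
    ((measurable_propensity_uncurry Q).mul ((measurable_deltaA Q).comp measurable_fst))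

theorem fst_absolutelyContinuous {P Q : ProbabilityMeasure (Obs m)}
    (h : (Q : Measure (Obs m)) ≪ (P : Measure (Obs m))) :
    (Q : Measure (Obs m)).fst ≪ (P : Measure (Obs m)).fst :=
  h.map measurable_fst

theorem lawX_absolutelyContinuous {P Q : ProbabilityMeasure (Obs m)}
    (h : (Q : Measure (Obs m)) ≪ (P : Measure (Obs m))) : lawX Q ≪ lawX P :=
  (fst_absolutelyContinuous h).map measurable_fst

/-- The mean under `Q` of the residual built from `P`, with the weights that belong to `Q`, is the
mean of `δ_Q - δ_P`. This is exact, not a first-order expansion. -/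
theorem integral_mul_weightedResid_mul_weightRatio {P Q : ProbabilityMeasure (Obs m)}
    (hP : P ∈ nonparametricModel m) (hQ : Q ∈ nonparametricModel m)
    (hQP : (Q : Measure (Obs m)) ≪ (P : Measure (Obs m))) {γ : Cov m → ℝ}
    (hγ : Integrable (fun o => γ o.1.1 * weightedResid P o * weightRatio P Q o.1)
      (Q : Measure (Obs m))) :
    ∫ o, γ o.1.1 * weightedResid P o * weightRatio P Q o.1 ∂(Q : Measure (Obs m)) =
      ∫ x, γ x * (delta Q x - delta P x) ∂(lawX Q) := by
  have hac := lawX_absolutelyContinuous hQP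
  have hpP : ∀ᵐ x ∂(lawX Q), ∀ z, 0 < propensity P z x := hac.ae_le (ae_all_iff.2 hP.2.1)
  have hdP : ∀ᵐ x ∂(lawX Q), deltaA P x ≠ 0 := hac.ae_le hP.2.2.1
  set k : Cov m × Bool → ℝ := fun w =>
    γ w.1 * armSign w.2 / (propensity Q w.2 w.1 * deltaA Q w.1) *
      (muY Q w.2 w.1 - muA Q w.2 w.1 * delta P w.1 -
        (muY P w.2 w.1 - muA P w.2 w.1 * delta P w.1)) with hk
  have hinner : (fun w : Cov m × Bool => ∫ q, γ w.1 * weightedResid P (w, q) * weightRatio P Q w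
      ∂(condAY Q w.2 w.1)) =ᵐ[(Q : Measure (Obs m)).fst] k := by
    filter_upwards [ae_integrable_outcome hQ, ae_fst_of_ae_lawX Q hpP, ae_fst_of_ae_lawX Q hdP]
      with w hY hp hd
    have hp' := (hp w.2).ne'
    have h2 : ∀ q, γ w.1 * weightedResid P (w, q) * weightRatio P Q w =
        (γ w.1 * armSign w.2 / (propensity Q w.2 w.1 * deltaA Q w.1)) * resid P (w, q) := by
      intro q
      simp only [weightedResid, weightRatio]
      rw [show ∀ a b c d e f : ℝ, a * (b * c / d) * (e / f) = (d⁻¹ * e) * (a * b / f) * c by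
        intros; ring]
      rw [inv_mul_cancel₀ (mul_ne_zero hp' hd), one_mul]
    simp_rw [h2]
    rw [integral_const_mul, integral_resid P Q hY]
  have hki : Integrable k (Q : Measure (Obs m)).fst :=
    (integrable_integral_condAY Q hγ).congr hinner
  rw [integral_eq_integral_condAY Q hγ, integral_congr_ae hinner, integral_fst Q hki]
  refine integral_congr_ae ?_
  filter_upwards [hdP, ae_all_iff.2 hQ.2.1, hQ.2.2.1] with x hd hp hdQ
  have h1 := (hp true).ne'
  have h0 := (hp false).ne'
  have hdP' : delta P x * deltaA P x = deltaY P x := div_mul_cancel₀ _ hd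
  have hdQ' : delta Q x * deltaA Q x = deltaY Q x := div_mul_cancel₀ _ hdQ
  simp only [Fintype.sum_bool, hk, armSign, if_true, Bool.false_eq_true, if_false]
  field_simp
  rw [deltaY, deltaA] at hdP' hdQ'
  rw [deltaA]
  linear_combination γ x * hdP' - γ x * hdQ'

theorem abs_weightRatio_le {P Q : ProbabilityMeasure (Obs m)} {c : ℝ} (hc : 0 < c) {x : Cov m}
    (hd : deltaA P x ≠ 0) (hp : ∀ z, 0 < propensity P z x)
    (hdc : c * |deltaA P x| ≤ |deltaA Q x|)
    (hpc : ∀ z, c * propensity P z x ≤ propensity Q z x) (z : Bool) :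
    |weightRatio P Q (x, z)| ≤ 1 / c ^ 2 := by
  have h1 : 0 < c * |deltaA P x| := mul_pos hc (abs_pos.2 hd)
  have h2 : 0 < c * propensity P z x := mul_pos hc (hp z)
  rw [weightRatio, abs_div, abs_mul, abs_mul, abs_of_pos (hp z),
    abs_of_nonneg (propensity_nonneg Q z x), div_le_div_iff₀ (by
      have := hpc z
      exact mul_pos (by linarith) (by linarith)) (by positivity), one_mul]
  calc propensity P z x * |deltaA P x| * c ^ 2
      = (c * propensity P z x) * (c * |deltaA P x|) := by ring
    _ ≤ _ := mul_le_mul (hpc z) hdc h1.le (propensity_nonneg Q z x)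

theorem integral_abs_muA_sub_le {P Q : ProbabilityMeasure (Obs m)}
    (hQP : (Q : Measure (Obs m)) ≪ (P : Measure (Obs m))) :
    ∫ w, |muA Q w.2 w.1 - muA P w.2 w.1| ∂(P : Measure (Obs m)).fst ≤
      2 * ∫ o, |likelihoodRatio Q P o - 1| ∂(P : Measure (Obs m)) :=
  integral_abs_condMean_sub_le (P : Measure (Obs m)) (Q : Measure (Obs m))
    (fun _ hF hF1 => abs_integral_sub_integral_le hQP hF hF1) (f := fun q => bit q.1)
    (measurable_bit.comp measurable_fst) fun q => abs_bit_le_one q.1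

theorem integral_abs_propensity_sub_le {P Q : ProbabilityMeasure (Obs m)}
    (hQP : (Q : Measure (Obs m)) ≪ (P : Measure (Obs m))) :
    ∫ x, |propensity Q true x - propensity P true x| ∂(lawX P) ≤
      2 * ∫ o, |likelihoodRatio Q P o - 1| ∂(P : Measure (Obs m)) := by
  have key : ∀ (S : ProbabilityMeasure (Obs m)) (x : Cov m),
      ∫ z, bit z ∂((S : Measure (Obs m)).fst.condKernel x) = propensity S true x := by
    intro S x
    rw [integral_fintype Integrable.of_finite]
    simp [bit, propensity]
  have h := integral_abs_condMean_sub_le (P : Measure (Obs m)).fst (Q : Measure (Obs m)).fst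
    (ε := ∫ o, |likelihoodRatio Q P o - 1| ∂(P : Measure (Obs m))) (fun F hF hF1 => by
      rw [← integral_comp_fst Q hF, ← integral_comp_fst P hF]
      exact abs_integral_sub_integral_le hQP (hF.comp measurable_fst) fun o => hF1 o.1)
    measurable_bit abs_bit_le_one
  simp_rw [key] at h
  exact h

/-- Along a regular path the propensities and the conditional means of the treatment converge in
measure, because the laws converge in total variation. -/
theorem exists_subseq_tendsto_weightRatio {P : ProbabilityMeasure (Obs m)}
    (hP : P ∈ nonparametricModel m) {p : ℝ → ProbabilityMeasure (Obs m)} {s : Obs m → ℝ}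
    (hp : IsRegularPath P p s) {u : ℕ → ℝ} (hu : Tendsto u atTop (𝓝[≠] 0)) :
    ∃ ns : ℕ → ℕ, Tendsto ns atTop atTop ∧ ∀ᵐ o ∂(P : Measure (Obs m)),
      Tendsto (fun n => weightRatio P (p (u (ns n))) o.1) atTop (𝓝 1) := by
  set Φ : ℝ → Cov m × Bool → ℝ := fun t w =>
    |propensity (p t) true w.1 - propensity P true w.1| +
      |muA (p t) w.2 w.1 - muA P w.2 w.1| with hΦ
  have m1 : ∀ t, Measurable fun w : Cov m × Bool =>
      |propensity (p t) true w.1 - propensity P true w.1| := fun t =>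
    (((measurable_propensity (p t) true).sub (measurable_propensity P true)).comp
      measurable_fst).abs
  have m2 : ∀ t, Measurable fun w : Cov m × Bool => |muA (p t) w.2 w.1 - muA P w.2 w.1| :=
    fun t => ((measurable_muA_uncurry (p t)).sub (measurable_muA_uncurry P)).abs
  have i1 : ∀ t, Integrable (fun w : Cov m × Bool =>
      |propensity (p t) true w.1 - propensity P true w.1|) (P : Measure (Obs m)).fst := fun t =>
    Integrable.of_bound (m1 t).aestronglyMeasurable 1 (ae_of_all _ fun w => by
      rw [Real.norm_eq_abs, abs_abs, abs_le]
      constructor <;> linarith [propensity_nonneg P true w.1, propensity_le_one P true w.1,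
        propensity_nonneg (p t) true w.1, propensity_le_one (p t) true w.1])
  have i2 : ∀ t, Integrable (fun w : Cov m × Bool =>
      |muA (p t) w.2 w.1 - muA P w.2 w.1|) (P : Measure (Obs m)).fst := fun t =>
    Integrable.of_bound (m2 t).aestronglyMeasurable 1 (ae_of_all _ fun w => by
      rw [Real.norm_eq_abs, abs_abs, abs_le]
      constructor <;> linarith [muA_nonneg P w.2 w.1, muA_le_one P w.2 w.1,
        muA_nonneg (p t) w.2 w.1, muA_le_one (p t) w.2 w.1])
  have hΦ0 : ∀ t w, 0 ≤ Φ t w := fun t w => by positivity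
  have hv : VanishesInMeasure (P : Measure (Obs m)).fst Φ := by
    refine vanishesInMeasure_of_tendsto_integral (Eventually.of_forall fun t => (i1 t).add (i2 t))
      ?_
    have hlim := (hp.tendsto_integral_abs.const_mul 4).mono_left
      (nhdsWithin_le_nhds (s := {(0 : ℝ)}ᶜ))
    rw [mul_zero] at hlim
    refine squeeze_zero' (Eventually.of_forall fun t => integral_nonneg fun o => abs_nonneg _) ?_
      hlim
    filter_upwards [hp.absolutelyContinuous.filter_mono nhdsWithin_le_nhds] with t ht
    simp_rw [fun w => abs_of_nonneg (hΦ0 t w)]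
    have e1 : ∫ w, |propensity (p t) true w.1 - propensity P true w.1|
        ∂(P : Measure (Obs m)).fst = ∫ x, |propensity (p t) true x - propensity P true x|
        ∂(lawX P) :=
      (integral_map measurable_fst.aemeasurable ((measurable_propensity (p t) true).sub
        (measurable_propensity P true)).abs.aestronglyMeasurable).symm
    rw [integral_add (i1 t) (i2 t), e1]
    linarith [integral_abs_muA_sub_le ht, integral_abs_propensity_sub_le ht]
  obtain ⟨ns, hns, hae⟩ := hv u hu
  refine ⟨ns, hns, ?_⟩
  have hx := ae_lawX_of_ae_fst P hP.2.1 hae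
  have hx' : ∀ᵐ x ∂(lawX P), ∀ z,
      Tendsto (fun n => weightRatio P (p (u (ns n))) (x, z)) atTop (𝓝 1) := by
    filter_upwards [hx, ae_all_iff.2 hP.2.1, hP.2.2.1] with x hx hpos hd z
    have t1 : Tendsto (fun n => propensity (p (u (ns n))) true x) atTop
        (𝓝 (propensity P true x)) := by
      rw [tendsto_iff_norm_sub_tendsto_zero]
      exact squeeze_zero (fun n => norm_nonneg _)
        (fun n => le_add_of_nonneg_right (abs_nonneg _)) (hx true)
    have t1' : ∀ z, Tendsto (fun n => propensity (p (u (ns n))) z x) atTop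
        (𝓝 (propensity P z x)) := by
      intro z
      cases z with
      | true => exact t1
      | false =>
        have e : ∀ S : ProbabilityMeasure (Obs m),
            propensity S false x = 1 - propensity S true x := fun S => by
          linarith [propensity_true_add_false S x]
        simp_rw [e]
        exact t1.const_sub 1
    have t2 : ∀ z, Tendsto (fun n => muA (p (u (ns n))) z x) atTop (𝓝 (muA P z x)) := by
      intro z
      rw [tendsto_iff_norm_sub_tendsto_zero]
      exact squeeze_zero (fun n => norm_nonneg _)
        (fun n => le_add_of_nonneg_left (abs_nonneg _)) (hx z)
    have t3 : Tendsto (fun n => deltaA (p (u (ns n))) x) atTop (𝓝 (deltaA P x)) :=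
      (t2 true).sub (t2 false)
    have hne : propensity P z x * deltaA P x ≠ 0 := mul_ne_zero (hpos z).ne' hd
    have := (tendsto_const_nhds (x := propensity P z x * deltaA P x)).div ((t1' z).mul t3) hne
    rw [div_self hne] at this
    exact this
  have := ae_of_ae_fst P (ae_fst_of_ae_lawX P hx')
  filter_upwards [this] with o ho
  exact ho o.1.2

/-- The functional is differentiable along a regular path, with the derivative given by the inner
product of the score with the efficient influence function. The weight `γ` truncates the influence
function where the path leaves `δ` unchanged: that makes the statement available also when the
influence function itself is not square integrable. -/
theorem hasDerivAt_ivFunctional {P : ProbabilityMeasure (Obs m)}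
    (hP : P ∈ nonparametricModel m) (hδ : MemLp (delta P) 2 (lawX P))
    {p : ℝ → ProbabilityMeasure (Obs m)} {s : Obs m → ℝ} (hp : IsRegularPath P p s)
    (hM : ∀ᶠ t in 𝓝 (0 : ℝ), p t ∈ nonparametricModel m) (hR : LocallyUniformStrength P p)
    {γ : Cov m → ℝ}
    (hγ : MemLp (fun o : Obs m => γ o.1.1 * weightedResid P o) 2 (P : Measure (Obs m)))
    (hγδ : ∀ᶠ t in 𝓝 (0 : ℝ), ∀ᵐ x ∂(lawX (p t)), γ x = 1 ∨ delta (p t) x = delta P x) :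
    HasDerivAt (fun t => ivFunctional (p t))
      (∫ o, (γ o.1.1 * weightedResid P o + (delta P o.1.1 - ivFunctional P)) * s o
        ∂(P : Measure (Obs m))) 0 := by
  obtain ⟨c, hc, hcs⟩ := hR
  obtain ⟨C, hC0, hC⟩ := hp.exists_integral_sq_le
  set μ : Measure (Obs m) := (P : Measure (Obs m)) with hμ
  set τ := ivFunctional P with hτ
  set K : ℝ := max 1 (1 / c ^ 2) with hK
  set ψ : Obs m → ℝ := fun o => γ o.1.1 * weightedResid P o with hψ
  set η : Obs m → ℝ := fun o => delta P o.1.1 - τ with hη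
  -- The bound on the weight ratio holds only almost surely under `p t`; clamping makes it global.
  set a : ℝ → Obs m → ℝ := fun t o => max (-K) (min K (weightRatio P (p t) o.1)) with ha
  have hK1 : 1 ≤ K := le_max_left _ _
  have ham : ∀ t, Measurable (a t) := fun t =>
    measurable_const.max (measurable_const.min
      ((measurable_weightRatio P (p t)).comp measurable_fst))
  have haK : ∀ t o, |a t o| ≤ K := fun t o =>
    abs_le.2 ⟨le_max_left _ _, max_le (by linarith) (min_le_left _ _)⟩
  have hηm : Measurable η := ((measurable_delta P).comp (by fun_prop)).sub_const τ
  have hηL : MemLp η 2 μ :=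
    ((memLp_comp_cov_iff P (measurable_delta P) 2).2 hδ).sub (memLp_const τ)
  have hη0 : ∫ o, η o ∂μ = 0 := by
    have h1 : Integrable (fun o : Obs m => delta P o.1.1) μ :=
      ((memLp_comp_cov_iff P (measurable_delta P) 2).2 hδ).integrable one_le_two
    rw [integral_sub h1 (integrable_const τ), integral_comp_cov P (measurable_delta P)]
    simp [hτ, ivFunctional]
  have hψa : ∀ t, MemLp (fun o => ψ o * a t o) 2 μ := by
    intro t
    refine (hγ.const_mul K).mono (hγ.1.mul (ham t).aestronglyMeasurable) (ae_of_all _ fun o => ?_)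
    calc |ψ o * a t o| = |a t o| * |ψ o| := by rw [abs_mul, mul_comm]
      _ ≤ |K| * |ψ o| :=
        mul_le_mul_of_nonneg_right ((haK t o).trans (le_abs_self K)) (abs_nonneg _)
      _ = |K * ψ o| := (abs_mul _ _).symm
  have hψa0 : ∀ t, ∫ o, ψ o * a t o ∂μ = 0 := by
    intro t
    have e : ∀ o, ψ o * a t o = (γ o.1.1 * max (-K) (min K (weightRatio P (p t) o.1))) *
        weightedResid P o := fun o => by simp only [hψ, ha]; ring
    have hi : Integrable (fun o => ψ o * a t o) μ := (hψa t).integrable one_le_two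
    simp_rw [e] at hi ⊢
    exact integral_mul_weightedResid hP
      (k := fun w => γ w.1 * max (-K) (min K (weightRatio P (p t) w))) hi
  have hb : VanishesInMeasure μ (fun t o => a t o - 1) := by
    intro u hu
    obtain ⟨ns, hns, hae⟩ := exists_subseq_tendsto_weightRatio hP hp hu
    refine ⟨ns, hns, ?_⟩
    filter_upwards [hae] with o ho
    have h1 := (tendsto_const_nhds (x := -K)).max ((tendsto_const_nhds (x := K)).min ho)
    rw [min_eq_right hK1, max_eq_right (by linarith)] at h1
    simpa using h1.sub_const 1
  have hrem := hb.tendsto_integral_mul_div (K := K + 1) hγ (fun t => (ham t).sub_const 1)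
    (fun t o => abs_le.2 ⟨by linarith [(abs_le.1 (haK t o)).1], by
      linarith [(abs_le.1 (haK t o)).2]⟩)
    (hC.filter_mono (nhdsWithin_le_nhds (s := {(0 : ℝ)}ᶜ)))
  have hmain := hp.tendsto_integral_mul_div (hγ.add hηL)
  rw [hasDerivAt_iff_tendsto_slope_zero]
  have hsum := hmain.add hrem
  rw [add_zero] at hsum
  refine hsum.congr' ?_
  have hev : ∀ᶠ t in 𝓝 (0 : ℝ), ivFunctional (p t) - τ =
      (∫ o, (ψ o + η o) * (likelihoodRatio (p t) P o - 1) ∂μ) +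
        ∫ o, ψ o * (a t o - 1) * (likelihoodRatio (p t) P o - 1) ∂μ := by
    filter_upwards [hM, hp.absolutelyContinuous, hcs, hC, hγδ] with t htM htac htc htC htγ
    set Q := p t with hQ
    have hac := lawX_absolutelyContinuous htac
    have hpP : ∀ᵐ x ∂(lawX Q), ∀ z, 0 < propensity P z x := hac.ae_le (ae_all_iff.2 hP.2.1)
    have hdP : ∀ᵐ x ∂(lawX Q), deltaA P x ≠ 0 := hac.ae_le hP.2.2.1
    have haw : ∀ᵐ o ∂(Q : Measure (Obs m)), weightRatio P Q o.1 = a t o := by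
      have h1 : ∀ᵐ x ∂(lawX Q), ∀ z, |weightRatio P Q (x, z)| ≤ K := by
        filter_upwards [hpP, hdP, htc] with x h1 h2 h3 z
        exact (abs_weightRatio_le hc h2 h1 h3.1 h3.2 z).trans (le_max_right _ _)
      filter_upwards [ae_of_ae_fst Q (ae_fst_of_ae_lawX Q h1)] with o ho
      have h2 := abs_le.1 (ho o.1.2)
      change _ = max (-K) (min K (weightRatio P Q o.1))
      rw [min_eq_right h2.2, max_eq_right h2.1]
    have intQ : ∀ {f : Obs m → ℝ}, MemLp f 2 μ →
        Integrable f (Q : Measure (Obs m)) := by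
      intro f hf
      refine (integrable_likelihoodRatio_mul_iff htac).1 ?_
      refine ((htC.1.integrable_mul hf).add (hf.integrable one_le_two)).congr
        (ae_of_all _ fun o => ?_)
      simp only [Pi.add_apply, Pi.mul_apply]; ring
    have chg : ∀ {f : Obs m → ℝ}, MemLp f 2 μ → ∫ o, f o ∂μ = 0 →
        ∫ o, f o ∂(Q : Measure (Obs m)) = ∫ o, f o * (likelihoodRatio Q P o - 1) ∂μ := by
      intro f hf hf0
      have h1 := (integrable_likelihoodRatio_mul_iff htac).2 (intQ hf)
      rw [← integral_likelihoodRatio_mul htac, ← sub_zero (∫ o, _ ∂_), ← hf0,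
        ← integral_sub h1 (hf.integrable one_le_two)]
      exact integral_congr_ae (ae_of_all _ fun o => by ring)
    have hwi : Integrable (fun o => γ o.1.1 * weightedResid P o * weightRatio P Q o.1)
        (Q : Measure (Obs m)) := by
      refine (intQ (hψa t)).congr ?_
      filter_upwards [haw] with o ho
      rw [ho]
    have hexact := integral_mul_weightedResid_mul_weightRatio hP htM htac hwi
    have hδQ : Integrable (delta P) (lawX Q) := by
      have h1 : MemLp (fun o : Obs m => delta P o.1.1) 1 (Q : Measure (Obs m)) :=
        memLp_one_iff_integrable.2
          (intQ ((memLp_comp_cov_iff P (measurable_delta P) 2).2 hδ))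
      exact memLp_one_iff_integrable.1 ((memLp_comp_cov_iff Q (measurable_delta P) 1).1 h1)
    have e1 : ∫ x, γ x * (delta Q x - delta P x) ∂(lawX Q) =
        ivFunctional Q - ∫ x, delta P x ∂(lawX Q) := by
      rw [ivFunctional, ← integral_sub htM.2.2.2 hδQ]
      refine integral_congr_ae ?_
      filter_upwards [htγ] with x hx
      rcases hx with hx | hx
      · rw [hx, one_mul]
      · rw [hx, sub_self, mul_zero]
    have e2 : ∫ o, η o ∂(Q : Measure (Obs m)) = (∫ x, delta P x ∂(lawX Q)) - τ := by
      rw [integral_sub (intQ ((memLp_comp_cov_iff P (measurable_delta P) 2).2 hδ))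
        (integrable_const τ), integral_comp_cov Q (measurable_delta P)]
      simp
    have e3 : ∫ o, ψ o * a t o ∂(Q : Measure (Obs m)) =
        ∫ o, γ o.1.1 * weightedResid P o * weightRatio P Q o.1 ∂(Q : Measure (Obs m)) := by
      refine integral_congr_ae ?_
      filter_upwards [haw] with o ho
      rw [ho]
    have e4 : ivFunctional Q - τ =
        ∫ o, ψ o * a t o ∂(Q : Measure (Obs m)) + ∫ o, η o ∂(Q : Measure (Obs m)) := by
      rw [e2, e3, hexact, e1]; ring
    have j1 : Integrable (fun o => ψ o * a t o * (likelihoodRatio Q P o - 1)) μ :=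
      (hψa t).integrable_mul htC.1
    have j2 : Integrable (fun o => η o * (likelihoodRatio Q P o - 1)) μ :=
      hηL.integrable_mul htC.1
    have j3 : Integrable (fun o => ψ o * (likelihoodRatio Q P o - 1)) μ :=
      hγ.integrable_mul htC.1
    have j4 : Integrable (fun o => (ψ o + η o) * (likelihoodRatio Q P o - 1)) μ := by
      refine (j3.add j2).congr (ae_of_all _ fun o => ?_)
      simp only [Pi.add_apply]; ring
    have j5 : Integrable (fun o => ψ o * (a t o - 1) * (likelihoodRatio Q P o - 1)) μ := by
      refine (j1.sub j3).congr (ae_of_all _ fun o => ?_)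
      simp only [Pi.sub_apply]; ring
    rw [e4, chg (hψa t) (hψa0 t), chg hηL hη0, ← integral_add j1 j2, ← integral_add j4 j5]
    exact integral_congr_ae (ae_of_all _ fun o => by ring)
  filter_upwards [hev.filter_mono nhdsWithin_le_nhds] with t ht
  rw [zero_add, hp.at_zero, smul_eq_mul, ht]
  simp only [Pi.add_apply]
  ring

end ObsLaw

/-! ### The variance bound as a second moment, and the Cramér–Rao inequality -/

namespace ObsLaw

variable {m : ℕ}

theorem ae_memLp_outcome {P : ProbabilityMeasure (Obs m)}
    (hP : P ∈ nonparametricModel m) : ∀ᵐ w ∂(P : Measure (Obs m)).fst,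
      MemLp (fun q : Bool × ℝ => q.2) 2 (condAY P w.2 w.1) := by
  have h := ae_integrable_condAY P (f := fun o => o.2.2 ^ 2) hP.1.integrable_sq
  filter_upwards [h] with w hw
  exact (memLp_two_iff_integrable_sq (by fun_prop)).2 hw

theorem lintegral_weightedResid_sq_condAY (P : ProbabilityMeasure (Obs m)) {x : Cov m} {z : Bool}
    (hY : MemLp (fun q : Bool × ℝ => q.2) 2 (condAY P z x)) :
    ∫⁻ q, ENNReal.ofReal (weightedResid P ((x, z), q) ^ 2) ∂(condAY P z x) =
      ENNReal.ofReal (sigmaSq P z x /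
        (propensity P z x * deltaA P x) ^ 2) := by
  have hA : MemLp (fun q : Bool × ℝ => bit q.1) 2 (condAY P z x) :=
    MemLp.of_bound (measurable_bit.comp measurable_fst).aestronglyMeasurable 1
      (ae_of_all _ fun q => abs_bit_le_one q.1)
  have hV : MemLp (fun q : Bool × ℝ => q.2 - bit q.1 * delta P x) 2 (condAY P z x) :=
    hY.sub (hA.mul_const _)
  have hmean : ∫ q : Bool × ℝ, q.2 - bit q.1 * delta P x ∂(condAY P z x) =
      muY P z x - muA P z x * delta P x := by
    rw [integral_sub (hY.integrable one_le_two) ((hA.mul_const _).integrable one_le_two),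
      integral_mul_const]
    rfl
  have hvar : sigmaSq P z x = ∫ q, resid P ((x, z), q) ^ 2 ∂(condAY P z x) := by
    rw [sigmaSq, variance_eq_integral hV.1.aemeasurable, hmean]
    rfl
  have hres : MemLp (fun q => resid P ((x, z), q)) 2 (condAY P z x) :=
    hV.sub (memLp_const (muY P z x - muA P z x * delta P x))
  have e : ∀ q, weightedResid P ((x, z), q) ^ 2 =
      resid P ((x, z), q) ^ 2 / (propensity P z x * deltaA P x) ^ 2 := by
    intro q
    rw [weightedResid, div_pow, mul_pow, armSign_sq, one_mul]
  simp_rw [e]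
  rw [← ofReal_integral_eq_lintegral_ofReal (hres.integrable_sq.div_const _)
    (ae_of_all _ fun q => by positivity), integral_div, hvar]

/-- The variance bound is the sum of the second moments of the two orthogonal parts of the efficient
influence function, with values in `[0, ∞]`. -/
theorem vEff_eq_lintegral {P : ProbabilityMeasure (Obs m)} (hP : P ∈ nonparametricModel m)
    {π : Cov m → ℝ} (hπ : ∀ᵐ x ∂(lawX P), propensity P true x = π x) (τ : ℝ) :
    vEff P π τ = ∫⁻ o, ENNReal.ofReal (weightedResid P o ^ 2) ∂(P : Measure (Obs m)) +
      ∫⁻ o : Obs m, ENNReal.ofReal ((delta P o.1.1 - τ) ^ 2) ∂(P : Measure (Obs m)) := by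
  have hm1 : Measurable fun o => ENNReal.ofReal (weightedResid P o ^ 2) :=
    ((measurable_weightedResid P).pow_const 2).ennreal_ofReal
  have hm2 : Measurable fun x => ENNReal.ofReal ((delta P x - τ) ^ 2) :=
    (((measurable_delta P).sub_const τ).pow_const 2).ennreal_ofReal
  have hm3 : Measurable fun w : Cov m × Bool =>
      ∫⁻ q, ENNReal.ofReal (weightedResid P (w, q) ^ 2) ∂(condAY P w.2 w.1) :=
    Measurable.lintegral_kernel_prod_right' (κ := (P : Measure (Obs m)).condKernel) hm1
  have e2 : ∫⁻ o : Obs m, ENNReal.ofReal ((delta P o.1.1 - τ) ^ 2) ∂(P : Measure (Obs m)) =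
      ∫⁻ x, ENNReal.ofReal ((delta P x - τ) ^ 2) ∂(lawX P) := by
    rw [lawX, Measure.fst, lintegral_map hm2 measurable_fst, Measure.fst]
    exact (lintegral_map (hm2.comp measurable_fst) measurable_fst).symm
  rw [lintegral_eq_lintegral_condAY P hm1, lintegral_fst P hm3, e2,
    ← lintegral_add_right _ hm2, vEff]
  refine lintegral_congr_ae ?_
  filter_upwards [ae_lawX_of_ae_fst P hP.2.1 (ae_memLp_outcome hP), ae_all_iff.2 hP.2.1,
    hP.2.2.1, hπ] with x hY hpos hd hx
  have hs : ∀ z, 0 ≤ sigmaSq P z x := fun z => variance_nonneg _ _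
  have h1 := hpos true
  have h0 := hpos false
  have hx' : 1 - π x = propensity P false x := by linarith [propensity_true_add_false P x]
  rw [Fintype.sum_bool, lintegral_weightedResid_sq_condAY P (hY true),
    lintegral_weightedResid_sq_condAY P (hY false), ← ENNReal.ofReal_mul h1.le,
    ← ENNReal.ofReal_mul h0.le, ← ENNReal.ofReal_add, ← ENNReal.ofReal_add, hx', ← hx]
  · congr 1
    field_simp
  · have := hs true
    have := hs false
    positivity
  · positivity
  · have := hs true
    positivity
  · have := hs false
    positivity

theorem efficiencyBound_mono {𝒪 : Type*} [MeasurableSpace 𝒪]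
    {M₁ M₂ : Set (ProbabilityMeasure 𝒪)} (h : M₁ ⊆ M₂) (R : (ℝ → ProbabilityMeasure 𝒪) → Prop)
    (Ψ : ProbabilityMeasure 𝒪 → ℝ) (P : ProbabilityMeasure 𝒪) :
    efficiencyBound M₁ R Ψ P ≤ efficiencyBound M₂ R Ψ P := by
  refine sSup_le_sSup ?_
  rintro b ⟨p, s, d, h1, h2, h3⟩
  exact ⟨p, s, d, h1, h2.mono fun t ht => h ht, h3⟩

/-- No regular submodel has a Cramér–Rao bound above the second moment of the influence function. -/
theorem efficiencyBound_nonparametricModel_le {P : ProbabilityMeasure (Obs m)}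
    (hP : P ∈ nonparametricModel m) (hδ : MemLp (delta P) 2 (lawX P))
    {π : Cov m → ℝ} (hπ : ∀ᵐ x ∂(lawX P), propensity P true x = π x) :
    efficiencyBound (nonparametricModel m) (LocallyUniformStrength P) ivFunctional P ≤
      vEff P π (ivFunctional P) := by
  refine sSup_le ?_
  rintro b ⟨p, s, d, hp, hM, hR, hd, hI, rfl⟩
  by_cases htop : vEff P π (ivFunctional P) = ∞
  · rw [htop]; exact le_top
  set τ := ivFunctional P with hτ
  have hv := vEff_eq_lintegral hP hπ τ
  have hD : MemLp (weightedResid P) 2 (P : Measure (Obs m)) := by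
    rw [memLp_two_iff_integrable_sq (measurable_weightedResid P).aestronglyMeasurable]
    refine ⟨((measurable_weightedResid P).pow_const 2).aestronglyMeasurable, ?_⟩
    rw [hasFiniteIntegral_iff_ofReal (ae_of_all _ fun o => sq_nonneg _)]
    refine lt_of_le_of_lt ?_ (lt_top_iff_ne_top.2 htop)
    rw [hv]; exact le_self_add
  have he : MemLp (fun o : Obs m => delta P o.1.1 - τ) 2 (P : Measure (Obs m)) :=
    ((memLp_comp_cov_iff P (measurable_delta P) 2).2 hδ).sub (memLp_const τ)
  have hder := hasDerivAt_ivFunctional hP hδ hp hM hR (γ := fun _ => 1) (by simpa using hD)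
    (Eventually.of_forall fun t => ae_of_all _ fun x => Or.inl rfl)
  simp only [one_mul] at hder
  have hdval := hd.unique hder
  have hcross : ∫ o, (delta P o.1.1 - τ) * weightedResid P o ∂(P : Measure (Obs m)) = 0 :=
    integral_mul_weightedResid hP (k := fun w => delta P w.1 - τ) (he.integrable_mul hD)
  have hsq : ∫ o, (weightedResid P o + (delta P o.1.1 - τ)) ^ 2 ∂(P : Measure (Obs m)) =
      (∫ o, weightedResid P o ^ 2 ∂(P : Measure (Obs m))) +
        ∫ o : Obs m, (delta P o.1.1 - τ) ^ 2 ∂(P : Measure (Obs m)) := by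
    have e : ∀ o, (weightedResid P o + (delta P o.1.1 - τ)) ^ 2 = weightedResid P o ^ 2 +
        (delta P o.1.1 - τ) ^ 2 + 2 * ((delta P o.1.1 - τ) * weightedResid P o) :=
      fun o => by ring
    have i1 : Integrable (fun o => weightedResid P o ^ 2 + (delta P o.1.1 - τ) ^ 2)
        (P : Measure (Obs m)) := hD.integrable_sq.add he.integrable_sq
    have i2 : Integrable (fun o => 2 * ((delta P o.1.1 - τ) * weightedResid P o))
        (P : Measure (Obs m)) := (he.integrable_mul hD).const_mul 2
    simp_rw [e]
    rw [integral_add i1 i2, integral_add hD.integrable_sq he.integrable_sq, integral_const_mul,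
      hcross, mul_zero, add_zero]
  have hcs := sq_integral_mul_le (hD.add he) hp.memLp_score
  simp only [Pi.add_apply] at hcs
  rw [← hdval, hsq] at hcs
  rw [hv, ← ofReal_integral_eq_lintegral_ofReal hD.integrable_sq (ae_of_all _ fun o => sq_nonneg _),
    ← ofReal_integral_eq_lintegral_ofReal he.integrable_sq (ae_of_all _ fun o => sq_nonneg _),
    ← ENNReal.ofReal_add (integral_nonneg fun o => sq_nonneg _)
      (integral_nonneg fun o => sq_nonneg _)]
  exact ENNReal.ofReal_le_ofReal ((div_le_iff₀ hI).2 hcs)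

end ObsLaw

/-! ### Paths with bounded scores -/

/-- A path whose likelihood ratio is `1 + t s + O(t²)` uniformly, with `s` bounded, is regular. -/
theorem isRegularPath_of_bounded {𝒪 : Type*} [MeasurableSpace 𝒪] {P : ProbabilityMeasure 𝒪}
    {p : ℝ → ProbabilityMeasure 𝒪} {s : 𝒪 → ℝ} {B C : ℝ} (h0 : p 0 = P) (hs : Measurable s)
    (hB : ∀ o, |s o| ≤ B)
    (hac : ∀ᶠ t in 𝓝 (0 : ℝ), (p t : Measure 𝒪) ≪ (P : Measure 𝒪))
    (hL : ∀ᶠ t in 𝓝 (0 : ℝ), ∀ᵐ o ∂(P : Measure 𝒪),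
      |likelihoodRatio (p t) P o - 1 - t * s o| ≤ C * t ^ 2) : IsRegularPath P p s := by
  have hC0 : 0 ≤ |C| := abs_nonneg C
  have h1 : ∀ᶠ t in 𝓝 (0 : ℝ), |t| ≤ 1 := by
    filter_upwards [Metric.ball_mem_nhds (0 : ℝ) one_pos] with t ht
    simpa using (mem_ball_zero_iff.1 ht).le
  have hLR : ∀ᶠ t in 𝓝 (0 : ℝ), ∀ᵐ o ∂(P : Measure 𝒪),
      (likelihoodRatio (p t) P o - 1) ^ 2 ≤ (|B| + |C|) ^ 2 * t ^ 2 := by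
    filter_upwards [hL, h1] with t ht ht1
    filter_upwards [ht] with o ho
    have e1 : |t * s o| ≤ |B| * |t| := by
      rw [abs_mul, mul_comm]
      exact mul_le_mul_of_nonneg_right ((hB o).trans (le_abs_self B)) (abs_nonneg t)
    have e2 : C * t ^ 2 ≤ |C| * |t| := by
      rw [← sq_abs t]
      calc C * |t| ^ 2 ≤ |C| * |t| ^ 2 := by gcongr; exact le_abs_self C
        _ ≤ |C| * |t| := by
          gcongr
          nlinarith [abs_nonneg t]
    have e3 : |likelihoodRatio (p t) P o - 1| ≤ (|B| + |C|) * |t| := by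
      have := abs_add_le (likelihoodRatio (p t) P o - 1 - t * s o) (t * s o)
      rw [sub_add_cancel] at this
      nlinarith
    rw [← sq_abs, ← sq_abs t, ← mul_pow]
    exact pow_le_pow_left₀ (abs_nonneg _) e3 2
  refine ⟨h0, hac, MemLp.of_bound hs.aestronglyMeasurable B (ae_of_all _ hB), ?_,
    (|B| + |C|) ^ 2, ?_⟩
  · set K : ℝ := (|B| + |C|) ^ 2 + |C| with hK
    have hlim : Tendsto (fun t : ℝ => ENNReal.ofReal (K ^ 2 * t ^ 2)) (𝓝[≠] 0) (𝓝 0) := by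
      have : Continuous fun t : ℝ => ENNReal.ofReal (K ^ 2 * t ^ 2) :=
        ENNReal.continuous_ofReal.comp (by fun_prop)
      simpa using (this.tendsto 0).mono_left nhdsWithin_le_nhds
    refine tendsto_of_tendsto_of_tendsto_of_le_of_le' tendsto_const_nhds hlim
      (Eventually.of_forall fun _ => zero_le) ?_
    filter_upwards [(hLR.and hL).filter_mono nhdsWithin_le_nhds, self_mem_nhdsWithin] with t ht ht0
    have ht0' : 0 < t ^ 2 := by have : t ≠ 0 := ht0; positivity
    rw [ENNReal.div_le_iff (ENNReal.ofReal_pos.2 ht0').ne' ENNReal.ofReal_ne_top,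
      ← ENNReal.ofReal_mul (by positivity)]
    have hbd : ∀ᵐ o ∂(P : Measure 𝒪), ENNReal.ofReal
        ((√(likelihoodRatio (p t) P o) - 1 - t / 2 * s o) ^ 2) ≤
        ENNReal.ofReal (K ^ 2 * t ^ 2 * t ^ 2) := by
      filter_upwards [ht.1, ht.2] with o ho1 ho2
      refine ENNReal.ofReal_le_ofReal ?_
      set r := likelihoodRatio (p t) P o with hr
      have hr0 : 0 ≤ r := likelihoodRatio_nonneg _ _ _
      have hsq : √r ^ 2 = r := Real.sq_sqrt hr0
      have e1 : √r - 1 - t / 2 * s o = (r - 1 - t * s o) / 2 - (√r - 1) ^ 2 / 2 := by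
        linear_combination (1 / 2 : ℝ) * hsq
      have e2 : (√r - 1) ^ 2 ≤ (r - 1) ^ 2 := sq_le_sq.2 (abs_sqrt_sub_one_le hr0)
      have e3 : |√r - 1 - t / 2 * s o| ≤ K * t ^ 2 := by
        rw [e1, abs_le]
        have e4 := abs_le.1 ho2
        have e5 : C * t ^ 2 ≤ |C| * t ^ 2 := by gcongr; exact le_abs_self C
        have e6 : 0 ≤ (√r - 1) ^ 2 := sq_nonneg _
        have e7 : 0 ≤ |C| * t ^ 2 := by positivity
        have e8 : K * t ^ 2 = (|B| + |C|) ^ 2 * t ^ 2 + |C| * t ^ 2 := by rw [hK]; ring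
        constructor <;> linarith [e4.1, e4.2]
      calc _ = |√r - 1 - t / 2 * s o| ^ 2 := (sq_abs _).symm
        _ ≤ (K * t ^ 2) ^ 2 := pow_le_pow_left₀ (abs_nonneg _) e3 2
        _ = _ := by ring
    refine (lintegral_mono_ae hbd).trans ?_
    simp
  · filter_upwards [hLR] with t ht
    calc _ ≤ ∫⁻ _, ENNReal.ofReal ((|B| + |C|) ^ 2 * t ^ 2) ∂(P : Measure 𝒪) :=
          lintegral_mono_ae (ht.mono fun o ho => ENNReal.ofReal_le_ofReal ho)
      _ = _ := by simp

theorem withDensity_compProd {α β : Type*} [MeasurableSpace α] [MeasurableSpace β]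
    (μ : Measure α) [SFinite μ] (κ : Kernel α β) [IsSFiniteKernel κ] {f : α → ℝ≥0∞}
    (hf : Measurable f) :
    (μ.withDensity f) ⊗ₘ κ = (μ ⊗ₘ κ).withDensity fun p => f p.1 := by
  have hf' : Measurable fun p : α × β => f p.1 := hf.comp measurable_fst
  ext s hs
  rw [Measure.compProd_apply hs, withDensity_apply _ hs, ← lintegral_indicator hs,
    Measure.lintegral_compProd (hf'.indicator hs),
    lintegral_withDensity_eq_lintegral_mul _ hf (Kernel.measurable_kernel_prodMk_left hs)]
  refine lintegral_congr fun a => ?_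
  have h : ∀ b, s.indicator (fun p : α × β => f p.1) (a, b) =
      f a * (Prod.mk a ⁻¹' s).indicator 1 b := by
    intro b
    by_cases hb : (a, b) ∈ s <;> simp [hb]
  simp_rw [h]
  rw [lintegral_const_mul _ (measurable_one.indicator (measurable_prodMk_left hs)),
    lintegral_indicator_one (measurable_prodMk_left hs)]
  rfl

/-! ### Perturbations of a law that keep the instrument policy -/

namespace ObsLaw

variable {m : ℕ}

/-- The covariate values at which the compliance score and both propensities are at least `1 / N`,
and `|δ|` and the conditional first absolute moments of the outcome are at most `N`. -/
def goodSet (P : ProbabilityMeasure (Obs m)) (N : ℝ) : Set (Cov m) :=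
  {x | 1 / N ≤ |deltaA P x| ∧ |delta P x| ≤ N ∧ ∀ z, 1 / N ≤ propensity P z x ∧
    ∫⁻ q : Bool × ℝ, ENNReal.ofReal |q.2| ∂(condAY P z x) ≤ ENNReal.ofReal N}

theorem measurableSet_goodSet (P : ProbabilityMeasure (Obs m)) (N : ℝ) :
    MeasurableSet (goodSet P N) := by
  have h : ∀ z, Measurable fun x => ∫⁻ q : Bool × ℝ, ENNReal.ofReal |q.2| ∂(condAY P z x) := by
    intro z
    have hm : Measurable fun o : Obs m => ENNReal.ofReal |o.2.2| := by fun_prop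
    exact (Measurable.lintegral_kernel_prod_right' (κ := (P : Measure (Obs m)).condKernel)
      hm).comp (measurable_prodMk_right (y := z))
  have e : goodSet P N = {x | 1 / N ≤ |deltaA P x|} ∩ ({x | |delta P x| ≤ N} ∩
      ⋂ z, ({x | 1 / N ≤ propensity P z x} ∩
        {x | ∫⁻ q : Bool × ℝ, ENNReal.ofReal |q.2| ∂(condAY P z x) ≤ ENNReal.ofReal N})) := by
    ext x; simp [goodSet]
  rw [e]
  refine (measurableSet_le measurable_const (measurable_deltaA P).abs).inter
    ((measurableSet_le (measurable_delta P).abs measurable_const).inter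
      (MeasurableSet.iInter fun z => ?_))
  exact (measurableSet_le measurable_const (measurable_propensity P z)).inter
    (measurableSet_le (h z) measurable_const)

theorem integrable_of_mem_goodSet {P : ProbabilityMeasure (Obs m)} {N : ℝ} {x : Cov m}
    (hx : x ∈ goodSet P N) (z : Bool) :
    Integrable (fun q : Bool × ℝ => q.2) (condAY P z x) := by
  refine ⟨by fun_prop, ?_⟩
  rw [hasFiniteIntegral_iff_norm]
  exact ((hx.2.2 z).2).trans_lt ENNReal.ofReal_lt_top

theorem integral_abs_le_of_mem_goodSet {P : ProbabilityMeasure (Obs m)} {N : ℝ} (hN : 0 ≤ N)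
    {x : Cov m} (hx : x ∈ goodSet P N) (z : Bool) :
    ∫ q : Bool × ℝ, |q.2| ∂(condAY P z x) ≤ N := by
  rw [integral_eq_lintegral_of_nonneg_ae (ae_of_all _ fun q => abs_nonneg _) (by fun_prop)]
  exact ENNReal.toReal_le_of_le_ofReal hN (hx.2.2 z).2

/-- A bounded direction in the tangent space of the model with known policy: `g₁` has mean zero
given `(X, Z)`, and `g₂` is a function of `X` with mean zero. In addition `g₁` vanishes off
`goodSet P N`, where a small change of the law of `(A, Y)` could make `δ` arbitrarily large. -/
structure IsDirection (P : ProbabilityMeasure (Obs m)) (N B : ℝ) (g₁ : Obs m → ℝ)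
    (g₂ : Cov m → ℝ) : Prop where
  measurable_left : Measurable g₁
  measurable_right : Measurable g₂
  abs_left_le : ∀ o, |g₁ o| ≤ B
  abs_right_le : ∀ x, |g₂ x| ≤ B
  integral_left : ∀ w : Cov m × Bool, ∫ q, g₁ (w, q) ∂(condAY P w.2 w.1) = 0
  integral_right : ∫ x, g₂ x ∂(lawX P) = 0
  eq_zero : ∀ x, x ∉ goodSet P N → ∀ z q, g₁ ((x, z), q) = 0

/-- The law with density `(1 + t g₂(X)) (1 + t g₁)` with respect to `P`; the value is `P` where
this is not a probability measure, which does not happen for small `t`. The factors tilt the law of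
`X` and the conditional law of `(A, Y)`, and leave that of `Z` given `X` as it is. -/
noncomputable def perturb (P : ProbabilityMeasure (Obs m)) (g₁ : Obs m → ℝ) (g₂ : Cov m → ℝ)
    (t : ℝ) : ProbabilityMeasure (Obs m) :=
  open Classical in
  if h : IsProbabilityMeasure ((P : Measure (Obs m)).withDensity fun o =>
      ENNReal.ofReal (1 + t * g₁ o) * ENNReal.ofReal (1 + t * g₂ o.1.1)) then ⟨_, h⟩ else P

/-- The tilted conditional law of `(A, Y)` given `(X, Z)`. -/
noncomputable def tiltedKernel (P : ProbabilityMeasure (Obs m)) (g₁ : Obs m → ℝ) (t : ℝ) :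
    Kernel (Cov m × Bool) (Bool × ℝ) :=
  (P : Measure (Obs m)).condKernel.withDensity fun w q => ENNReal.ofReal (1 + t * g₁ (w, q))

namespace IsDirection

variable {P : ProbabilityMeasure (Obs m)} {N B t : ℝ} {g₁ : Obs m → ℝ} {g₂ : Cov m → ℝ}

theorem bounds_left (h : IsDirection P N B g₁ g₂) (ht : |t| * B ≤ 1 / 2) (o : Obs m) :
    1 / 2 ≤ 1 + t * g₁ o ∧ 1 + t * g₁ o ≤ 3 / 2 := by
  have h1 : |t * g₁ o| ≤ 1 / 2 := by
    rw [abs_mul]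
    exact (mul_le_mul_of_nonneg_left (h.abs_left_le o) (abs_nonneg t)).trans ht
  constructor <;> linarith [(abs_le.1 h1).1, (abs_le.1 h1).2]

theorem bounds_right (h : IsDirection P N B g₁ g₂) (ht : |t| * B ≤ 1 / 2) (x : Cov m) :
    1 / 2 ≤ 1 + t * g₂ x ∧ 1 + t * g₂ x ≤ 3 / 2 := by
  have h1 : |t * g₂ x| ≤ 1 / 2 := by
    rw [abs_mul]
    exact (mul_le_mul_of_nonneg_left (h.abs_right_le x) (abs_nonneg t)).trans ht
  constructor <;> linarith [(abs_le.1 h1).1, (abs_le.1 h1).2]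

theorem measurable_density (h : IsDirection P N B g₁ g₂) (t : ℝ) :
    Measurable fun o => ENNReal.ofReal (1 + t * g₁ o) :=
  ((h.measurable_left.const_mul t).const_add 1).ennreal_ofReal

theorem integrable_section (h : IsDirection P N B g₁ g₂) (w : Cov m × Bool) :
    Integrable (fun q => g₁ (w, q)) (condAY P w.2 w.1) :=
  Integrable.of_bound (h.measurable_left.comp measurable_prodMk_left).aestronglyMeasurable B
    (ae_of_all _ fun _ => h.abs_left_le _)

theorem tiltedKernel_apply (h : IsDirection P N B g₁ g₂) (t : ℝ) (w : Cov m × Bool) :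
    tiltedKernel P g₁ t w = (condAY P w.2 w.1).withDensity fun q =>
      ENNReal.ofReal (1 + t * g₁ (w, q)) :=
  Kernel.withDensity_apply _ (h.measurable_density t) w

theorem isMarkovKernel_tiltedKernel (h : IsDirection P N B g₁ g₂) (ht : |t| * B ≤ 1 / 2) :
    IsMarkovKernel (tiltedKernel P g₁ t) := by
  refine ⟨fun w => ⟨?_⟩⟩
  have hi : Integrable (fun q => 1 + t * g₁ (w, q)) (condAY P w.2 w.1) :=
    (integrable_const 1).add ((h.integrable_section w).const_mul t)
  rw [h.tiltedKernel_apply, withDensity_apply _ MeasurableSet.univ, Measure.restrict_univ,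
    ← ofReal_integral_eq_lintegral_ofReal hi
      (ae_of_all _ fun q => le_trans (by norm_num) (h.bounds_left ht (w, q)).1),
    integral_add (integrable_const 1) ((h.integrable_section w).const_mul t), integral_const_mul,
    h.integral_left]
  simp

theorem isProbabilityMeasure_tilted (h : IsDirection P N B g₁ g₂) (ht : |t| * B ≤ 1 / 2) :
    IsProbabilityMeasure ((lawX P).withDensity fun x => ENNReal.ofReal (1 + t * g₂ x)) := by
  have hi : Integrable g₂ (lawX P) :=
    Integrable.of_bound h.measurable_right.aestronglyMeasurable B (ae_of_all _ h.abs_right_le)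
  have hi' : Integrable (fun x => 1 + t * g₂ x) (lawX P) :=
    (integrable_const 1).add (hi.const_mul t)
  constructor
  rw [withDensity_apply _ MeasurableSet.univ, Measure.restrict_univ,
    ← ofReal_integral_eq_lintegral_ofReal hi'
      (ae_of_all _ fun x => by
        have := (h.bounds_right ht x).1
        simp only [Pi.zero_apply]; linarith),
    integral_add (integrable_const 1) (hi.const_mul t), integral_const_mul, h.integral_right]
  simp

theorem withDensity_eq_compProd (h : IsDirection P N B g₁ g₂) (ht : |t| * B ≤ 1 / 2) :
    ((P : Measure (Obs m)).withDensity fun o =>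
      ENNReal.ofReal (1 + t * g₁ o) * ENNReal.ofReal (1 + t * g₂ o.1.1)) =
    (((lawX P).withDensity fun x => ENNReal.ofReal (1 + t * g₂ x)) ⊗ₘ
      (P : Measure (Obs m)).fst.condKernel) ⊗ₘ tiltedKernel P g₁ t := by
  have := h.isMarkovKernel_tiltedKernel ht
  have hm2 : Measurable fun x => ENNReal.ofReal (1 + t * g₂ x) :=
    ((h.measurable_right.const_mul t).const_add 1).ennreal_ofReal
  have hm2' : Measurable fun w : Cov m × Bool => ENNReal.ofReal (1 + t * g₂ w.1) :=
    hm2.comp measurable_fst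
  have hm2'' : Measurable fun o : Obs m => ENNReal.ofReal (1 + t * g₂ o.1.1) :=
    hm2'.comp measurable_fst
  have e1 : lawX P ⊗ₘ (P : Measure (Obs m)).fst.condKernel = (P : Measure (Obs m)).fst :=
    (P : Measure (Obs m)).fst.disintegrate _
  have e2 : (P : Measure (Obs m)).fst ⊗ₘ tiltedKernel P g₁ t =
      (P : Measure (Obs m)).withDensity fun o => ENNReal.ofReal (1 + t * g₁ o) := by
    have : IsSFiniteKernel ((P : Measure (Obs m)).condKernel.withDensity
      fun w q => ENNReal.ofReal (1 + t * g₁ (w, q))) := by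
        change IsSFiniteKernel (tiltedKernel P g₁ t); infer_instance
    rw [tiltedKernel, Measure.compProd_withDensity (h.measurable_density t),
      (P : Measure (Obs m)).disintegrate]
  rw [withDensity_compProd _ _ hm2, e1, withDensity_compProd _ _ hm2', e2,
    ← withDensity_mul _ (h.measurable_density t) hm2'']
  rfl

theorem coe_perturb (h : IsDirection P N B g₁ g₂) (ht : |t| * B ≤ 1 / 2) :
    (perturb P g₁ g₂ t : Measure (Obs m)) =
      (P : Measure (Obs m)).withDensity fun o =>
        ENNReal.ofReal (1 + t * g₁ o) * ENNReal.ofReal (1 + t * g₂ o.1.1) := by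
  have hp : IsProbabilityMeasure ((P : Measure (Obs m)).withDensity fun o =>
      ENNReal.ofReal (1 + t * g₁ o) * ENNReal.ofReal (1 + t * g₂ o.1.1)) := by
    have := h.isMarkovKernel_tiltedKernel ht
    have := h.isProbabilityMeasure_tilted ht
    rw [h.withDensity_eq_compProd ht]
    infer_instance
  have e : perturb P g₁ g₂ t = ⟨_, hp⟩ := dif_pos hp
  rw [e]
  rfl

theorem perturb_zero (h : IsDirection P N B g₁ g₂) : perturb P g₁ g₂ 0 = P := by
  apply Subtype.ext
  refine (h.coe_perturb (t := 0) (by simp)).trans ?_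
  simp

theorem fst_perturb (h : IsDirection P N B g₁ g₂) (ht : |t| * B ≤ 1 / 2) :
    (perturb P g₁ g₂ t : Measure (Obs m)).fst =
      ((lawX P).withDensity fun x => ENNReal.ofReal (1 + t * g₂ x)) ⊗ₘ
        (P : Measure (Obs m)).fst.condKernel := by
  have := h.isMarkovKernel_tiltedKernel ht
  have := h.isProbabilityMeasure_tilted ht
  rw [h.coe_perturb ht, h.withDensity_eq_compProd ht, Measure.fst_compProd]

theorem lawX_perturb (h : IsDirection P N B g₁ g₂) (ht : |t| * B ≤ 1 / 2) :
    lawX (perturb P g₁ g₂ t) = (lawX P).withDensity fun x => ENNReal.ofReal (1 + t * g₂ x) := by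
  have := h.isProbabilityMeasure_tilted ht
  rw [lawX, h.fst_perturb ht, Measure.fst_compProd]

theorem propensity_perturb (h : IsDirection P N B g₁ g₂) (ht : |t| * B ≤ 1 / 2) :
    ∀ᵐ x ∂(lawX (perturb P g₁ g₂ t)), ∀ z,
      propensity (perturb P g₁ g₂ t) z x = propensity P z x := by
  have := h.isProbabilityMeasure_tilted ht
  rw [h.lawX_perturb ht]
  have := condKernel_compProd ((lawX P).withDensity fun x => ENNReal.ofReal (1 + t * g₂ x))
    (P : Measure (Obs m)).fst.condKernel
  filter_upwards [this] with x hx z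
  simp only [propensity, h.fst_perturb ht]
  rw [hx]

theorem perturb_absolutelyContinuous (h : IsDirection P N B g₁ g₂) (ht : |t| * B ≤ 1 / 2) :
    (perturb P g₁ g₂ t : Measure (Obs m)) ≪ (P : Measure (Obs m)) := by
  rw [h.coe_perturb ht]
  exact withDensity_absolutelyContinuous _ _

theorem perturb_le (h : IsDirection P N B g₁ g₂) (ht : |t| * B ≤ 1 / 2) :
    (perturb P g₁ g₂ t : Measure (Obs m)) ≤ ENNReal.ofReal (9 / 4) • (P : Measure (Obs m)) := by
  rw [h.coe_perturb ht, ← withDensity_const]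
  refine withDensity_mono (ae_of_all _ fun o => ?_)
  have h1 := h.bounds_left ht o
  have h2 := h.bounds_right ht o.1.1
  beta_reduce
  rw [← ENNReal.ofReal_mul (by linarith)]
  refine ENNReal.ofReal_le_ofReal ?_
  nlinarith

theorem propensity_perturb_pos (h : IsDirection P N B g₁ g₂) (hP : P ∈ nonparametricModel m)
    (ht : |t| * B ≤ 1 / 2) :
    ∀ z, ∀ᵐ x ∂(lawX (perturb P g₁ g₂ t)), 0 < propensity (perturb P g₁ g₂ t) z x := by
  intro z
  filter_upwards [h.propensity_perturb ht,
    (lawX_absolutelyContinuous (h.perturb_absolutelyContinuous ht)).ae_le (hP.2.1 z)] with x h1 h2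
  rwa [h1 z]

theorem condAY_perturb (h : IsDirection P N B g₁ g₂) (hP : P ∈ nonparametricModel m)
    (ht : |t| * B ≤ 1 / 2) :
    ∀ᵐ x ∂(lawX (perturb P g₁ g₂ t)), ∀ z, condAY (perturb P g₁ g₂ t) z x =
      (condAY P z x).withDensity fun q => ENNReal.ofReal (1 + t * g₁ ((x, z), q)) := by
  have := h.isMarkovKernel_tiltedKernel ht
  have h2 : (perturb P g₁ g₂ t : Measure (Obs m)).fst ⊗ₘ tiltedKernel P g₁ t =
      (perturb P g₁ g₂ t : Measure (Obs m)) := by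
    rw [h.fst_perturb ht, ← h.withDensity_eq_compProd ht, h.coe_perturb ht]
  have h1 := eq_condKernel_of_measure_eq_compProd (tiltedKernel P g₁ t) h2.symm
  filter_upwards [ae_lawX_of_ae_fst _ (h.propensity_perturb_pos hP ht) h1] with x hx z
  exact (hx z).symm.trans (h.tiltedKernel_apply t (x, z))

theorem integral_tilted (h : IsDirection P N B g₁ g₂) (ht : |t| * B ≤ 1 / 2) (x : Cov m) (z : Bool)
    (f : Bool × ℝ → ℝ) :
    ∫ q, f q ∂((condAY P z x).withDensity fun q => ENNReal.ofReal (1 + t * g₁ ((x, z), q))) =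
      ∫ q, (1 + t * g₁ ((x, z), q)) * f q ∂(condAY P z x) := by
  have hm : Measurable fun q => ENNReal.ofReal (1 + t * g₁ ((x, z), q)) :=
    (h.measurable_density t).comp measurable_prodMk_left
  rw [integral_withDensity_eq_integral_toReal_smul hm (ae_of_all _ fun q => ENNReal.ofReal_lt_top)]
  refine integral_congr_ae (ae_of_all _ fun q => ?_)
  have := (h.bounds_left ht ((x, z), q)).1
  simp only [smul_eq_mul]
  rw [ENNReal.toReal_ofReal (by linarith)]

theorem mu_perturb_of_notMem (h : IsDirection P N B g₁ g₂) (hP : P ∈ nonparametricModel m)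
    (ht : |t| * B ≤ 1 / 2) : ∀ᵐ x ∂(lawX (perturb P g₁ g₂ t)), x ∉ goodSet P N →
      deltaA (perturb P g₁ g₂ t) x = deltaA P x ∧ delta (perturb P g₁ g₂ t) x = delta P x := by
  filter_upwards [h.condAY_perturb hP ht] with x hx hxG
  have e : ∀ z, condAY (perturb P g₁ g₂ t) z x = condAY P z x := by
    intro z
    rw [hx z]
    simp [h.eq_zero x hxG z]
  simp only [delta, deltaA, deltaY, muA, muY, e, and_self]

theorem abs_deltaA_perturb (h : IsDirection P N B g₁ g₂) (hP : P ∈ nonparametricModel m)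
    (hN : 1 ≤ N) (ht : |t| * (4 * B * N) ≤ 1) (ht' : |t| * B ≤ 1 / 2) :
    ∀ᵐ x ∂(lawX (perturb P g₁ g₂ t)),
      1 / 2 * |deltaA P x| ≤ |deltaA (perturb P g₁ g₂ t) x| := by
  filter_upwards [h.condAY_perturb hP ht', h.mu_perturb_of_notMem hP ht'] with x hx hxG
  by_cases hG : x ∈ goodSet P N
  swap
  · rw [(hxG hG).1]
    linarith [abs_nonneg (deltaA P x)]
  have hmu : ∀ z, |muA (perturb P g₁ g₂ t) z x - muA P z x| ≤ |t| * B := by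
    intro z
    have i1 : Integrable (fun q : Bool × ℝ => bit q.1) (condAY P z x) :=
      integrable_bit_comp _ measurable_fst
    have i2 : Integrable (fun q : Bool × ℝ => t * (g₁ ((x, z), q) * bit q.1)) (condAY P z x) := by
      refine Integrable.const_mul ?_ t
      exact i1.bdd_mul (h.integrable_section (x, z)).1 (ae_of_all _ fun q => h.abs_left_le _)
    rw [muA, muA, hx z, h.integral_tilted ht']
    have e : ∀ q : Bool × ℝ, (1 + t * g₁ ((x, z), q)) * bit q.1 =
        bit q.1 + t * (g₁ ((x, z), q) * bit q.1) := fun q => by ring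
    simp_rw [e]
    rw [integral_add i1 i2, add_sub_cancel_left]
    have hb : ∀ᵐ q ∂(condAY P z x), ‖t * (g₁ ((x, z), q) * bit q.1)‖ ≤ |t| * B := by
      refine ae_of_all _ fun q => ?_
      rw [Real.norm_eq_abs, abs_mul, abs_mul]
      refine mul_le_mul_of_nonneg_left ?_ (abs_nonneg t)
      exact (mul_le_of_le_one_right (abs_nonneg _) (abs_bit_le_one _)).trans (h.abs_left_le _)
    simpa using norm_integral_le_of_norm_le_const hb
  have h1 := abs_le.1 (hmu true)
  have h0 := abs_le.1 (hmu false)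
  have hd : |deltaA P x - deltaA (perturb P g₁ g₂ t) x| ≤ 2 * (|t| * B) := by
    rw [deltaA, deltaA, abs_le]
    constructor <;> linarith [h1.1, h1.2, h0.1, h0.2]
  have h2 : 2 * (|t| * B) ≤ 1 / 2 * |deltaA P x| := by
    have h3 : 2 * (|t| * B) ≤ 1 / 2 * (1 / N) := by
      rw [mul_one_div, le_div_iff₀ (by linarith)]
      linarith
    linarith [hG.1]
  have h4 := abs_sub_abs_le_abs_sub (deltaA P x) (deltaA (perturb P g₁ g₂ t) x)
  linarith

theorem abs_delta_perturb_le (h : IsDirection P N B g₁ g₂) (hP : P ∈ nonparametricModel m)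
    (hN : 1 ≤ N) (ht : |t| * (4 * B * N) ≤ 1) (ht' : |t| * B ≤ 1 / 2) :
    ∀ᵐ x ∂(lawX (perturb P g₁ g₂ t)),
      |delta (perturb P g₁ g₂ t) x| ≤ |delta P x| + 8 * N ^ 2 := by
  filter_upwards [h.condAY_perturb hP ht', h.mu_perturb_of_notMem hP ht',
    h.abs_deltaA_perturb hP hN ht ht'] with x hx hxG hdA
  by_cases hG : x ∈ goodSet P N
  swap
  · rw [(hxG hG).2]
    linarith [sq_nonneg N]
  have hmu : ∀ z, |muY (perturb P g₁ g₂ t) z x| ≤ 2 * N := by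
    intro z
    rw [muY, hx z, h.integral_tilted ht', ← Real.norm_eq_abs]
    calc ‖∫ q : Bool × ℝ, (1 + t * g₁ ((x, z), q)) * q.2 ∂(condAY P z x)‖
        ≤ ∫ q : Bool × ℝ, 2 * |q.2| ∂(condAY P z x) := by
          refine norm_integral_le_of_norm_le ((integrable_of_mem_goodSet hG z).abs.const_mul 2)
            (ae_of_all _ fun q => ?_)
          have := h.bounds_left ht' ((x, z), q)
          rw [Real.norm_eq_abs, abs_mul, abs_of_nonneg (by linarith [this.1])]
          exact mul_le_mul_of_nonneg_right (by linarith [this.2]) (abs_nonneg _)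
      _ ≤ 2 * N := by
          rw [integral_const_mul]
          linarith [integral_abs_le_of_mem_goodSet (by linarith) hG z]
  have h1 := abs_le.1 (hmu true)
  have h0 := abs_le.1 (hmu false)
  have hY : |deltaY (perturb P g₁ g₂ t) x| ≤ 4 * N := by
    rw [deltaY, abs_le]
    constructor <;> linarith [h1.1, h1.2, h0.1, h0.2]
  have hA : 1 / (2 * N) ≤ |deltaA (perturb P g₁ g₂ t) x| := by
    have : 1 / (2 * N) = 1 / 2 * (1 / N) := by field_simp
    linarith [hG.1]
  have hN2 : 0 < 1 / (2 * N) := by positivity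
  have : |delta (perturb P g₁ g₂ t) x| ≤ 8 * N ^ 2 := by
    rw [delta, abs_div, div_le_iff₀ (hN2.trans_le hA)]
    calc _ ≤ 4 * N := hY
      _ = 8 * N ^ 2 * (1 / (2 * N)) := by field_simp; ring
      _ ≤ _ := by gcongr
  linarith [abs_nonneg (delta P x)]

theorem perturb_mem (h : IsDirection P N B g₁ g₂) (hP : P ∈ nonparametricModel m)
    (hN : 1 ≤ N) (ht : |t| * (4 * B * N) ≤ 1) (ht' : |t| * B ≤ 1 / 2) :
    perturb P g₁ g₂ t ∈ nonparametricModel m := by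
  have hac := lawX_absolutelyContinuous (h.perturb_absolutelyContinuous ht')
  have hmem : ∀ {f : Obs m → ℝ} {r : ℝ≥0∞}, MemLp f r (P : Measure (Obs m)) →
      MemLp f r (perturb P g₁ g₂ t : Measure (Obs m)) := fun hf =>
    hf.of_measure_le_smul ENNReal.ofReal_ne_top (h.perturb_le ht')
  refine ⟨hmem hP.1, h.propensity_perturb_pos hP ht', ?_, ?_⟩
  · filter_upwards [h.abs_deltaA_perturb hP hN ht ht', hac.ae_le hP.2.2.1] with x h1 h2
    have := abs_pos.2 h2
    exact abs_pos.1 (by linarith)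
  · have h1 : Integrable (delta P) (lawX (perturb P g₁ g₂ t)) := by
      have h2 := (memLp_comp_cov_iff P (measurable_delta P) 1).2
        (memLp_one_iff_integrable.2 hP.2.2.2)
      exact memLp_one_iff_integrable.1
        ((memLp_comp_cov_iff _ (measurable_delta P) 1).1 (hmem h2))
    exact (h1.abs.add (integrable_const (8 * N ^ 2))).mono'
      (measurable_delta _).aestronglyMeasurable (h.abs_delta_perturb_le hP hN ht ht')

theorem likelihoodRatio_perturb (h : IsDirection P N B g₁ g₂) (ht : |t| * B ≤ 1 / 2) :
    ∀ᵐ o ∂(P : Measure (Obs m)), likelihoodRatio (perturb P g₁ g₂ t) P o =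
      (1 + t * g₁ o) * (1 + t * g₂ o.1.1) := by
  have hm2 : Measurable fun o : Obs m => ENNReal.ofReal (1 + t * g₂ o.1.1) :=
    (((h.measurable_right.comp (measurable_fst.comp measurable_fst)).const_mul
      t).const_add 1).ennreal_ofReal
  have h1 := Measure.rnDeriv_withDensity (P : Measure (Obs m))
    (f := fun o => ENNReal.ofReal (1 + t * g₁ o) * ENNReal.ofReal (1 + t * g₂ o.1.1))
    ((h.measurable_density t).mul hm2)
  rw [← h.coe_perturb ht] at h1
  filter_upwards [h1] with o ho
  rw [likelihoodRatio, ho, ENNReal.toReal_mul,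
    ENNReal.toReal_ofReal (by linarith [(h.bounds_left ht o).1]),
    ENNReal.toReal_ofReal (by linarith [(h.bounds_right ht o.1.1).1])]

/-- The two smallness conditions under which the perturbed laws are probability measures and stay
in the model. -/
theorem eventually_small (B N : ℝ) :
    ∀ᶠ t in 𝓝 (0 : ℝ), |t| * (4 * B * N) ≤ 1 ∧ |t| * B ≤ 1 / 2 := by
  have h : ∀ a b : ℝ, 0 < b → ∀ᶠ t in 𝓝 (0 : ℝ), |t| * a ≤ b := by
    intro a b hb
    have hc : Continuous fun t : ℝ => |t| * a := by fun_prop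
    have := hc.tendsto 0
    simp only [abs_zero, zero_mul] at this
    exact this.eventually_le_const hb
  exact (h _ _ one_pos).and (h _ _ (by norm_num))

theorem isRegularPath_perturb (h : IsDirection P N B g₁ g₂) :
    IsRegularPath P (perturb P g₁ g₂) (fun o => g₁ o + g₂ o.1.1) := by
  have hm2 : Measurable fun o : Obs m => g₂ o.1.1 :=
    h.measurable_right.comp (measurable_fst.comp measurable_fst)
  refine isRegularPath_of_bounded (B := B + B) (C := B * B) h.perturb_zero
    (h.measurable_left.add hm2)
    (fun o => (abs_add_le _ _).trans (add_le_add (h.abs_left_le o) (h.abs_right_le _))) ?_ ?_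
  · filter_upwards [eventually_small B N] with t ht using h.perturb_absolutelyContinuous ht.2
  · filter_upwards [eventually_small B N] with t ht
    filter_upwards [h.likelihoodRatio_perturb ht.2] with o ho
    have e : likelihoodRatio (perturb P g₁ g₂ t) P o - 1 - t * (g₁ o + g₂ o.1.1) =
        g₁ o * g₂ o.1.1 * t ^ 2 := by rw [ho]; ring
    rw [e, abs_mul, abs_mul, abs_of_nonneg (sq_nonneg t)]
    refine mul_le_mul_of_nonneg_right ?_ (sq_nonneg t)
    exact mul_le_mul (h.abs_left_le o) (h.abs_right_le _) (abs_nonneg _)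
      ((abs_nonneg _).trans (h.abs_left_le o))

theorem locallyUniformStrength_perturb (h : IsDirection P N B g₁ g₂)
    (hP : P ∈ nonparametricModel m) (hN : 1 ≤ N) :
    LocallyUniformStrength P (perturb P g₁ g₂) := by
  refine ⟨1 / 2, by norm_num, ?_⟩
  filter_upwards [eventually_small B N] with t ht
  filter_upwards [h.abs_deltaA_perturb hP hN ht.1 ht.2, h.propensity_perturb ht.2] with x h1 h2
  refine ⟨h1, fun z => ?_⟩
  rw [h2 z]
  linarith [propensity_nonneg P z x]

theorem integral_mul_left_eq_zero (h : IsDirection P N B g₁ g₂) {k : Cov m × Bool → ℝ}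
    (hk : Integrable (fun o => k o.1 * g₁ o) (P : Measure (Obs m))) :
    ∫ o, k o.1 * g₁ o ∂(P : Measure (Obs m)) = 0 := by
  rw [integral_eq_integral_condAY P hk]
  simp_rw [integral_const_mul, h.integral_left, mul_zero, integral_zero]

end IsDirection

end ObsLaw

/-! ### Approximately least favorable submodels -/

namespace ObsLaw

variable {m : ℕ}

theorem memLp_two_of_bound {𝒪 : Type*} [MeasurableSpace 𝒪] {μ : Measure 𝒪} [IsFiniteMeasure μ]
    {f : 𝒪 → ℝ} (hf : Measurable f) {K : ℝ} (hK : ∀ o, |f o| ≤ K) : MemLp f 2 μ :=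
  MemLp.of_bound hf.aestronglyMeasurable K (ae_of_all _ hK)

/-- A real number, replaced by zero when its absolute value exceeds `N`. -/
noncomputable def cutoff (N a : ℝ) : ℝ := if |a| ≤ N then a else 0

theorem measurable_cutoff (N : ℝ) : Measurable (cutoff N) :=
  Measurable.ite (measurableSet_le measurable_id.abs measurable_const) measurable_id
    measurable_const

theorem abs_cutoff_le {N : ℝ} (hN : 0 ≤ N) (a : ℝ) : |cutoff N a| ≤ N := by
  unfold cutoff; split_ifs with h
  · exact h
  · simpa using hN

theorem mul_cutoff (N a : ℝ) : a * cutoff N a = cutoff N a ^ 2 := by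
  unfold cutoff; split_ifs
  · ring
  · simp

/-- The indicator of the covariate values in `goodSet P N`. -/
noncomputable def goodInd (P : ProbabilityMeasure (Obs m)) (N : ℝ) : Cov m → ℝ :=
  (goodSet P N).indicator 1

theorem measurable_goodInd (P : ProbabilityMeasure (Obs m)) (N : ℝ) :
    Measurable (goodInd P N) := measurable_one.indicator (measurableSet_goodSet P N)

theorem goodInd_eq (P : ProbabilityMeasure (Obs m)) (N : ℝ) (x : Cov m) :
    x ∈ goodSet P N ∧ goodInd P N x = 1 ∨ x ∉ goodSet P N ∧ goodInd P N x = 0 := by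
  by_cases h : x ∈ goodSet P N <;> simp [goodInd, h]

/-- The weighted residual, truncated to a bounded function. -/
noncomputable def truncResid (P : ProbabilityMeasure (Obs m)) (N : ℝ) (o : Obs m) : ℝ :=
  goodInd P N o.1.1 * cutoff N (weightedResid P o)

theorem measurable_truncResid (P : ProbabilityMeasure (Obs m)) (N : ℝ) :
    Measurable (truncResid P N) :=
  ((measurable_goodInd P N).comp (by fun_prop)).mul
    ((measurable_cutoff N).comp (measurable_weightedResid P))

theorem abs_truncResid_le (P : ProbabilityMeasure (Obs m)) {N : ℝ} (hN : 0 ≤ N) (o : Obs m) :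
    |truncResid P N o| ≤ N := by
  rw [truncResid]
  rcases goodInd_eq P N o.1.1 with ⟨-, h⟩ | ⟨-, h⟩ <;> rw [h]
  · rw [one_mul]; exact abs_cutoff_le hN _
  · simpa using hN

/-- The conditional mean of the truncated residual given `(X, Z)`. -/
noncomputable def truncMean (P : ProbabilityMeasure (Obs m)) (N : ℝ) (w : Cov m × Bool) : ℝ :=
  ∫ q, truncResid P N (w, q) ∂(condAY P w.2 w.1)

theorem measurable_truncMean (P : ProbabilityMeasure (Obs m)) (N : ℝ) :
    Measurable (truncMean P N) :=
  measurable_integral_condAY P (measurable_truncResid P N)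

theorem abs_truncMean_le (P : ProbabilityMeasure (Obs m)) {N : ℝ} (hN : 0 ≤ N)
    (w : Cov m × Bool) : |truncMean P N w| ≤ N := by
  have hb : ∀ᵐ q ∂(condAY P w.2 w.1), ‖truncResid P N (w, q)‖ ≤ N :=
    ae_of_all _ fun q => abs_truncResid_le P hN (w, q)
  simpa [truncMean] using norm_integral_le_of_norm_le_const hb

/-- The centered effect `δ(X) - τ`, truncated to a bounded function. -/
noncomputable def truncEffect (P : ProbabilityMeasure (Obs m)) (N : ℝ) (x : Cov m) : ℝ :=
  cutoff N (delta P x - ivFunctional P)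

theorem measurable_truncEffect (P : ProbabilityMeasure (Obs m)) (N : ℝ) :
    Measurable (truncEffect P N) :=
  (measurable_cutoff N).comp ((measurable_delta P).sub_const _)

theorem abs_truncEffect_le (P : ProbabilityMeasure (Obs m)) {N : ℝ} (hN : 0 ≤ N) (x : Cov m) :
    |truncEffect P N x| ≤ N := abs_cutoff_le hN _

/-- The bounded approximation to the efficient influence function, recentered so that it lies in the
tangent space of the model with known policy. -/
theorem isDirection_trunc (P : ProbabilityMeasure (Obs m)) {N : ℝ} (hN : 0 ≤ N) :
    IsDirection P N (2 * N) (fun o => truncResid P N o - truncMean P N o.1)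
      (fun x => truncEffect P N x - ∫ x', truncEffect P N x' ∂(lawX P)) where
  measurable_left :=
    (measurable_truncResid P N).sub ((measurable_truncMean P N).comp measurable_fst)
  measurable_right := (measurable_truncEffect P N).sub_const _
  abs_left_le o := by
    have h1 := abs_le.1 (abs_truncResid_le P hN o)
    have h2 := abs_le.1 (abs_truncMean_le P hN o.1)
    rw [abs_le]; constructor <;> linarith [h1.1, h1.2, h2.1, h2.2]
  abs_right_le x := by
    have hb : ∀ᵐ x' ∂(lawX P), ‖truncEffect P N x'‖ ≤ N :=
      ae_of_all _ fun x' => abs_truncEffect_le P hN x'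
    have h := norm_integral_le_of_norm_le_const hb
    rw [probReal_univ, mul_one, Real.norm_eq_abs] at h
    have h1 := abs_le.1 (abs_truncEffect_le P hN x)
    have h2 := abs_le.1 h
    rw [abs_le]; constructor <;> linarith [h1.1, h1.2, h2.1, h2.2]
  integral_left w := by
    have hi : Integrable (fun q => truncResid P N (w, q)) (condAY P w.2 w.1) :=
      Integrable.of_bound
        ((measurable_truncResid P N).comp measurable_prodMk_left).aestronglyMeasurable N
        (ae_of_all _ fun q => abs_truncResid_le P hN (w, q))
    change ∫ q, truncResid P N (w, q) - truncMean P N w ∂(condAY P w.2 w.1) = 0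
    rw [integral_sub hi (integrable_const _)]
    simp [truncMean]
  integral_right := by
    have hi : Integrable (truncEffect P N) (lawX P) :=
      (memLp_two_of_bound (measurable_truncEffect P N) (abs_truncEffect_le P hN)).integrable
        one_le_two
    rw [integral_sub hi (integrable_const _)]
    simp
  eq_zero x hx z q := by
    have h : ∀ q, truncResid P N ((x, z), q) = 0 := fun q => by
      rw [truncResid]
      rcases goodInd_eq P N x with ⟨h, -⟩ | ⟨-, h⟩
      · exact absurd h hx
      · rw [h, zero_mul]
    simp [truncMean, h]

/-- On `goodSet P N` the influence function is square integrable, even if it is not so globally. -/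
theorem memLp_goodInd_mul_weightedResid {P : ProbabilityMeasure (Obs m)}
    (hP : P ∈ nonparametricModel m) {N : ℝ} (hN : 0 < N) :
    MemLp (fun o : Obs m => goodInd P N o.1.1 * weightedResid P o) 2 (P : Measure (Obs m)) := by
  have hb : MemLp (fun o : Obs m => N ^ 2 * (|o.2.2| + 3 * N)) 2 (P : Measure (Obs m)) :=
    (hP.1.abs.add (memLp_const (3 * N))).const_mul (N ^ 2)
  have hm : Measurable fun o : Obs m => goodInd P N o.1.1 * weightedResid P o :=
    ((measurable_goodInd P N).comp (by fun_prop)).mul (measurable_weightedResid P)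
  refine hb.mono hm.aestronglyMeasurable (ae_of_all _ fun o => ?_)
  have hpos : 0 ≤ N ^ 2 * (|o.2.2| + 3 * N) := by positivity
  rw [Real.norm_eq_abs, Real.norm_eq_abs, abs_of_nonneg hpos]
  rcases goodInd_eq P N o.1.1 with ⟨hx, h⟩ | ⟨-, h⟩
  swap
  · rw [h, zero_mul, abs_zero]; exact hpos
  rw [h, one_mul, weightedResid, abs_div, abs_mul, abs_armSign, one_mul, abs_mul,
    abs_of_nonneg (propensity_nonneg P _ _)]
  have hinv : 0 < 1 / N := by positivity
  have hden : 1 / N * (1 / N) ≤ propensity P o.1.2 o.1.1 * |deltaA P o.1.1| :=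
    mul_le_mul (hx.2.2 _).1 hx.1 hinv.le (propensity_nonneg P _ _)
  have hres : |resid P o| ≤ |o.2.2| + 3 * N := by
    have h1 := hx.2.1
    have h2 : |muY P o.1.2 o.1.1| ≤ N := by
      rw [muY, ← Real.norm_eq_abs]
      exact (norm_integral_le_integral_norm _).trans (integral_abs_le_of_mem_goodSet hN.le hx _)
    have h3 : |bit o.2.1 * delta P o.1.1| ≤ N := by
      rw [abs_mul]
      exact (mul_le_of_le_one_left (abs_nonneg _) (abs_bit_le_one _)).trans h1
    have h4 : |muA P o.1.2 o.1.1 * delta P o.1.1| ≤ N := by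
      rw [abs_mul, abs_of_nonneg (muA_nonneg P _ _)]
      exact (mul_le_of_le_one_left (abs_nonneg _) (muA_le_one P _ _)).trans h1
    rw [resid, abs_le]
    constructor <;> linarith [(abs_le.1 h2).1, (abs_le.1 h2).2, (abs_le.1 h3).1, (abs_le.1 h3).2,
      (abs_le.1 h4).1, (abs_le.1 h4).2, neg_abs_le o.2.2, le_abs_self o.2.2]
  rw [div_le_iff₀ ((mul_pos hinv hinv).trans_le hden)]
  calc |resid P o| ≤ |o.2.2| + 3 * N := hres
    _ = N ^ 2 * (|o.2.2| + 3 * N) * (1 / N * (1 / N)) := by field_simp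
    _ ≤ _ := mul_le_mul_of_nonneg_left hden hpos

/-- The submodel in the truncated direction attains a Cramér–Rao bound that is at least the second
moment of the truncated influence function: the derivative of the functional equals that second
moment, and recentering can only have decreased the Fisher information. -/
theorem ofReal_integral_trunc_le_efficiencyBound {P : ProbabilityMeasure (Obs m)}
    (hP : P ∈ nonparametricModel m) (hδ : MemLp (delta P) 2 (lawX P))
    {π : Cov m → ℝ} (hπ : ∀ᵐ x ∂(lawX P), propensity P true x = π x) {N : ℝ} (hN : 1 ≤ N) :
    ENNReal.ofReal (∫ o, truncResid P N o ^ 2 ∂(P : Measure (Obs m)) +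
      ∫ o : Obs m, truncEffect P N o.1.1 ^ 2 ∂(P : Measure (Obs m))) ≤
      efficiencyBound (fixedPolicyModel π) (LocallyUniformStrength P) ivFunctional P := by
  have hN0 : 0 ≤ N := by linarith
  have hdir := isDirection_trunc P hN0
  set μ : Measure (Obs m) := (P : Measure (Obs m)) with hμ
  set T : Obs m → ℝ := truncResid P N with hT
  set k : Cov m × Bool → ℝ := truncMean P N with hk
  set S : Obs m → ℝ := fun o => truncEffect P N o.1.1 with hS
  set b : ℝ := ∫ x', truncEffect P N x' ∂(lawX P) with hb
  set g₁ : Obs m → ℝ := fun o => T o - k o.1 with hg₁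
  set e : Obs m → ℝ := fun o => delta P o.1.1 - ivFunctional P with he
  set ψ : Obs m → ℝ := fun o => goodInd P N o.1.1 * weightedResid P o with hψ
  have hSm : Measurable S := (measurable_truncEffect P N).comp (by fun_prop)
  have hkm : Measurable fun o : Obs m => k o.1 := (measurable_truncMean P N).comp (by fun_prop)
  have LT : MemLp T 2 μ :=
    memLp_two_of_bound (measurable_truncResid P N) (abs_truncResid_le P hN0)
  have Lk : MemLp (fun o : Obs m => k o.1) 2 μ :=
    memLp_two_of_bound hkm fun o => abs_truncMean_le P hN0 o.1
  have LS : MemLp S 2 μ := memLp_two_of_bound hSm fun o => abs_truncEffect_le P hN0 o.1.1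
  have Lg₁ : MemLp g₁ 2 μ := LT.sub Lk
  have Lg₂ : MemLp (fun o => S o - b) 2 μ := LS.sub (memLp_const b)
  have Lψ : MemLp ψ 2 μ := memLp_goodInd_mul_weightedResid hP (by linarith)
  have Lδ : MemLp (fun o : Obs m => delta P o.1.1) 2 μ :=
    (memLp_comp_cov_iff P (measurable_delta P) 2).2 hδ
  have Le : MemLp e 2 μ := Lδ.sub (memLp_const _)
  have hSb : ∫ o, S o ∂μ = b := integral_comp_cov P (measurable_truncEffect P N)
  have he0 : ∫ o, e o ∂μ = 0 := by
    rw [integral_sub (Lδ.integrable one_le_two) (integrable_const _),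
      integral_comp_cov P (measurable_delta P)]
    simp [ivFunctional]
  -- Mean zero given `(X, Z)` makes both residual terms orthogonal to the functions of `(X, Z)`.
  have ortho : ∀ {f : Cov m × Bool → ℝ}, MemLp (fun o : Obs m => f o.1) 2 μ →
      ∫ o, f o.1 * g₁ o ∂μ = 0 := fun hf => hdir.integral_mul_left_eq_zero (hf.integrable_mul Lg₁)
  have orthoψ : ∀ {f : Cov m × Bool → ℝ}, MemLp (fun o : Obs m => f o.1) 2 μ →
      ∫ o, ψ o * f o.1 ∂μ = 0 := by
    intro f hf
    have hi : Integrable (fun o => ψ o * f o.1) μ := Lψ.integrable_mul hf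
    have e1 : ∀ o, ψ o * f o.1 = (f o.1 * goodInd P N o.1.1) * weightedResid P o :=
      fun o => by simp only [hψ]; ring
    simp_rw [e1] at hi ⊢
    exact integral_mul_weightedResid hP (k := fun w => f w * goodInd P N w.1) hi
  have dψ₁ : ∫ o, ψ o * g₁ o ∂μ = ∫ o, T o ^ 2 ∂μ := by
    have e1 : ∀ o, ψ o * g₁ o = T o ^ 2 - ψ o * k o.1 := by
      intro o
      have h1 : ψ o * T o = T o ^ 2 := by
        simp only [hψ, hT, truncResid]
        rw [mul_pow, ← mul_cutoff]; ring
      rw [← h1, hg₁]; ring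
    have i1 : Integrable (fun o => ψ o * k o.1) μ := Lψ.integrable_mul Lk
    simp_rw [e1]
    rw [integral_sub LT.integrable_sq i1, orthoψ Lk, sub_zero]
  have de₂ : ∫ o, e o * (S o - b) ∂μ = ∫ o, S o ^ 2 ∂μ := by
    have e1 : ∀ o, e o * (S o - b) = S o ^ 2 - e o * b := by
      intro o
      have h1 : e o * S o = S o ^ 2 := mul_cutoff N _
      rw [← h1]; ring
    simp_rw [e1]
    rw [integral_sub LS.integrable_sq ((Le.integrable one_le_two).mul_const b),
      integral_mul_const, he0, zero_mul, sub_zero]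
  have hd : ∫ o, (ψ o + e o) * (g₁ o + (S o - b)) ∂μ =
      ∫ o, T o ^ 2 ∂μ + ∫ o, S o ^ 2 ∂μ := by
    have e1 : ∀ o, (ψ o + e o) * (g₁ o + (S o - b)) =
        (ψ o * g₁ o + ψ o * (S o - b)) + (e o * g₁ o + e o * (S o - b)) := fun o => by ring
    have i1 : Integrable (fun o => ψ o * g₁ o) μ := Lψ.integrable_mul Lg₁
    have i2 : Integrable (fun o => ψ o * (S o - b)) μ := Lψ.integrable_mul Lg₂
    have i3 : Integrable (fun o => e o * g₁ o) μ := Le.integrable_mul Lg₁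
    have i4 : Integrable (fun o => e o * (S o - b)) μ := Le.integrable_mul Lg₂
    have i12 : Integrable (fun o => ψ o * g₁ o + ψ o * (S o - b)) μ := i1.add i2
    have i34 : Integrable (fun o => e o * g₁ o + e o * (S o - b)) μ := i3.add i4
    simp_rw [e1]
    rw [integral_add i12 i34, integral_add i1 i2, integral_add i3 i4, dψ₁, de₂,
      orthoψ (f := fun w => truncEffect P N w.1 - b) Lg₂,
      ortho (f := fun w => delta P w.1 - ivFunctional P) Le, add_zero, zero_add]
  have hI₁ : ∫ o, g₁ o ^ 2 ∂μ ≤ ∫ o, T o ^ 2 ∂μ := by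
    have e1 : ∀ o, T o ^ 2 = (g₁ o ^ 2 + k o.1 ^ 2) + 2 * (k o.1 * g₁ o) := fun o => by
      simp only [hg₁]; ring
    have i1 : Integrable (fun o => g₁ o ^ 2 + k o.1 ^ 2) μ :=
      Lg₁.integrable_sq.add Lk.integrable_sq
    have i2 : Integrable (fun o => 2 * (k o.1 * g₁ o)) μ := (Lk.integrable_mul Lg₁).const_mul 2
    have h1 : 0 ≤ ∫ o, k o.1 ^ 2 ∂μ := integral_nonneg fun o => sq_nonneg _
    rw [integral_congr_ae (ae_of_all _ e1), integral_add i1 i2,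
      integral_add Lg₁.integrable_sq Lk.integrable_sq, integral_const_mul, ortho Lk]
    linarith
  have hI₂ : ∫ o, (S o - b) ^ 2 ∂μ ≤ ∫ o, S o ^ 2 ∂μ := by
    have e1 : ∀ o, (S o - b) ^ 2 = S o ^ 2 - (2 * b * S o - b ^ 2) := fun o => by ring
    have i1 : Integrable (fun o => 2 * b * S o) μ := (LS.integrable one_le_two).const_mul _
    have i2 : Integrable (fun o => 2 * b * S o - b ^ 2) μ := i1.sub (integrable_const _)
    rw [integral_congr_ae (ae_of_all _ e1), integral_sub LS.integrable_sq i2,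
      integral_sub i1 (integrable_const _), integral_const_mul, hSb, integral_const,
      probReal_univ, one_smul]
    nlinarith [sq_nonneg b]
  have hI : ∫ o, (g₁ o + (S o - b)) ^ 2 ∂μ ≤ ∫ o, T o ^ 2 ∂μ + ∫ o, S o ^ 2 ∂μ := by
    have e1 : ∀ o, (g₁ o + (S o - b)) ^ 2 =
        (g₁ o ^ 2 + (S o - b) ^ 2) + 2 * ((S o - b) * g₁ o) := fun o => by ring
    have i1 : Integrable (fun o => g₁ o ^ 2 + (S o - b) ^ 2) μ :=
      Lg₁.integrable_sq.add Lg₂.integrable_sq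
    have i2 : Integrable (fun o => 2 * ((S o - b) * g₁ o)) μ :=
      (Lg₂.integrable_mul Lg₁).const_mul 2
    rw [integral_congr_ae (ae_of_all _ e1), integral_add i1 i2,
      integral_add Lg₁.integrable_sq Lg₂.integrable_sq, integral_const_mul,
      ortho (f := fun w => truncEffect P N w.1 - b) Lg₂]
    linarith
  set v := ∫ o, T o ^ 2 ∂μ + ∫ o, S o ^ 2 ∂μ with hv
  have hv_nonneg : 0 ≤ v := add_nonneg (integral_nonneg fun o => sq_nonneg (T o))
    (integral_nonneg fun o => sq_nonneg (S o))
  rcases hv_nonneg.eq_or_lt with hv0 | hv0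
  · rw [← hv0, ENNReal.ofReal_zero]; exact zero_le
  have hIpos : 0 < ∫ o, (g₁ o + (S o - b)) ^ 2 ∂μ := by
    have hcs := sq_integral_mul_le (Lψ.add Le) (Lg₁.add Lg₂)
    simp only [Pi.add_apply] at hcs
    rw [hd] at hcs
    by_contra hneg
    have h0 : ∫ o, (g₁ o + (S o - b)) ^ 2 ∂μ = 0 :=
      le_antisymm (not_lt.1 hneg) (integral_nonneg fun o => sq_nonneg _)
    rw [h0, mul_zero] at hcs
    nlinarith
  have hmem : ∀ᶠ t in 𝓝 (0 : ℝ), perturb P g₁ (fun x => truncEffect P N x - b) t ∈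
      nonparametricModel m := by
    filter_upwards [IsDirection.eventually_small (2 * N) N] with t ht
    exact hdir.perturb_mem hP hN ht.1 ht.2
  have hder := hasDerivAt_ivFunctional hP hδ hdir.isRegularPath_perturb hmem
    (hdir.locallyUniformStrength_perturb hP hN) (γ := goodInd P N) Lψ (by
      filter_upwards [IsDirection.eventually_small (2 * N) N] with t ht
      filter_upwards [hdir.mu_perturb_of_notMem hP ht.2] with x hx
      rcases goodInd_eq P N x with ⟨-, h⟩ | ⟨h, -⟩
      · exact Or.inl h
      · exact Or.inr (hx h).2)
  have hle : ENNReal.ofReal v ≤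
      ENNReal.ofReal (v ^ 2 / ∫ o, (g₁ o + (S o - b)) ^ 2 ∂μ) := by
    refine ENNReal.ofReal_le_ofReal ((le_div_iff₀ hIpos).2 ?_)
    rw [sq]
    exact mul_le_mul_of_nonneg_left hI hv0.le
  refine hle.trans (le_sSup ⟨perturb P g₁ (fun x => truncEffect P N x - b),
    fun o => g₁ o + (S o - b), v, hdir.isRegularPath_perturb, ?_,
    hdir.locallyUniformStrength_perturb hP hN, ?_, hIpos, rfl⟩)
  · filter_upwards [hmem, IsDirection.eventually_small (2 * N) N] with t h1 ht
    refine ⟨h1, ?_⟩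
    filter_upwards [hdir.propensity_perturb ht.2,
      (lawX_absolutelyContinuous (hdir.perturb_absolutelyContinuous ht.2)).ae_le hπ] with x h2 h3
    rw [← h3]
    exact h2 true
  · rw [← hd]
    exact hder

theorem eventually_mem_goodSet {P : ProbabilityMeasure (Obs m)} {x : Cov m}
    (hd : deltaA P x ≠ 0) (hp : ∀ z, 0 < propensity P z x)
    (hY : ∀ z, Integrable (fun q : Bool × ℝ => q.2) (condAY P z x)) :
    ∀ᶠ n : ℕ in atTop, x ∈ goodSet P (n + 1) := by
  have hsmall : ∀ {a : ℝ}, 0 < a → ∀ᶠ n : ℕ in atTop, 1 / ((n : ℝ) + 1) ≤ a := fun ha =>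
    tendsto_one_div_add_atTop_nhds_zero_nat.eventually_le_const ha
  have hlarge : ∀ a : ℝ, ∀ᶠ n : ℕ in atTop, a ≤ (n : ℝ) + 1 := fun a =>
    (tendsto_atTop_add_const_right _ _ tendsto_natCast_atTop_atTop).eventually_ge_atTop a
  have hz : ∀ z, ∀ᶠ n : ℕ in atTop, 1 / ((n : ℝ) + 1) ≤ propensity P z x ∧
      ∫⁻ q : Bool × ℝ, ENNReal.ofReal |q.2| ∂(condAY P z x) ≤ ENNReal.ofReal (n + 1) := by
    intro z
    filter_upwards [hsmall (hp z),
      hlarge (∫ q : Bool × ℝ, |q.2| ∂(condAY P z x))] with n h1 h2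
    refine ⟨h1, ?_⟩
    rw [← ofReal_integral_eq_lintegral_ofReal (hY z).abs (ae_of_all _ fun q => abs_nonneg _)]
    exact ENNReal.ofReal_le_ofReal h2
  filter_upwards [hsmall (abs_pos.2 hd), hlarge |delta P x|, eventually_all.2 hz] with n h1 h2 h3
  exact ⟨h1, h2, h3⟩

/-- Bounded directions come arbitrarily close to the variance bound, whether or not it is finite. -/
theorem vEff_le_efficiencyBound {P : ProbabilityMeasure (Obs m)}
    (hP : P ∈ nonparametricModel m) (hδ : MemLp (delta P) 2 (lawX P))
    {π : Cov m → ℝ} (hπ : ∀ᵐ x ∂(lawX P), propensity P true x = π x) :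
    vEff P π (ivFunctional P) ≤
      efficiencyBound (fixedPolicyModel π) (LocallyUniformStrength P) ivFunctional P := by
  set F : ℕ → Obs m → ℝ≥0∞ := fun n o => ENNReal.ofReal (truncResid P (n + 1) o ^ 2) +
    ENNReal.ofReal (truncEffect P (n + 1) o.1.1 ^ 2) with hF
  have m1 : ∀ n : ℕ, Measurable fun o => ENNReal.ofReal (truncResid P (n + 1) o ^ 2) := fun n =>
    ((measurable_truncResid P _).pow_const 2).ennreal_ofReal
  have m2 : ∀ n : ℕ, Measurable fun o : Obs m =>
      ENNReal.ofReal (truncEffect P (n + 1) o.1.1 ^ 2) := fun n =>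
    (((measurable_truncEffect P _).comp (by fun_prop)).pow_const 2).ennreal_ofReal
  have m3 : Measurable fun o : Obs m =>
      ENNReal.ofReal ((delta P o.1.1 - ivFunctional P) ^ 2) :=
    ((((measurable_delta P).comp (by fun_prop)).sub_const _).pow_const 2).ennreal_ofReal
  rw [vEff_eq_lintegral hP hπ, ← lintegral_add_right _ m3]
  have hlim : ∀ᵐ o ∂(P : Measure (Obs m)), liminf (fun n => F n o) atTop =
      ENNReal.ofReal (weightedResid P o ^ 2) +
        ENNReal.ofReal ((delta P o.1.1 - ivFunctional P) ^ 2) := by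
    have hx : ∀ᵐ x ∂(lawX P), ∀ᶠ n : ℕ in atTop, x ∈ goodSet P (n + 1) := by
      filter_upwards [hP.2.2.1, ae_all_iff.2 hP.2.1,
        ae_lawX_of_ae_fst P hP.2.1 (ae_integrable_outcome hP)] with x h1 h2 h3
      exact eventually_mem_goodSet h1 h2 h3
    filter_upwards [ae_of_ae_fst P (ae_fst_of_ae_lawX P hx)] with o ho
    have hlarge : ∀ a : ℝ, ∀ᶠ n : ℕ in atTop, a ≤ (n : ℝ) + 1 := fun a =>
      (tendsto_atTop_add_const_right _ _ tendsto_natCast_atTop_atTop).eventually_ge_atTop a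
    refine Tendsto.liminf_eq (tendsto_const_nhds.congr' ?_)
    filter_upwards [ho, hlarge |weightedResid P o|,
      hlarge |delta P o.1.1 - ivFunctional P|] with n h1 h2 h3
    simp only [hF, truncResid, truncEffect, cutoff, if_pos h2, if_pos h3, goodInd,
      Set.indicator_of_mem h1, Pi.one_apply, one_mul]
  rw [← lintegral_congr_ae hlim]
  refine (lintegral_liminf_le (f := F) fun n => (m1 n).add (m2 n)).trans
    (liminf_le_of_frequently_le' (Frequently.of_forall fun n => ?_))
  have hn : (1 : ℝ) ≤ (n : ℝ) + 1 := by linarith [n.cast_nonneg (α := ℝ)]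
  have hn0 : (0 : ℝ) ≤ (n : ℝ) + 1 := by linarith
  have LT : MemLp (truncResid P (n + 1)) 2 (P : Measure (Obs m)) :=
    memLp_two_of_bound (measurable_truncResid P _) (abs_truncResid_le P hn0)
  have LS : MemLp (fun o : Obs m => truncEffect P (n + 1) o.1.1) 2 (P : Measure (Obs m)) :=
    memLp_two_of_bound ((measurable_truncEffect P _).comp (by fun_prop))
      fun o => abs_truncEffect_le P hn0 o.1.1
  refine le_trans (le_of_eq ?_) (ofReal_integral_trunc_le_efficiencyBound hP hδ hπ hn)
  simp only [hF]
  rw [lintegral_add_right _ (m2 n), ENNReal.ofReal_add (integral_nonneg fun o => sq_nonneg _)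
    (integral_nonneg fun o => sq_nonneg _),
    ofReal_integral_eq_lintegral_ofReal LT.integrable_sq (ae_of_all _ fun o => sq_nonneg _),
    ofReal_integral_eq_lintegral_ofReal LS.integrable_sq (ae_of_all _ fun o => sq_nonneg _)]

/-- The efficiency bound is the same with a known and with an unknown policy, because the influence
function is orthogonal to the scores of the law of `Z` given `X`. -/
theorem efficiencyBound_eq_vEff {P : ProbabilityMeasure (Obs m)}
    (hP : P ∈ nonparametricModel m) (hδ : MemLp (delta P) 2 (lawX P))
    {π : Cov m → ℝ} (hπ : ∀ᵐ x ∂(lawX P), propensity P true x = π x) :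
    efficiencyBound (fixedPolicyModel π) (LocallyUniformStrength P) ivFunctional P =
        vEff P π (ivFunctional P) ∧
      efficiencyBound (nonparametricModel m) (LocallyUniformStrength P) ivFunctional P =
        vEff P π (ivFunctional P) := by
  have h1 := vEff_le_efficiencyBound hP hδ hπ
  have h2 := efficiencyBound_nonparametricModel_le hP hδ hπ
  have h3 : efficiencyBound (fixedPolicyModel π) (LocallyUniformStrength P) ivFunctional P ≤
      efficiencyBound (nonparametricModel m) (LocallyUniformStrength P) ivFunctional P :=
    efficiencyBound_mono (fun Q hQ => hQ.1) _ _ _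
  exact ⟨le_antisymm (h3.trans h2) h1, le_antisymm h2 (h1.trans h3)⟩

end ObsLaw

/-! ### Conditional independence and conditional expectations -/

section CondIndep

theorem condProb_bounds {Ω : Type*} (m' : MeasurableSpace Ω) {mΩ : MeasurableSpace Ω}
    {μ : Measure Ω} [IsProbabilityMeasure μ] (hm : m' ≤ mΩ) {s : Set Ω}
    (hs : MeasurableSet s) : ∀ᵐ ω ∂μ, 0 ≤ (μ⟦s | m'⟧) ω ∧ (μ⟦s | m'⟧) ω ≤ 1 := by
  have i1 : Integrable (s.indicator fun _ => (1 : ℝ)) μ := (integrable_const 1).indicator hs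
  have h0 : 0 ≤ᵐ[μ] μ⟦s | m'⟧ :=
    condExp_nonneg (ae_of_all _ fun ω => Set.indicator_nonneg (fun _ _ => zero_le_one) ω)
  have h1 : μ⟦s | m'⟧ ≤ᵐ[μ] μ[fun _ => (1 : ℝ) | m'] :=
    condExp_mono i1 (integrable_const 1) (ae_of_all _ fun ω =>
      Set.indicator_le_self' (fun _ _ => zero_le_one) ω)
  rw [condExp_const hm] at h1
  filter_upwards [h0, h1] with ω a b using ⟨a, b⟩

variable {Ω α β γ : Type*} [mΩ : MeasurableSpace Ω] [StandardBorelSpace Ω] [mα : MeasurableSpace α]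
  [MeasurableSpace β] [MeasurableSpace γ] {μ : Measure Ω} [IsProbabilityMeasure μ]
  {X : Ω → α} {f : Ω → β} {g : Ω → γ}

/-- If `f` and `g` are conditionally independent given `X`, then on the event `g ∈ S` the pair
`(X, f)` has density `ℙ(g ∈ S | X)` with respect to its law. -/
theorem map_restrict_eq_map_withDensity (hX : Measurable X) (hf : Measurable f)
    (hg : Measurable g)
    (h : CondIndepFun (MeasurableSpace.comap X mα) hX.comap_le f g μ) {S : Set γ}
    (hS : MeasurableSet S) :
    (μ.restrict (g ⁻¹' S)).map (fun ω => (X ω, f ω)) =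
      (μ.withDensity fun ω => ENNReal.ofReal
        ((μ⟦g ⁻¹' S | MeasurableSpace.comap X mα⟧) ω)).map fun ω => (X ω, f ω) := by
  have hm : MeasurableSpace.comap X mα ≤ mΩ := hX.comap_le
  set q : Ω → ℝ := μ⟦g ⁻¹' S | MeasurableSpace.comap X mα⟧ with hq
  have hqb := condProb_bounds (μ := μ) _ hm (hg hS)
  have hqi : Integrable q μ := integrable_condExp
  have hXf : Measurable fun ω => (X ω, f ω) := hX.prodMk hf
  have hqfin : IsFiniteMeasure (μ.withDensity fun ω => ENNReal.ofReal (q ω)) :=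
    isFiniteMeasure_withDensity_ofReal hqi.2
  refine Measure.ext_prod fun {s t} hs ht => ?_
  have hsm : MeasurableSet[MeasurableSpace.comap X mα] (X ⁻¹' s) := ⟨s, hs, rfl⟩
  have hst : MeasurableSet (X ⁻¹' s ∩ f ⁻¹' t) := (hX hs).inter (hf ht)
  have it : Integrable ((f ⁻¹' t).indicator fun _ => (1 : ℝ)) μ :=
    (integrable_const 1).indicator (hf ht)
  have itS : Integrable ((f ⁻¹' t ∩ g ⁻¹' S).indicator fun _ => (1 : ℝ)) μ :=
    (integrable_const 1).indicator ((hf ht).inter (hg hS))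
  have hbound : ∀ᵐ ω ∂μ, ‖q ω‖ ≤ 1 := by
    filter_upwards [hqb] with ω hω
    rw [Real.norm_eq_abs, abs_of_nonneg hω.1]; exact hω.2
  have hpull := condExp_stronglyMeasurable_mul_of_bound hm
    (stronglyMeasurable_condExp (f := (g ⁻¹' S).indicator fun _ => (1 : ℝ))
      (m := MeasurableSpace.comap X mα) (μ := μ))
    it 1 hbound
  have hind := (condIndepFun_iff_condExp_inter_preimage_eq_mul hf hg).1 h t S ht hS
  have hreal : ∫ ω in X ⁻¹' s ∩ f ⁻¹' t, q ω ∂μ = μ.real (X ⁻¹' s ∩ (f ⁻¹' t ∩ g ⁻¹' S)) := by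
    calc ∫ ω in X ⁻¹' s ∩ f ⁻¹' t, q ω ∂μ
        = ∫ ω in X ⁻¹' s, (q * (f ⁻¹' t).indicator fun _ => (1 : ℝ)) ω ∂μ := by
          rw [← setIntegral_indicator (hf ht)]
          refine integral_congr_ae (ae_of_all _ fun ω => ?_)
          by_cases hω : ω ∈ f ⁻¹' t <;> simp [hω]
      _ = ∫ ω in X ⁻¹' s,
            (μ[q * (f ⁻¹' t).indicator fun _ => (1 : ℝ) | MeasurableSpace.comap X mα]) ω ∂μ := by
          rw [setIntegral_condExp hm _ hsm]
          exact it.bdd_mul hqi.1 hbound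
      _ = ∫ ω in X ⁻¹' s, (μ⟦f ⁻¹' t ∩ g ⁻¹' S | MeasurableSpace.comap X mα⟧) ω ∂μ := by
          refine integral_congr_ae (ae_restrict_of_ae ?_)
          filter_upwards [hpull, hind] with ω h1 h2
          rw [h1, h2, Pi.mul_apply, mul_comm]
      _ = μ.real (X ⁻¹' s ∩ (f ⁻¹' t ∩ g ⁻¹' S)) := by
          rw [setIntegral_condExp hm itS hsm, setIntegral_indicator ((hf ht).inter (hg hS))]
          simp
  rw [Measure.map_apply hXf (hs.prod ht), Measure.map_apply hXf (hs.prod ht),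
    Set.mk_preimage_prod, Measure.restrict_apply hst, withDensity_apply _ hst,
    ← ofReal_integral_eq_lintegral_ofReal hqi.integrableOn
      (ae_restrict_of_ae (hqb.mono fun ω hω => hω.1)), hreal, ofReal_measureReal, Set.inter_assoc]

theorem setIntegral_eq_integral_condProb_mul (hX : Measurable X) (hf : Measurable f)
    (hg : Measurable g)
    (h : CondIndepFun (MeasurableSpace.comap X mα) hX.comap_le f g μ) {S : Set γ}
    (hS : MeasurableSet S) {φ : α × β → ℝ} (hφ : Measurable φ) :
    ∫ ω in g ⁻¹' S, φ (X ω, f ω) ∂μ =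
      ∫ ω, (μ⟦g ⁻¹' S | MeasurableSpace.comap X mα⟧) ω * φ (X ω, f ω) ∂μ := by
  have hXf : Measurable fun ω => (X ω, f ω) := hX.prodMk hf
  have hqm : Measurable fun ω => ENNReal.ofReal
      ((μ⟦g ⁻¹' S | MeasurableSpace.comap X mα⟧) ω) :=
    (stronglyMeasurable_condExp.measurable.mono hX.comap_le le_rfl).ennreal_ofReal
  have h1 := congrArg (fun ν => ∫ w, φ w ∂ν) (map_restrict_eq_map_withDensity hX hf hg h hS)
  beta_reduce at h1
  rw [integral_map hXf.aemeasurable hφ.aestronglyMeasurable,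
    integral_map hXf.aemeasurable hφ.aestronglyMeasurable,
    integral_withDensity_eq_integral_toReal_smul hqm
      (ae_of_all _ fun ω => ENNReal.ofReal_lt_top)] at h1
  rw [h1]
  refine integral_congr_ae ?_
  filter_upwards [condProb_bounds (μ := μ) _ hX.comap_le (hg hS)] with ω hω
  rw [ENNReal.toReal_ofReal hω.1, smul_eq_mul]

/-- Under conditional independence of `f` and `g` given `X`, the conditional expectation of
`φ(X, f) 𝟙{g ∈ S}` factors. -/
theorem condExp_indicator_eq_mul (hX : Measurable X) (hf : Measurable f) (hg : Measurable g)
    (h : CondIndepFun (MeasurableSpace.comap X mα) hX.comap_le f g μ) {S : Set γ}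
    (hS : MeasurableSet S) {φ : α × β → ℝ} (hφ : Measurable φ)
    (hi : Integrable (fun ω => φ (X ω, f ω)) μ) :
    μ[(g ⁻¹' S).indicator (fun ω => φ (X ω, f ω)) | MeasurableSpace.comap X mα] =ᵐ[μ]
      fun ω => (μ⟦g ⁻¹' S | MeasurableSpace.comap X mα⟧) ω *
        (μ[fun ω => φ (X ω, f ω) | MeasurableSpace.comap X mα]) ω := by
  have hm : MeasurableSpace.comap X mα ≤ mΩ := hX.comap_le
  set q : Ω → ℝ := μ⟦g ⁻¹' S | MeasurableSpace.comap X mα⟧ with hq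
  have hbound : ∀ᵐ ω ∂μ, ‖q ω‖ ≤ 1 := by
    filter_upwards [condProb_bounds (μ := μ) _ hm (hg hS)] with ω hω
    rw [Real.norm_eq_abs, abs_of_nonneg hω.1]; exact hω.2
  have hqi : Integrable q μ := integrable_condExp
  have hpull := condExp_stronglyMeasurable_mul_of_bound hm
    (stronglyMeasurable_condExp (f := (g ⁻¹' S).indicator fun _ => (1 : ℝ))
      (m := MeasurableSpace.comap X mα) (μ := μ))
    hi 1 hbound
  have hqφ : Integrable (q * fun ω => φ (X ω, f ω)) μ := hi.bdd_mul hqi.1 hbound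
  refine EventuallyEq.trans ?_ hpull
  symm
  refine ae_eq_condExp_of_forall_setIntegral_eq hm (hi.indicator (hg hS))
    (fun s _ _ => integrable_condExp.integrableOn) ?_
    stronglyMeasurable_condExp.aestronglyMeasurable
  rintro _ ⟨s, hs, rfl⟩ -
  rw [setIntegral_condExp hm hqφ ⟨s, hs, rfl⟩, setIntegral_indicator (hg hS),
    ← integral_indicator (hX hs), Set.inter_comm,
    ← setIntegral_indicator (hX hs)]
  have hφs : Measurable fun w : α × β => (Prod.fst ⁻¹' s).indicator φ w :=
    hφ.indicator (measurable_fst hs)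
  have key := setIntegral_eq_integral_condProb_mul hX hf hg h hS hφs
  have e1 : ∀ ω, (Prod.fst ⁻¹' s).indicator φ (X ω, f ω) =
      (X ⁻¹' s).indicator (fun ω => φ (X ω, f ω)) ω := by
    intro ω
    by_cases hω : X ω ∈ s <;> simp [hω]
  simp_rw [e1] at key
  rw [key]
  refine integral_congr_ae (ae_of_all _ fun ω => ?_)
  by_cases hω : X ω ∈ s <;> simp [hω, hq]

end CondIndep

/-! ### Identification of the average treatment effect -/

namespace IVExperiment

open ObsLaw

variable {m : ℕ} {Ω 𝒰 : Type*} [mΩ : MeasurableSpace Ω]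
  [MeasurableSpace 𝒰] {μ : Measure Ω} (E : IVExperiment m Ω 𝒰)

theorem memLp_po_comp {E : IVExperiment m Ω 𝒰} (hL2 : ∀ a, MemLp (E.po a) 2 μ)
    {a : Ω → Bool} (ha : Measurable a) :
    MemLp (fun ω => E.po (a ω) ω) 2 μ := by
  have hm : Measurable fun ω => E.po (a ω) ω := by
    have h : Measurable fun p : Bool × Ω => E.po p.1 p.2 :=
      measurable_from_prod_countable_right fun b => E.measurable_po b
    exact h.comp (ha.prodMk measurable_id)
  refine ((hL2 true).abs.add (hL2 false).abs).mono hm.aestronglyMeasurable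
    (ae_of_all _ fun ω => ?_)
  change |E.po (a ω) ω| ≤ |(|E.po true ω| + |E.po false ω|)|
  rw [abs_of_nonneg (by positivity : 0 ≤ |E.po true ω| + |E.po false ω|)]
  cases a ω
  · linarith [abs_nonneg (E.po true ω)]
  · linarith [abs_nonneg (E.po false ω)]

variable [IsProbabilityMeasure μ]

theorem lawX_obsLaw : lawX (E.obsLaw μ) = μ.map E.X := by
  change ((μ.map E.obs).map Prod.fst).map Prod.fst = _
  rw [Measure.map_map measurable_fst E.measurable_obs,
    Measure.map_map measurable_fst (measurable_fst.comp E.measurable_obs)]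
  rfl

theorem ae_lawX_of_ae {p : Cov m → Prop} (hp : MeasurableSet {x | p x})
    (h : ∀ᵐ ω ∂μ, p (E.X ω)) : ∀ᵐ x ∂(lawX (E.obsLaw μ)), p x := by
  rw [lawX_obsLaw]
  exact (ae_map_iff E.measurable_X.aemeasurable hp).2 h

theorem integral_lawX {k : Cov m → ℝ} (hk : Measurable k) :
    ∫ x, k x ∂(lawX (E.obsLaw μ)) = ∫ ω, k (E.X ω) ∂μ := by
  rw [lawX_obsLaw, integral_map E.measurable_X.aemeasurable hk.aestronglyMeasurable]

theorem integral_obsLaw {F : Obs m → ℝ} (hF : Measurable F) :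
    ∫ o, F o ∂(E.obsLaw μ : Measure (Obs m)) = ∫ ω, F (E.obs ω) ∂μ :=
  integral_map E.measurable_obs.aemeasurable hF.aestronglyMeasurable

theorem integrable_obsLaw_iff {F : Obs m → ℝ} (hF : Measurable F) :
    Integrable F (E.obsLaw μ : Measure (Obs m)) ↔ Integrable (fun ω => F (E.obs ω)) μ :=
  integrable_map_measure hF.aestronglyMeasurable E.measurable_obs.aemeasurable

/-- The conditional expectation of a function of `(A, Y)` on an arm, in terms of the disintegration
of the law of the observation. -/
theorem condExp_indicator_obs (z : Bool) {F : Bool × ℝ → ℝ} (hF : Measurable F)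
    (hi : Integrable (fun ω => F (E.A ω, E.Y ω)) μ) :
    μ[(E.Z ⁻¹' {z}).indicator (fun ω => F (E.A ω, E.Y ω)) | E.sigmaX] =ᵐ[μ] fun ω =>
      propensity (E.obsLaw μ) z (E.X ω) *
        ∫ q, F q ∂(condAY (E.obsLaw μ) z (E.X ω)) := by
  set P := E.obsLaw μ with hP
  have hZ : MeasurableSet (E.Z ⁻¹' {z}) := E.measurable_Z (measurableSet_singleton z)
  set k : Cov m × Bool → ℝ := fun w => ∫ q, F q ∂(condAY P w.2 w.1) with hk
  have hkm : Measurable k := measurable_integral_condAY P (f := fun o => F o.2)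
    (hF.comp measurable_snd)
  have hkzm : Measurable fun x => propensity P z x * k (x, z) :=
    (measurable_propensity P z).mul (hkm.comp (measurable_prodMk_right (y := z)))
  have hFi : Integrable (fun o : Obs m => F o.2) (P : Measure (Obs m)) :=
    (E.integrable_obsLaw_iff (hF.comp measurable_snd)).2 hi
  -- For a measurable set `s` of covariate values, the two sides integrate alike over `X ∈ s`.
  have main : ∀ s : Set (Cov m), MeasurableSet s →
      Integrable (s.indicator fun x => propensity P z x * k (x, z)) (lawX P) ∧
      ∫ x, s.indicator (fun x => propensity P z x * k (x, z)) x ∂(lawX P) =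
        ∫ ω, (E.X ⁻¹' s ∩ E.Z ⁻¹' {z}).indicator (fun ω => F (E.A ω, E.Y ω)) ω ∂μ := by
    intro s hs
    have hsz : MeasurableSet (s ×ˢ ({z} : Set Bool)) := hs.prod (measurableSet_singleton z)
    have hsz' : MeasurableSet (Prod.fst ⁻¹' (s ×ˢ ({z} : Set Bool)) : Set (Obs m)) :=
      measurable_fst hsz
    set G : Obs m → ℝ := (Prod.fst ⁻¹' (s ×ˢ ({z} : Set Bool))).indicator fun o => F o.2 with hG
    have hGm : Measurable G := (hF.comp measurable_snd).indicator hsz'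
    have hGi : Integrable G (P : Measure (Obs m)) := hFi.indicator hsz'
    have einner : ∀ w : Cov m × Bool, ∫ q, G (w, q) ∂(condAY P w.2 w.1) =
        (s ×ˢ ({z} : Set Bool)).indicator k w := by
      intro w
      by_cases hw : w ∈ s ×ˢ ({z} : Set Bool)
      · have : ∀ q, G (w, q) = F q := fun q => Set.indicator_of_mem (by exact hw) _
        simp_rw [this]
        rw [Set.indicator_of_mem hw]
      · have : ∀ q, G (w, q) = 0 := fun q => Set.indicator_of_notMem (by exact hw) _
        simp_rw [this]
        rw [Set.indicator_of_notMem hw, integral_zero]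
    have hki : Integrable ((s ×ˢ ({z} : Set Bool)).indicator k) (P : Measure (Obs m)).fst := by
      have := integrable_integral_condAY P hGi
      simp_rw [einner] at this
      exact this
    have esum : ∀ x : Cov m, ∑ z', propensity P z' x * (s ×ˢ ({z} : Set Bool)).indicator k (x, z') =
        s.indicator (fun x => propensity P z x * k (x, z)) x := by
      intro x
      rw [Finset.sum_eq_single z]
      · by_cases hx : x ∈ s <;> simp [hx]
      · intro z' _ hz'
        rw [Set.indicator_of_notMem (by simp [hz']), mul_zero]
      · simp
    constructor
    · have h1 : Integrable (fun x => ∫ z', (s ×ˢ ({z} : Set Bool)).indicator k (x, z')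
          ∂((P : Measure (Obs m)).fst.condKernel x)) (lawX P) :=
        hki.integral_norm_condKernel.mono' hki.1.integral_condKernel
          (ae_of_all _ fun x => norm_integral_le_integral_norm _)
      refine h1.congr (ae_of_all _ fun x => ?_)
      beta_reduce
      rw [← esum x, integral_fintype Integrable.of_finite]
      rfl
    · have h1 : ∫ o, G o ∂(P : Measure (Obs m)) =
          ∫ x, s.indicator (fun x => propensity P z x * k (x, z)) x ∂(lawX P) := by
        rw [integral_eq_integral_condAY P hGi]
        simp_rw [einner]
        rw [integral_fst P hki]
        simp_rw [esum]
      rw [← h1, hP, E.integral_obsLaw hGm]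
      rfl
  symm
  refine ae_eq_condExp_of_forall_setIntegral_eq E.sigmaX_le (hi.indicator hZ) ?_ ?_ ?_
  · intro s _ _
    have h1 := (main Set.univ MeasurableSet.univ).1
    rw [Set.indicator_univ, lawX_obsLaw,
      integrable_map_measure hkzm.aestronglyMeasurable E.measurable_X.aemeasurable] at h1
    exact Integrable.integrableOn h1
  · rintro _ ⟨s, hs, rfl⟩ -
    rw [setIntegral_indicator hZ, ← integral_indicator (E.measurable_X hs),
      ← integral_indicator ((E.measurable_X hs).inter hZ), ← (main s hs).2,
      E.integral_lawX (hkzm.indicator hs)]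
    rfl
  · exact (hkzm.comp (comap_measurable E.X)).stronglyMeasurable.aestronglyMeasurable

theorem condProb_Z (z : Bool) : μ⟦E.Z ⁻¹' {z} | E.sigmaX⟧ =ᵐ[μ] fun ω =>
    propensity (E.obsLaw μ) z (E.X ω) := by
  have h := E.condExp_indicator_obs (μ := μ) z (F := fun _ => 1) measurable_const
    (integrable_const 1)
  filter_upwards [h] with ω hω
  rw [hω]
  simp

/-- The treatment taken on the arm `z`, as a number. -/
noncomputable def treatNum (z : Bool) (ω : Ω) : ℝ := bit (E.treat z ω)

/-- The outcome on the arm `z`. -/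
def armOutcome (z : Bool) (ω : Ω) : ℝ := E.outcome (E.treat z ω) z ω

theorem measurable_treatNum (z : Bool) : Measurable (E.treatNum z) :=
  measurable_bit.comp (E.measurable_treat z)

theorem integrable_treatNum (z : Bool) : Integrable (E.treatNum z) μ :=
  integrable_bit_comp μ (E.measurable_treat z)

theorem exists_treatNum_eq (z : Bool) : ∃ v : Cov m × 𝒰 → ℝ, Measurable v ∧
    E.treatNum z = fun ω => v (E.X ω, E.U ω) := by
  obtain ⟨g, hg, h⟩ := E.treat_eq z
  refine ⟨fun w => bit (g w), measurable_bit.comp hg, ?_⟩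
  ext ω
  rw [treatNum, h]

theorem exists_armOutcome_eq (z : Bool) : ∃ v : Cov m × 𝒰 → ℝ, Measurable v ∧
    E.armOutcome z = fun ω => v (E.X ω, E.U ω) := by
  obtain ⟨g, hg, h⟩ := E.treat_eq z
  choose r hr hr' using fun a => E.outcome_eq a z
  refine ⟨fun w => r (g w) w, ?_, ?_⟩
  · have h1 : Measurable fun p : Bool × (Cov m × 𝒰) => r p.1 p.2 :=
      measurable_from_prod_countable_right fun a => hr a
    exact h1.comp (hg.prodMk measurable_id)
  · ext ω
    rw [armOutcome, hr', h]

theorem propensity_obsLaw {E : IVExperiment m Ω 𝒰} {π : Cov m → ℝ} (hπ : Measurable π)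
    (hpol : E.FollowsPolicy μ π) :
    ∀ᵐ x ∂(lawX (E.obsLaw μ)), propensity (E.obsLaw μ) true x = π x := by
  refine E.ae_lawX_of_ae (measurableSet_eq_fun (measurable_propensity _ true) hπ) ?_
  have eZ : (fun ω => bit (E.Z ω)) = (E.Z ⁻¹' {true}).indicator fun _ => (1 : ℝ) := by
    ext ω
    cases h : E.Z ω <;> simp [bit, h]
  have h := E.condProb_Z (μ := μ) true
  rw [← eZ] at h
  exact h.symm.trans hpol

variable [StandardBorelSpace Ω]

/-- On the arm `Z = z`, conditional means given `(Z, X)` are conditional means given `X` of the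
corresponding potential variable `V`, by the conditional independence of `Z` and `U`. -/
theorem propensity_mul_integral_condAY {E : IVExperiment m Ω 𝒰}
    (hind : CondIndepFun E.sigmaX E.sigmaX_le E.Z E.U μ) (z : Bool) {F : Bool × ℝ → ℝ}
    (hF : Measurable F) (hi : Integrable (fun ω => F (E.A ω, E.Y ω)) μ) {V : Ω → ℝ}
    {v : Cov m × 𝒰 → ℝ} (hv : Measurable v) (hVv : V = fun ω => v (E.X ω, E.U ω))
    (hVi : Integrable V μ) (hVF : ∀ ω, E.Z ω = z → V ω = F (E.A ω, E.Y ω)) :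
    ∀ᵐ ω ∂μ, (μ[(E.Z ⁻¹' {z}).indicator V | E.sigmaX]) ω =
        propensity (E.obsLaw μ) z (E.X ω) * (μ[V | E.sigmaX]) ω ∧
      propensity (E.obsLaw μ) z (E.X ω) * (μ[V | E.sigmaX]) ω =
        propensity (E.obsLaw μ) z (E.X ω) * ∫ q, F q ∂(condAY (E.obsLaw μ) z (E.X ω)) := by
  subst hVv
  have h1 := condExp_indicator_eq_mul E.measurable_X E.measurable_U E.measurable_Z hind.symm
    (measurableSet_singleton z) hv hVi
  have h2 := E.condExp_indicator_obs z hF hi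
  have e : (E.Z ⁻¹' {z}).indicator (fun ω => v (E.X ω, E.U ω)) =
      (E.Z ⁻¹' {z}).indicator (fun ω => F (E.A ω, E.Y ω)) :=
    Set.indicator_congr fun ω hω => hVF ω hω
  rw [← e] at h2
  filter_upwards [h1, h2, E.condProb_Z z] with ω a1 a2 a3
  rw [a3] at a1
  exact ⟨a1, a1.symm.trans a2⟩

variable {E}

theorem armOutcome_ae_eq (hIV : E.StandardIV μ) (z : Bool) :
    E.armOutcome z =ᵐ[μ] fun ω => E.po (E.treat z ω) ω := by
  filter_upwards [hIV.exclusion true z, hIV.exclusion false z] with ω h1 h0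
  rw [armOutcome]
  cases E.treat z ω
  · exact h0
  · exact h1

theorem Y_ae_eq (hIV : E.StandardIV μ) : E.Y =ᵐ[μ] fun ω => E.po (E.A ω) ω := by
  have h : ∀ᵐ ω ∂μ, ∀ a z, E.outcome a z ω = E.po a ω :=
    ae_all_iff.2 fun a => ae_all_iff.2 fun z => hIV.exclusion a z
  filter_upwards [h] with ω hω
  exact hω _ _

theorem integrable_armOutcome (hL2 : ∀ a, MemLp (E.po a) 2 μ) (hIV : E.StandardIV μ) (z : Bool) :
    Integrable (E.armOutcome z) μ :=
  ((memLp_po_comp hL2 (E.measurable_treat z)).integrable one_le_two).congr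
    (armOutcome_ae_eq hIV z).symm

theorem memLp_Y (hL2 : ∀ a, MemLp (E.po a) 2 μ) (hIV : E.StandardIV μ) : MemLp E.Y 2 μ :=
  (memLp_po_comp hL2 E.measurable_A).ae_eq (Y_ae_eq hIV).symm

theorem condExp_A_indicator (hIV : E.StandardIV μ) (z : Bool) :
    ∀ᵐ ω ∂μ, (μ[(E.Z ⁻¹' {z}).indicator (E.treatNum z) | E.sigmaX]) ω =
        propensity (E.obsLaw μ) z (E.X ω) * (μ[E.treatNum z | E.sigmaX]) ω ∧
      propensity (E.obsLaw μ) z (E.X ω) * (μ[E.treatNum z | E.sigmaX]) ω =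
        propensity (E.obsLaw μ) z (E.X ω) * muA (E.obsLaw μ) z (E.X ω) := by
  obtain ⟨v, hv, hv'⟩ := E.exists_treatNum_eq z
  refine propensity_mul_integral_condAY hIV.independence z (F := fun q => bit q.1)
    (measurable_bit.comp measurable_fst) (integrable_bit_comp μ E.measurable_A) hv hv'
    (E.integrable_treatNum z) ?_
  rintro ω rfl
  rfl

theorem condExp_Y_indicator (hL2 : ∀ a, MemLp (E.po a) 2 μ) (hIV : E.StandardIV μ) (z : Bool) :
    ∀ᵐ ω ∂μ, propensity (E.obsLaw μ) z (E.X ω) * (μ[E.armOutcome z | E.sigmaX]) ω =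
        propensity (E.obsLaw μ) z (E.X ω) * muY (E.obsLaw μ) z (E.X ω) := by
  obtain ⟨v, hv, hv'⟩ := E.exists_armOutcome_eq z
  refine (propensity_mul_integral_condAY hIV.independence z (F := fun q => q.2)
    measurable_snd ((memLp_Y hL2 hIV).integrable one_le_two) hv hv'
    (integrable_armOutcome hL2 hIV z) ?_).mono fun ω hω => hω.2
  rintro ω rfl
  rfl

/-- The conditional covariance of instrument and treatment factors into the propensities and the
compliance score, so that relevance entails overlap. -/
theorem condCovZA_ae_eq (hIV : E.StandardIV μ) :
    E.condCovZA μ =ᵐ[μ] fun ω => propensity (E.obsLaw μ) true (E.X ω) *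
      propensity (E.obsLaw μ) false (E.X ω) *
        ((μ[E.treatNum true | E.sigmaX]) ω - (μ[E.treatNum false | E.sigmaX]) ω) := by
  set bZ : Ω → ℝ := fun ω => bit (E.Z ω) with hbZ
  set bA : Ω → ℝ := fun ω => bit (E.A ω) with hbA
  have iZ : Integrable bZ μ := integrable_bit_comp μ E.measurable_Z
  have iA : Integrable bA μ := integrable_bit_comp μ E.measurable_A
  set ζ : Ω → ℝ := μ[bZ | E.sigmaX] with hζ
  set ξ : Ω → ℝ := μ[bA | E.sigmaX] with hξ
  have bd : ∀ {c : Ω → Bool}, Measurable c →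
      ∀ᵐ ω ∂μ, ‖(μ[fun ω => bit (c ω) | E.sigmaX]) ω‖ ≤ 1 := by
    intro c hc
    exact ae_bdd_abs_condExp_of_ae_bdd_abs (R := 1) (ae_of_all _ fun ω => abs_bit_le_one (c ω))
  have iZA : Integrable (fun ω => bZ ω * bA ω) μ :=
    iA.bdd_mul iZ.1 (ae_of_all _ fun ω => abs_bit_le_one (E.Z ω))
  have iζ : Integrable ζ μ := integrable_condExp
  have iξ : Integrable ξ μ := integrable_condExp
  have iξZ : Integrable (fun ω => ξ ω * bZ ω) μ := iZ.bdd_mul iξ.1 (bd E.measurable_A)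
  have iζr : Integrable (fun ω => ζ ω * (bA ω - ξ ω)) μ :=
    (iA.sub iξ).bdd_mul iζ.1 (bd E.measurable_Z)
  have p1 : μ[fun ω => ξ ω * bZ ω | E.sigmaX] =ᵐ[μ] fun ω => ξ ω * ζ ω :=
    condExp_mul_of_stronglyMeasurable_left stronglyMeasurable_condExp iξZ iZ
  have p2 : μ[fun ω => ζ ω * (bA ω - ξ ω) | E.sigmaX] =ᵐ[μ]
      fun ω => ζ ω * (μ[fun ω => bA ω - ξ ω | E.sigmaX]) ω :=
    condExp_mul_of_stronglyMeasurable_left stronglyMeasurable_condExp iζr (iA.sub iξ)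
  have p3 : μ[fun ω => bA ω - ξ ω | E.sigmaX] =ᵐ[μ] fun ω => 0 := by
    have h1 := condExp_sub iA iξ E.sigmaX
    have h2 : μ[ξ | E.sigmaX] = ξ :=
      condExp_of_stronglyMeasurable E.sigmaX_le stronglyMeasurable_condExp iξ
    filter_upwards [h1] with ω hω
    refine hω.trans ?_
    rw [Pi.sub_apply, h2, sub_self]
  have hsplit : (fun ω => (bZ ω - ζ ω) * (bA ω - ξ ω)) =
      ((fun ω => bZ ω * bA ω) - fun ω => ξ ω * bZ ω) - fun ω => ζ ω * (bA ω - ξ ω) := by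
    ext ω; simp only [Pi.sub_apply]; ring
  have q1 := condExp_sub (iZA.sub iξZ) iζr E.sigmaX
  have q2 := condExp_sub iZA iξZ E.sigmaX
  -- The products with the instrument are indicators of the arms.
  have eZA : (fun ω => bZ ω * bA ω) = (E.Z ⁻¹' {true}).indicator (E.treatNum true) := by
    ext ω
    by_cases h : E.Z ω = true
    · rw [Set.indicator_of_mem (by exact h)]
      simp [hbZ, hbA, treatNum, A, h, bit]
    · rw [Set.indicator_of_notMem (by exact h)]
      simp [hbZ, bit, h]
  have eA : bA = (E.Z ⁻¹' {true}).indicator (E.treatNum true) +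
      (E.Z ⁻¹' {false}).indicator (E.treatNum false) := by
    ext ω
    cases h : E.Z ω <;> simp [hbA, treatNum, A, h]
  have eZ : bZ = (E.Z ⁻¹' {true}).indicator fun _ => (1 : ℝ) := by
    ext ω
    cases h : E.Z ω <;> simp [hbZ, bit, h]
  have q3 := condExp_add (μ := μ) ((E.integrable_treatNum (μ := μ) true).indicator
    (E.measurable_Z (measurableSet_singleton true)))
    ((E.integrable_treatNum (μ := μ) false).indicator
    (E.measurable_Z (measurableSet_singleton false))) E.sigmaX
  rw [← eA] at q3
  have hcov : E.condCovZA μ = μ[fun ω => (bZ ω - ζ ω) * (bA ω - ξ ω) | E.sigmaX] := rfl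
  rw [hcov, hsplit]
  have hZ1 := E.condProb_Z (μ := μ) true
  rw [← eZ] at hZ1
  filter_upwards [q1, q2, q3, p1, p2, p3, condExp_A_indicator hIV true,
    condExp_A_indicator hIV false, hZ1] with ω a1 a2 a3 a4 a5 a6 a7 a8 a9
  rw [a1, Pi.sub_apply, a2, Pi.sub_apply, a4, a5, a6, mul_zero, sub_zero, eZA, a7.1, hξ, a3,
    Pi.add_apply, a7.1, a8.1]
  have hζω : ζ ω = propensity (E.obsLaw μ) true (E.X ω) := a9
  have hsum := propensity_true_add_false (E.obsLaw μ) (E.X ω)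
  rw [hζω, show propensity (E.obsLaw μ) false (E.X ω) =
    1 - propensity (E.obsLaw μ) true (E.X ω) by linarith]
  ring

theorem propensity_pos (hIV : E.StandardIV μ) :
    ∀ᵐ ω ∂μ, (∀ z, 0 < propensity (E.obsLaw μ) z (E.X ω)) ∧
      (μ[E.treatNum true | E.sigmaX]) ω - (μ[E.treatNum false | E.sigmaX]) ω ≠ 0 := by
  filter_upwards [hIV.relevance, condCovZA_ae_eq hIV] with ω h1 h2
  rw [h2] at h1
  have h3 := mul_ne_zero_iff.1 h1
  have h4 := mul_ne_zero_iff.1 h3.1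
  refine ⟨fun z => lt_of_le_of_ne (propensity_nonneg _ _ _) ?_, h3.2⟩
  cases z
  · exact h4.2.symm
  · exact h4.1.symm

theorem deltaA_obsLaw (hIV : E.StandardIV μ) : ∀ᵐ ω ∂μ,
    deltaA (E.obsLaw μ) (E.X ω) =
      (μ[E.treatNum true | E.sigmaX]) ω - (μ[E.treatNum false | E.sigmaX]) ω := by
  filter_upwards [propensity_pos hIV, condExp_A_indicator hIV true,
    condExp_A_indicator hIV false] with ω h h1 h0
  rw [deltaA, mul_left_cancel₀ (h.1 true).ne' h1.2, mul_left_cancel₀ (h.1 false).ne' h0.2]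

theorem deltaY_obsLaw (hL2 : ∀ a, MemLp (E.po a) 2 μ) (hIV : E.StandardIV μ) : ∀ᵐ ω ∂μ,
    deltaY (E.obsLaw μ) (E.X ω) =
      (μ[E.armOutcome true | E.sigmaX]) ω - (μ[E.armOutcome false | E.sigmaX]) ω := by
  filter_upwards [propensity_pos hIV, condExp_Y_indicator hL2 hIV true,
    condExp_Y_indicator hL2 hIV false] with ω h h1 h0
  rw [deltaY, mul_left_cancel₀ (h.1 true).ne' h1, mul_left_cancel₀ (h.1 false).ne' h0]

/-- Unconfounded compliance makes the conditional mean of the product of effect and compliance the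
product of the conditional means. -/
theorem condExp_effect_mul_compliance (hL2 : ∀ a, MemLp (E.po a) 2 μ)
    (hUC : E.UnconfoundedCompliance μ) :
    ∀ᵐ ω ∂μ, (μ[fun ω => (E.po true ω - E.po false ω) *
        (E.treatNum true ω - E.treatNum false ω) | E.sigmaX]) ω =
      (μ[fun ω => E.po true ω - E.po false ω | E.sigmaX]) ω *
        ((μ[E.treatNum true | E.sigmaX]) ω - (μ[E.treatNum false | E.sigmaX]) ω) := by
  set D : Ω → ℝ := fun ω => E.po true ω - E.po false ω with hD
  set W : Ω → ℝ := fun ω => bit (E.treat true ω) - bit (E.treat false ω) with hW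
  have mD : Measurable D := (E.measurable_po true).sub (E.measurable_po false)
  have mW : Measurable W := (E.measurable_treatNum true).sub (E.measurable_treatNum false)
  have iD : Integrable D μ := ((hL2 true).sub (hL2 false)).integrable one_le_two
  have fac : ∀ c : ℝ, μ[(W ⁻¹' {c}).indicator D | E.sigmaX] =ᵐ[μ] fun ω =>
      (μ⟦W ⁻¹' {c} | E.sigmaX⟧) ω * (μ[D | E.sigmaX]) ω := fun c =>
    condExp_indicator_eq_mul E.measurable_X mD mW hUC (measurableSet_singleton c)
      (φ := fun w => w.2) measurable_snd iD
  have hWm : ∀ c : ℝ, MeasurableSet (W ⁻¹' {c}) := fun c => mW (measurableSet_singleton c)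
  -- Compliance takes the values `1`, `0` and `-1`.
  have e1 : (fun ω => D ω * (E.treatNum true ω - E.treatNum false ω)) =
      (W ⁻¹' {1}).indicator D - (W ⁻¹' {-1}).indicator D := by
    ext ω
    cases h1 : E.treat true ω <;> cases h0 : E.treat false ω <;>
      norm_num [Set.indicator, hW, treatNum, h1, h0, bit]
  have e2 : (fun ω => E.treatNum true ω - E.treatNum false ω) =
      (W ⁻¹' {1}).indicator (fun _ => (1 : ℝ)) - (W ⁻¹' {-1}).indicator (fun _ => (1 : ℝ)) := by
    ext ω
    cases h1 : E.treat true ω <;> cases h0 : E.treat false ω <;>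
      norm_num [Set.indicator, hW, treatNum, h1, h0, bit]
  have c1 := condExp_sub (iD.indicator (hWm 1)) (iD.indicator (hWm (-1))) E.sigmaX
  have c2 := condExp_sub (μ := μ) ((integrable_const (1 : ℝ)).indicator (hWm 1))
    ((integrable_const (1 : ℝ)).indicator (hWm (-1))) E.sigmaX
  have c3 := condExp_sub (E.integrable_treatNum (μ := μ) true)
    (E.integrable_treatNum (μ := μ) false) E.sigmaX
  have e3 : E.treatNum true - E.treatNum false =
      fun ω => E.treatNum true ω - E.treatNum false ω := rfl
  rw [e3, e2] at c3
  rw [e1]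
  filter_upwards [c1, c2, c3, fac 1, fac (-1)] with ω a1 a2 a3 a4 a5
  rw [a1, Pi.sub_apply, a4, a5]
  rw [a2, Pi.sub_apply, Pi.sub_apply] at a3
  rw [← a3]
  ring

/-- The ratio `δ(X)` is the conditional average treatment effect. -/
theorem delta_obsLaw (hL2 : ∀ a, MemLp (E.po a) 2 μ) (hIV : E.StandardIV μ)
    (hUC : E.UnconfoundedCompliance μ) :
    (fun ω => delta (E.obsLaw μ) (E.X ω)) =ᵐ[μ]
      μ[fun ω => E.po true ω - E.po false ω | E.sigmaX] := by
  have hG : (E.armOutcome true - E.armOutcome false) =ᵐ[μ] fun ω =>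
      (E.po true ω - E.po false ω) * (E.treatNum true ω - E.treatNum false ω) := by
    filter_upwards [armOutcome_ae_eq hIV true, armOutcome_ae_eq hIV false] with ω h1 h0
    rw [Pi.sub_apply, h1, h0]
    cases h1 : E.treat true ω <;> cases h0 : E.treat false ω <;>
      simp [treatNum, h1, h0, bit]
  have c1 := condExp_sub (integrable_armOutcome hL2 hIV true)
    (integrable_armOutcome hL2 hIV false) E.sigmaX
  filter_upwards [c1, condExp_congr_ae (m := E.sigmaX) hG,
    condExp_effect_mul_compliance hL2 hUC, deltaA_obsLaw hIV, deltaY_obsLaw hL2 hIV,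
    propensity_pos hIV] with ω a1 a2 a3 a4 a5 a6
  rw [delta, a4, a5, div_eq_iff a6.2, ← a3, ← a2, a1, Pi.sub_apply]

theorem memLp_delta_obsLaw (hL2 : ∀ a, MemLp (E.po a) 2 μ) (hIV : E.StandardIV μ)
    (hUC : E.UnconfoundedCompliance μ) :
    MemLp (delta (E.obsLaw μ)) 2 (lawX (E.obsLaw μ)) := by
  rw [lawX_obsLaw, memLp_map_measure_iff (measurable_delta _).aestronglyMeasurable
    E.measurable_X.aemeasurable]
  exact (((hL2 true).sub (hL2 false)).condExp one_le_two).ae_eq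
    (delta_obsLaw hL2 hIV hUC).symm

theorem ivFunctional_obsLaw (hL2 : ∀ a, MemLp (E.po a) 2 μ) (hIV : E.StandardIV μ)
    (hUC : E.UnconfoundedCompliance μ) : ivFunctional (E.obsLaw μ) = E.ate μ := by
  rw [ivFunctional, E.integral_lawX (measurable_delta _),
    integral_congr_ae (delta_obsLaw hL2 hIV hUC), integral_condExp E.sigmaX_le,
    integral_sub ((hL2 true).integrable one_le_two) ((hL2 false).integrable one_le_two), ate]

theorem obsLaw_mem_nonparametricModel (hL2 : ∀ a, MemLp (E.po a) 2 μ) (hIV : E.StandardIV μ)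
    (hUC : E.UnconfoundedCompliance μ) : E.obsLaw μ ∈ nonparametricModel m := by
  refine ⟨?_, fun z => ?_, ?_, (memLp_delta_obsLaw hL2 hIV hUC).integrable one_le_two⟩
  · exact (memLp_map_measure_iff (by fun_prop) E.measurable_obs.aemeasurable).2 (memLp_Y hL2 hIV)
  · refine E.ae_lawX_of_ae (measurableSet_lt measurable_const (measurable_propensity _ z)) ?_
    filter_upwards [propensity_pos hIV] with ω h using h.1 z
  · refine E.ae_lawX_of_ae (measurable_deltaA _ (measurableSet_singleton 0).compl) ?_
    filter_upwards [propensity_pos hIV, deltaA_obsLaw hIV] with ω h1 h2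
    rw [h2]; exact h1.2

end IVExperiment

theorem theorem1 {m : ℕ} {Ω 𝒰 : Type*} [MeasurableSpace Ω] [StandardBorelSpace Ω]
    [MeasurableSpace 𝒰] (μ : Measure Ω) [IsProbabilityMeasure μ] (E : IVExperiment m Ω 𝒰)
    (hL2 : ∀ a, MemLp (E.po a) 2 μ)
    (hIV : E.StandardIV μ) (hUC : E.UnconfoundedCompliance μ)
    (π : EuclideanSpace ℝ (Fin m) → ℝ) (hπ : Measurable π) (hpol : E.FollowsPolicy μ π) :
    ObsLaw.ivFunctional (E.obsLaw μ) = E.ate μ ∧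
    efficiencyBound (ObsLaw.fixedPolicyModel π) (ObsLaw.LocallyUniformStrength (E.obsLaw μ))
      ObsLaw.ivFunctional (E.obsLaw μ) = ObsLaw.vEff (E.obsLaw μ) π (E.ate μ) ∧
    efficiencyBound (ObsLaw.nonparametricModel m) (ObsLaw.LocallyUniformStrength (E.obsLaw μ))
      ObsLaw.ivFunctional (E.obsLaw μ) = ObsLaw.vEff (E.obsLaw μ) π (E.ate μ) := by
  have hP := IVExperiment.obsLaw_mem_nonparametricModel hL2 hIV hUC
  have hτ := IVExperiment.ivFunctional_obsLaw hL2 hIV hUC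
  have h := ObsLaw.efficiencyBound_eq_vEff hP (IVExperiment.memLp_delta_obsLaw hL2 hIV hUC)
    (IVExperiment.propensity_obsLaw hπ hpol)
  rw [hτ] at h
  exact ⟨hτ, h⟩
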